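/- Let $K$ be a non-negative integer, $\gamma>0$, let $\alpha=(\alpha_1,\dots,\alpha_K)$ be real-valued functions in $H^\gamma$ of the circle $[0,2\pi]$ (periodic boundary conditions), let $T_1,\dots,T_K\ge 0$, $\mu\ge 0$ and $1/3\le s<1$. Put $B=\sqrt{1-\partial_x^2}$ and $\|f\|_{H^\sigma}=\|B^\sigma f\|_{L^2(dx)}$. For $\mathbf u=(u,r)$ with $u$ complex-valued and $r\in\mathbb R^K$ put $\|\mathbf u\|_{H^\sigma}=(|r|^2+\|u\|_{H^\sigma}^2)^{1/2}$ and $$\mathcal E(\mathbf u)=\tfrac12\|u\|_{H^1}^2+\tfrac12|r|^2+\tfrac{\mu}{4}\int_0^{2\pi}(\operatorname{Re}u)^4\,dx .$$ Let $\omega$ be a standard $K$-dimensional Brownian motion. Let $\mathbf u=(u,r)$ be the solution in $C([0,t],H^s\times\mathbb R^K)$ of $$ i\partial_t u=Bu+B^{-1}(\mu\phi^3+r\cdot\alpha),\qquad dr_j=-(r_j-\langle\alpha_j,\pi\rangle)\,dt+\sqrt{2T_j}\,d\omega_j,\qquad \phi=\operatorname{Re}u,\ \pi=B\operatorname{Im}u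 ,$$ (where $\int_0^t\langle\alpha_j,\pi\rangle dt'$ is understood as $\langle\alpha_j,\int_0^t\pi\,dt'\rangle$), and let $\mathbf u_o=(u_o,r_o)$ be the solution of the same system with $\mu$ replaced by $0$, with the same (deterministic) initial data and the same Brownian motion. With $P_{>N}$ the projection onto the Fourier modes $|k|>N$, set $$ I_N(t)=\mathcal E\big(u(t)-P_{>N}u_o(t),\ r(t)-r_o(t)\big),\qquad \theta_*=\min\{\tfrac13(4s-1),\tfrac13(1-s),\gamma\}.$$ Let $\theta>0$ and $\delta>0$ satisfy $\theta+\delta<\theta_*$. Then there are constants $c,C>0$ such that for every $R>1$ and every $\beta>0$ there are $N_o=N_o(R,\beta)$ and $\tau=\tau(R,\beta)>0$ with the following property: for all initial data with $\|\mathbf u(0)\|_{H^s}=\|\mathbf u_o(0)\|_{H^s}=\beta$, all $N\ge N_o$ and all $0<t\le\tau N^\delta$, $$ P\Big\{\sup_{t'\le t}I_N(t')>R\beta^2N^{2(1-s)}\Big\}\le C\exp\Big(-\frac{cN^{2\theta}}{t(1+t)^2}\Big),$$ where the event on the left is taken to include the event that $\mathbf u$ or $\mathbf u_o$ fails to exist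 on $[0,t]$. -/

import Mathlib

open MeasureTheory ProbabilityTheory Filter Topology
open scoped NNReal ENNReal

noncomputable section

/-- The positive length of the circle, needed for the theory of Fourier coefficients. -/
instance factTwoPiPos : Fact (0 < 2 * Real.pi) := ⟨Real.two_pi_pos⟩

/-- The circle obtained from `[0, 2π]` with periodic boundary conditions; its `volume` is
Lebesgue measure `dx`, of total mass `2π`. -/
abbrev Torus : Type := AddCircle (2 * Real.pi)

/-- The symbol `⟨k⟩ = (1 + k²)^{1/2}` of the operator `B = (1 - ∂ₓ²)^{1/2}`. -/
def bracket (k : ℤ) : ℝ := Real.sqrt (1 + (k : ℝ) ^ 2)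

/-- The square of the Sobolev norm, `‖f‖²_{H^σ} = ‖B^σ f‖²_{L²(dx)} = 2π ∑ₖ ⟨k⟩^{2σ} |f̂(k)|²`,
where `f̂(k) = (2π)⁻¹ ∫ f(x) e^{-ikx} dx`; it is `∞` where the series diverges. -/
def sobolevNormSq (σ : ℝ) (f : Torus → ℂ) : ℝ≥0∞ :=
  ENNReal.ofReal (2 * Real.pi) *
    ∑' k : ℤ, ENNReal.ofReal (bracket k ^ (2 * σ) * ‖fourierCoeff f k‖ ^ 2)

/-- Membership in `H^σ` of the circle, for `σ ≥ 0`. -/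
def MemSobolev (σ : ℝ) (f : Torus → ℂ) : Prop :=
  MemLp f 2 (volume : Measure Torus) ∧ sobolevNormSq σ f < ∞

/-- The norm `‖(u, r)‖_{H^σ} = (|r|² + ‖u‖²_{H^σ})^{1/2}` on `H^σ × ℝ^K`. -/
def stateNorm {K : ℕ} (σ : ℝ) (u : Torus → ℂ) (r : EuclideanSpace ℝ (Fin K)) : ℝ≥0∞ :=
  (‖r‖ₑ ^ 2 + sobolevNormSq σ u) ^ (1 / 2 : ℝ)

/-- The energy `𝓔(u, r) = ½ ‖u‖²_{H¹} + ½ |r|² + (μ/4) ∫ (Re u)⁴ dx`. -/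
def energy {K : ℕ} (μ : ℝ) (u : Torus → ℂ) (r : EuclideanSpace ℝ (Fin K)) : ℝ≥0∞ :=
  2⁻¹ * sobolevNormSq 1 u + 2⁻¹ * ‖r‖ₑ ^ 2 +
    ENNReal.ofReal (μ / 4) * ∫⁻ x : Torus, ‖(u x).re‖ₑ ^ 4

/-- The projection `P_{≤ N}` onto the Fourier modes `|k| ≤ N`. -/
def lowModes (N : ℕ) (f : Torus → ℂ) : Torus → ℂ :=
  fun x => ∑ k ∈ Finset.Icc (-(N : ℤ)) (N : ℤ), fourierCoeff f k * fourier k x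

/-- The projection `P_{> N}` onto the Fourier modes `|k| > N`. -/
def highModes (N : ℕ) (f : Torus → ℂ) : Torus → ℂ := f - lowModes N f

/-- `(u, r)` is a solution in `C([0, a], H^s × ℝ^K)`, `s ≥ 1/3`, with initial data `(u₀, r₀)`, of

  `i ∂ₜ u = B u + B⁻¹ (μ φ³ + r · α)`,   `φ = Re u`,   `π = B Im u`,
  `drⱼ = -(rⱼ - ⟨αⱼ, π⟩) dt + √(2 Tⱼ) dwⱼ`,

for the driving path `w`. Since the noise is additive, the equations are imposed path by path, in
the form integrated over `[0, t]`. The field equation is written in Fourier coefficients. Since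
`π(t)` is only a distribution in `H^{s-1}` while `αⱼ` is in `H^γ` with an arbitrarily small
`γ > 0`, the drift `∫₀ᵗ ⟨αⱼ, π(t')⟩ dt'` is understood (as for mild solutions of linear evolution
equations) as `⟨αⱼ, ∫₀ᵗ π(t') dt'⟩`, an `L²` pairing, which is
`2π ∑ₖ conj(α̂ⱼ(k)) ∫₀ᵗ ⟨k⟩ (Im u(t'))^(k) dt'`. -/
structure IsSolutionOn {K : ℕ} (μ s : ℝ) (α : Fin K → Torus → ℝ) (T : Fin K → ℝ)
    (w : ℝ → Fin K → ℝ) (u₀ : Torus → ℂ) (r₀ : EuclideanSpace ℝ (Fin K)) (a : ℝ)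
    (u : ℝ → Torus → ℂ) (r : ℝ → EuclideanSpace ℝ (Fin K)) : Prop where
  mem : ∀ t ∈ Set.Icc 0 a, MemSobolev s (u t)
  continuous_field : ∀ t ∈ Set.Icc 0 a,
    Tendsto (fun t' => sobolevNormSq s (u t' - u t)) (𝓝[Set.Icc 0 a] t) (𝓝 0)
  continuous_reservoir : ContinuousOn r (Set.Icc 0 a)
  init_field : u 0 =ᵐ[volume] u₀
  init_reservoir : r 0 = r₀
  field_eq : ∀ t ∈ Set.Icc 0 a, ∀ k : ℤ,
    Complex.I * (fourierCoeff (u t) k - fourierCoeff (u 0) k) =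
      ∫ t' in (0 : ℝ)..t,
        ((bracket k : ℂ) * fourierCoeff (u t') k +
          (bracket k : ℂ)⁻¹ *
            ((μ : ℂ) * fourierCoeff (fun x => (((u t' x).re ^ 3 : ℝ) : ℂ)) k +
              ∑ j, (r t' j : ℂ) * fourierCoeff (fun x => (α j x : ℂ)) k))
  reservoir_eq : ∀ t ∈ Set.Icc 0 a, ∀ j : Fin K,
    HasSum
      (fun k : ℤ => 2 * (Real.pi : ℂ) *
        starRingEnd ℂ (fourierCoeff (fun x => (α j x : ℂ)) k) *
        ∫ t' in (0 : ℝ)..t, (bracket k : ℂ) * fourierCoeff (fun x => ((u t' x).im : ℂ)) k)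
      ((r t j - r 0 j + (∫ t' in (0 : ℝ)..t, r t' j) - Real.sqrt (2 * T j) * w t j : ℝ) : ℂ)

/-- The modified energy `I_N(t) = 𝓔(u(t) - P_{> N} uₒ(t), r(t) - rₒ(t))`. -/
def modifiedEnergy {K : ℕ} (μ : ℝ) (N : ℕ)
    (u : ℝ → Torus → ℂ) (r : ℝ → EuclideanSpace ℝ (Fin K))
    (uo : ℝ → Torus → ℂ) (ro : ℝ → EuclideanSpace ℝ (Fin K)) (t : ℝ) : ℝ≥0∞ :=
  energy μ (u t - highModes N (uo t)) (r t - ro t)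

/-- The exponent `θ_* = min {(4s - 1)/3, (1 - s)/3, γ}`. -/
def thetaStar (s γ : ℝ) : ℝ := min (min ((4 * s - 1) / 3) ((1 - s) / 3)) γ

/-- `W` is a standard `K`-dimensional Brownian motion under `P`. -/
structure IsBrownianVector {Ω : Type*} [MeasurableSpace Ω] {K : ℕ}
    (W : Fin K → ℝ≥0 → Ω → ℝ) (P : Measure Ω) : Prop where
  brownian : ∀ j, IsBrownianReal (W j) P
  indep : iIndepFun (fun j ω => fun t => W j t ω) P

/-- For the driving path `w`, the bound `sup_{0 ≤ t' ≤ t} I_N(t') ≤ M` fails: either the nonlinear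
system (coupling `μ`) or the linear one (coupling `0`), with common initial data `(u₀, r₀)` and
common noise `w`, has no solution up to time `t`, or they have solutions with
`sup_{0 ≤ t' ≤ t} I_N(t') > M`. -/
def EnergyBoundFails {K : ℕ} (μ s : ℝ) (α : Fin K → Torus → ℝ) (T : Fin K → ℝ)
    (w : ℝ → Fin K → ℝ) (u₀ : Torus → ℂ) (r₀ : EuclideanSpace ℝ (Fin K))
    (N : ℕ) (t : ℝ) (M : ℝ≥0∞) : Prop :=
  (¬ ∃ u r, IsSolutionOn μ s α T w u₀ r₀ t u r) ∨
  (¬ ∃ uo ro, IsSolutionOn 0 s α T w u₀ r₀ t uo ro) ∨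
  ∃ u r uo ro, IsSolutionOn μ s α T w u₀ r₀ t u r ∧ IsSolutionOn 0 s α T w u₀ r₀ t uo ro ∧
    M < ⨆ t' ∈ Set.Icc 0 t, modifiedEnergy μ N u r uo ro t'

end

noncomputable section

/-! The initial field is only in `H^s`, so the energy of `u` may be infinite. The force, however,
enters through `B⁻¹`, so `u` is a free wave plus a Duhamel term in `H¹`. Subtracting `P_{>N} uₒ`
removes the rough high modes of the free wave. The field `V = B(u - P_{>N} uₒ)` is then in `L²`,
with initial energy at most about `β² N^{2(1-s)} / 2`. The noise is additive and common to both
systems, so it cancels in `q = r - rₒ`. The modified energy is therefore differentiable in time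
along each path, and no stochastic calculus is needed.

The linear system is controlled by its own energy method (`linear_energy_bound`). If the free wave
and the noise force the reservoirs by at most `G`, then the Duhamel part of `B uₒ` and the
reservoirs `rₒ` grow at most linearly in time, with slope proportional to `G`.

In the derivative of the modified energy the Hamiltonian terms cancel (`nonlinear_energy_bound`).
With `ψ = Re B⁻¹V` and `z = P_{>N} Re uₒ`, what survives is `μ((ψ+z)³ - ψ³)`, the low modes of the
linear force, and the coupling of `q` to `P_{≤N} uₒ`. As long as the energy is at most `M = Rβ²
N^{2(1-s)}`, Gagliardo-Nirenberg (`reL_smoothing_cube_le`) bounds `‖ψ‖_∞` by a power `M^{1/3}`, the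
embedding `H^{1/3} ⊂ L⁶` bounds `z` in `L⁶`, and the frequency cut-off gives `z` the size `N^{-s}`
in `L²`.

Put `ε = θ + δ`. For times up to `N^δ` and noise up to `N^θ`, the linear quantities are `O(N^ε)`.
The growth rate is then `O(N^{2(1-s)-ε})`: the term `ψ²z` requires `ε < (4s-1)/3`, the term `ψz²`
requires `ε < (1-s)/3`, and the coupling to `P_{≤N} uₒ` requires `ε < γ` (`powerBound_energyRate`).
Over a time `N^δ` the growth is `O(N^{2(1-s)-θ})`, below any fixed fraction of `β² N^{2(1-s)}` once
`N` is large.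

The same bounds are a priori bounds, so solutions exist: a truncated system has solutions by
Picard-Lindelöf, and the truncation is never reached (`exists_isMildSolution`). Hence failure forces
some Brownian component to exceed `N^θ` before time `t`, apart from a null set of irregular paths.
Chaining over dyadic times bounds this probability by a multiple of `exp(-N^{2θ}/(32t))`
(`measure_brownian_le`). -/

/-- The normalised Haar measure of the circle. -/
abbrev haarT : Measure Torus := AddCircle.haarAddCircle

/-! ### Fourier coefficients and multipliers on `L²`. -/

abbrev L2C : Type := Lp ℂ 2 haarT
abbrev L2R : Type := Lp ℝ 2 haarT

theorem one_le_bracket (k : ℤ) : 1 ≤ bracket k := by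
  unfold bracket
  rw [Real.one_le_sqrt]
  nlinarith [sq_nonneg (k : ℝ)]

theorem bracket_pos (k : ℤ) : 0 < bracket k := lt_of_lt_of_le one_pos (one_le_bracket k)

theorem bracket_neg (k : ℤ) : bracket (-k) = bracket k := by simp [bracket]

theorem bracket_sq (k : ℤ) : bracket k ^ 2 = 1 + (k : ℝ) ^ 2 :=
  Real.sq_sqrt (by positivity)

theorem abs_le_bracket (k : ℤ) : |(k : ℝ)| ≤ bracket k := by
  apply Real.abs_le_sqrt
  linarith

/-- The Fourier coefficients as continuous linear functionals on `L²`. -/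
def coef (k : ℤ) : L2C →L[ℂ] ℂ := innerSL ℂ (fourierBasis k)

theorem coef_eq_repr (k : ℤ) (f : L2C) : coef k f = fourierBasis.repr f k := by
  rw [coef, innerSL_apply_apply, HilbertBasis.repr_apply_apply]

theorem coef_eq_fourierCoeff (k : ℤ) (f : L2C) : coef k f = fourierCoeff f k := by
  rw [coef_eq_repr, fourierBasis_repr]

theorem coef_ext {f g : L2C} (h : ∀ k, coef k f = coef k g) : f = g := by
  apply fourierBasis.repr.injective
  ext k
  rw [← coef_eq_repr, ← coef_eq_repr, h]

theorem fourierCoeff_eq_coef {f : Torus → ℂ} {g : L2C} (h : f =ᵐ[haarT] g) (k : ℤ) :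
    fourierCoeff f k = coef k g := by
  rw [coef_eq_fourierCoeff, fourierCoeff_congr_ae h]

theorem hasSum_inner_coef (f g : L2C) :
    HasSum (fun k => starRingEnd ℂ (coef k f) * coef k g) (inner ℂ f g) := by
  have h := fourierBasis.hasSum_inner_mul_inner f g
  have h2 : ∀ k, inner ℂ f (fourierBasis k) = starRingEnd ℂ (coef k f) := fun k => by
    rw [coef, innerSL_apply_apply, inner_conj_symm]
  simp only [h2] at h
  exact h

theorem hasSum_norm_coef_sq (f : L2C) : HasSum (fun k => ‖coef k f‖ ^ 2) (‖f‖ ^ 2) := by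
  have h := lp.hasSum_norm (p := 2) (by norm_num) (fourierBasis.repr f)
  simpa [coef_eq_repr] using h

theorem exists_coef_eq {a : ℤ → ℂ} (ha : Summable fun k => ‖a k‖ ^ 2) :
    ∃ f : L2C, ∀ k, coef k f = a k := by
  have hm : Memℓp a 2 := memℓp_gen (by simpa using ha)
  exact ⟨fourierBasis.repr.symm ⟨a, hm⟩, fun k => by simp [coef_eq_repr]⟩

theorem memℓp_mul {m : ℤ → ℂ} {C : ℝ} (hm : ∀ k, ‖m k‖ ≤ C) {a : ℤ → ℂ} (ha : Memℓp a 2) :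
    Memℓp (fun k => m k * a k) 2 := by
  have h := (memℓp_gen_iff (by norm_num)).1 ha
  apply memℓp_gen
  refine Summable.of_nonneg_of_le (fun k => by positivity) (fun k => ?_) (h.mul_left (C ^ 2))
  simp only [ENNReal.toReal_ofNat, Real.rpow_ofNat, norm_mul, mul_pow]
  have := hm k
  gcongr

/-- The Fourier multiplier with symbol `m` (and `0` if the symbol is unbounded). -/
def mult (m : ℤ → ℂ) : L2C →L[ℂ] L2C :=
  open Classical in
  if h : ∃ C : ℝ, ∀ k, ‖m k‖ ≤ C then
    LinearMap.mkContinuous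
      { toFun := fun f => fourierBasis.repr.symm
          ⟨fun k => m k * fourierBasis.repr f k, memℓp_mul h.choose_spec (lp.memℓp _)⟩
        map_add' := fun f g => by
          rw [← map_add]; congr 1; ext k; simp [mul_add]; rfl
        map_smul' := fun c f => by
          rw [RingHom.id_apply, ← map_smul]; congr 1; ext k; simp [mul_left_comm] }
      |h.choose| (fun f => by
        set g : L2C := fourierBasis.repr.symm
          ⟨fun k => m k * fourierBasis.repr f k, memℓp_mul h.choose_spec (lp.memℓp _)⟩ with hg
        have hc : ∀ k, coef k g = m k * coef k f := fun k => by simp [coef_eq_repr, hg]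
        change ‖g‖ ≤ _
        refine le_of_sq_le_sq ?_ (by positivity)
        rw [mul_pow]
        refine hasSum_le (fun k => ?_) (hasSum_norm_coef_sq g)
          ((hasSum_norm_coef_sq f).mul_left _)
        rw [hc, norm_mul, mul_pow]
        have := (h.choose_spec k).trans (le_abs_self _)
        gcongr)
  else 0

theorem coef_mult {m : ℤ → ℂ} {C : ℝ} (hm : ∀ k, ‖m k‖ ≤ C) (f : L2C) (k : ℤ) :
    coef k (mult m f) = m k * coef k f := by
  have h : ∃ C : ℝ, ∀ k, ‖m k‖ ≤ C := ⟨C, hm⟩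
  simp [mult, h, coef_eq_repr]

theorem norm_le_of_coef {f g : L2C} {C : ℝ} (hC : 0 ≤ C)
    (h : ∀ k, ‖coef k f‖ ≤ C * ‖coef k g‖) : ‖f‖ ≤ C * ‖g‖ := by
  refine le_of_sq_le_sq ?_ (by positivity)
  rw [mul_pow]
  refine hasSum_le (fun k => ?_) (hasSum_norm_coef_sq f) ((hasSum_norm_coef_sq g).mul_left _)
  rw [← mul_pow]
  have := h k
  gcongr

theorem norm_eq_of_coef {f g : L2C} (h : ∀ k, ‖coef k f‖ = ‖coef k g‖) : ‖f‖ = ‖g‖ := by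
  apply le_antisymm
  · simpa using norm_le_of_coef zero_le_one (fun k => by rw [h k, one_mul])
  · simpa using norm_le_of_coef zero_le_one (fun k => by rw [h k, one_mul])

/-- The operator `B^{-σ}`, for `σ ≥ 0`. -/
def smoothing (σ : ℝ) : L2C →L[ℂ] L2C := mult fun k => ((bracket k ^ (-σ) : ℝ) : ℂ)

theorem bracket_rpow_neg_le_one {σ : ℝ} (hσ : 0 ≤ σ) (k : ℤ) : bracket k ^ (-σ) ≤ 1 :=
  Real.rpow_le_one_of_one_le_of_nonpos (one_le_bracket k) (by linarith)

theorem bracket_rpow_pos (σ : ℝ) (k : ℤ) : 0 < bracket k ^ σ := Real.rpow_pos_of_pos (bracket_pos k) _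

theorem coef_smoothing {σ : ℝ} (hσ : 0 ≤ σ) (f : L2C) (k : ℤ) :
    coef k (smoothing σ f) = ((bracket k ^ (-σ) : ℝ) : ℂ) * coef k f := by
  refine coef_mult (C := 1) (fun k => ?_) f k
  rw [Complex.norm_real, Real.norm_of_nonneg (bracket_rpow_pos _ _).le]
  exact bracket_rpow_neg_le_one hσ k

theorem norm_smoothing_le {σ : ℝ} (hσ : 0 ≤ σ) (f : L2C) : ‖smoothing σ f‖ ≤ ‖f‖ := by
  rw [← one_mul ‖f‖]
  refine norm_le_of_coef zero_le_one fun k => ?_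
  rw [coef_smoothing hσ, norm_mul, Complex.norm_real,
    Real.norm_of_nonneg (bracket_rpow_pos _ _).le]
  have := bracket_rpow_neg_le_one hσ k
  gcongr

theorem smoothing_add {σ τ : ℝ} (hσ : 0 ≤ σ) (hτ : 0 ≤ τ) (f : L2C) :
    smoothing σ (smoothing τ f) = smoothing (σ + τ) f := by
  refine coef_ext fun k => ?_
  rw [coef_smoothing hσ, coef_smoothing hτ, coef_smoothing (add_nonneg hσ hτ), ← mul_assoc,
    ← Complex.ofReal_mul, ← Real.rpow_add (bracket_pos k)]
  congr 3; ring

/-- The group `e^{-itB}`. -/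
def waveGroup (t : ℝ) : L2C →L[ℂ] L2C := mult fun k => Complex.exp (-(bracket k * t : ℝ) * Complex.I)

theorem coef_waveGroup (t : ℝ) (f : L2C) (k : ℤ) :
    coef k (waveGroup t f) = Complex.exp (-(bracket k * t : ℝ) * Complex.I) * coef k f := by
  refine coef_mult (C := 1) (fun k => ?_) f k
  rw [← Complex.ofReal_neg, Complex.norm_exp_ofReal_mul_I]

theorem norm_waveGroup (t : ℝ) (f : L2C) : ‖waveGroup t f‖ = ‖f‖ := by
  refine norm_eq_of_coef fun k => ?_
  rw [coef_waveGroup, norm_mul, ← Complex.ofReal_neg, Complex.norm_exp_ofReal_mul_I, one_mul]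

theorem waveGroup_zero (f : L2C) : waveGroup 0 f = f :=
  coef_ext fun k => by simp [coef_waveGroup]

theorem waveGroup_smoothing {σ : ℝ} (hσ : 0 ≤ σ) (t : ℝ) (f : L2C) :
    waveGroup t (smoothing σ f) = smoothing σ (waveGroup t f) := by
  refine coef_ext fun k => ?_
  simp only [coef_waveGroup, coef_smoothing hσ]
  ring

/-- The operator `P_{≤ N} B^σ`. -/
def lowPower (N : ℕ) (σ : ℝ) : L2C →L[ℂ] L2C :=
  mult fun k => if |k| ≤ N then ((bracket k ^ σ : ℝ) : ℂ) else 0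

theorem lowPower_bound (N : ℕ) (σ : ℝ) : ∃ C : ℝ, ∀ k : ℤ,
    ‖if |k| ≤ N then ((bracket k ^ σ : ℝ) : ℂ) else 0‖ ≤ C := by
  refine ⟨∑ k ∈ Finset.Icc (-(N : ℤ)) N, bracket k ^ σ, fun k => ?_⟩
  have h0 : ∀ k ∈ Finset.Icc (-(N : ℤ)) N, 0 ≤ bracket k ^ σ := fun k _ => (bracket_rpow_pos _ _).le
  split_ifs with h
  · rw [Complex.norm_real, Real.norm_of_nonneg (bracket_rpow_pos _ _).le]
    exact Finset.single_le_sum h0 (by simpa [abs_le] using h)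
  · simpa using Finset.sum_nonneg h0

theorem coef_lowPower (N : ℕ) (σ : ℝ) (f : L2C) (k : ℤ) :
    coef k (lowPower N σ f) = (if |k| ≤ N then ((bracket k ^ σ : ℝ) : ℂ) else 0) * coef k f := by
  obtain ⟨C, hC⟩ := lowPower_bound N σ
  exact coef_mult hC f k

theorem bracket_le_of_abs_le {k : ℤ} {N : ℕ} (h : |k| ≤ N) : bracket k ≤ bracket N := by
  apply Real.sqrt_le_sqrt
  have : |(k : ℝ)| ≤ |((N : ℤ) : ℝ)| := by
    rw [← Int.cast_abs, ← Int.cast_abs]; exact_mod_cast (by simpa using h)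
  have := sq_le_sq.2 this
  linarith

theorem norm_lowPower_le (N : ℕ) {σ : ℝ} (hσ : 0 ≤ σ) (f : L2C) :
    ‖lowPower N σ f‖ ≤ bracket N ^ σ * ‖f‖ := by
  refine norm_le_of_coef (bracket_rpow_pos _ _).le fun k => ?_
  rw [coef_lowPower, norm_mul]
  gcongr
  split_ifs with h
  · rw [Complex.norm_real, Real.norm_of_nonneg (bracket_rpow_pos _ _).le]
    exact Real.rpow_le_rpow (bracket_pos k).le (bracket_le_of_abs_le h) hσ
  · simpa using (bracket_rpow_pos _ _).le

/-- The projection `P_{> N}` on `L²`. -/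
def highProj (N : ℕ) : L2C →L[ℂ] L2C := ContinuousLinearMap.id ℂ L2C - lowPower N 0

theorem coef_highProj (N : ℕ) (f : L2C) (k : ℤ) :
    coef k (highProj N f) = if |k| ≤ N then 0 else coef k f := by
  simp only [highProj, sub_apply, ContinuousLinearMap.id_apply, map_sub,
    coef_lowPower]
  split_ifs <;> simp

theorem norm_highProj_le (N : ℕ) (f : L2C) : ‖highProj N f‖ ≤ ‖f‖ := by
  rw [← one_mul ‖f‖]
  refine norm_le_of_coef zero_le_one fun k => ?_
  rw [coef_highProj]
  split_ifs <;> simp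

/-! ### Real and imaginary parts on `L²`. -/

/-- Real part, imaginary part and inclusion of the real functions, on `L²`. -/
def reL : L2C →L[ℝ] L2R := Complex.reCLM.compLpL 2 haarT
def imL : L2C →L[ℝ] L2R := Complex.imCLM.compLpL 2 haarT
def conjL : L2C →L[ℝ] L2C := (Complex.conjCLE : ℂ →L[ℝ] ℂ).compLpL 2 haarT
def ofRealL : L2R →L[ℝ] L2C := Complex.ofRealCLM.compLpL 2 haarT

theorem coeFn_reL (f : L2C) : reL f =ᵐ[haarT] fun x => (f x).re :=
  Complex.reCLM.coeFn_compLpL f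
theorem coeFn_imL (f : L2C) : imL f =ᵐ[haarT] fun x => (f x).im :=
  Complex.imCLM.coeFn_compLpL f
theorem coeFn_conjL (f : L2C) : conjL f =ᵐ[haarT] fun x => starRingEnd ℂ (f x) :=
  ContinuousLinearMap.coeFn_compLpL _ f
theorem coeFn_ofRealL (f : L2R) : ofRealL f =ᵐ[haarT] fun x => (f x : ℂ) :=
  Complex.ofRealCLM.coeFn_compLpL f

theorem coef_conjL (f : L2C) (k : ℤ) : coef k (conjL f) = starRingEnd ℂ (coef (-k) f) := by
  rw [coef_eq_fourierCoeff, coef_eq_fourierCoeff, fourierCoeff_congr_ae (coeFn_conjL f),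
    fourierCoeff, fourierCoeff, ← integral_conj]
  refine integral_congr_ae (Eventually.of_forall fun x => ?_)
  simp

theorem ofRealL_reL (f : L2C) : ofRealL (reL f) = (1 / 2 : ℂ) • (f + conjL f) := by
  apply Lp.ext
  filter_upwards [coeFn_ofRealL (reL f), coeFn_reL f, coeFn_conjL f,
    Lp.coeFn_smul (1 / 2 : ℂ) (f + conjL f), Lp.coeFn_add f (conjL f)] with x h1 h2 h3 h4 h5
  rw [h1, h2, h4, Pi.smul_apply, h5, Pi.add_apply, h3, Complex.add_conj]
  simp

theorem ofRealL_imL (f : L2C) : ofRealL (imL f) = (1 / (2 * Complex.I) : ℂ) • (f - conjL f) := by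
  apply Lp.ext
  filter_upwards [coeFn_ofRealL (imL f), coeFn_imL f, coeFn_conjL f,
    Lp.coeFn_smul (1 / (2 * Complex.I) : ℂ) (f - conjL f), Lp.coeFn_sub f (conjL f)]
    with x h1 h2 h3 h4 h5
  rw [h1, h2, h4, Pi.smul_apply, h5, Pi.sub_apply, h3, Complex.sub_conj]
  simp [field]

theorem coef_ofRealL_reL (f : L2C) (k : ℤ) :
    coef k (ofRealL (reL f)) = (coef k f + starRingEnd ℂ (coef (-k) f)) / 2 := by
  rw [ofRealL_reL, map_smul, map_add, coef_conjL, smul_eq_mul]; ring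

theorem coef_ofRealL_imL (f : L2C) (k : ℤ) :
    coef k (ofRealL (imL f)) = (coef k f - starRingEnd ℂ (coef (-k) f)) / (2 * Complex.I) := by
  rw [ofRealL_imL, map_smul, map_sub, coef_conjL, smul_eq_mul]; ring

theorem reL_ofRealL (f : L2R) : reL (ofRealL f) = f := by
  apply Lp.ext
  filter_upwards [coeFn_ofRealL f, coeFn_reL (ofRealL f)] with x h1 h2
  rw [h2, h1, Complex.ofReal_re]

theorem conjL_ofRealL (f : L2R) : conjL (ofRealL f) = ofRealL f := by
  apply Lp.ext
  filter_upwards [coeFn_ofRealL f, coeFn_conjL (ofRealL f)] with x h1 h2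
  rw [h2, h1, Complex.conj_ofReal]

theorem imL_eq_zero_of_conjL {f : L2C} (h : conjL f = f) : imL f = 0 := by
  have h2 : ofRealL (imL f) = 0 := by rw [ofRealL_imL, h, sub_self, smul_zero]
  rw [← reL_ofRealL (imL f), h2, map_zero]

theorem coef_ofRealL_neg (f : L2R) (k : ℤ) :
    coef (-k) (ofRealL f) = starRingEnd ℂ (coef k (ofRealL f)) := by
  rw [← conjL_ofRealL, coef_conjL, conjL_ofRealL, neg_neg]

/-- The symbol of `B^{-σ}` is real and even. Consequently the real force does not enter the equation
of `Re u`, which is just `∂ₜφ = π`. -/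
theorem imL_smoothing_ofRealL {σ : ℝ} (hσ : 0 ≤ σ) (f : L2R) :
    imL (smoothing σ (ofRealL f)) = 0 := by
  apply imL_eq_zero_of_conjL
  refine coef_ext fun k => ?_
  rw [coef_conjL, coef_smoothing hσ, coef_smoothing hσ, map_mul, Complex.conj_ofReal, bracket_neg,
    coef_ofRealL_neg, Complex.conj_conj]

theorem reL_neg_I_smul (f : L2C) : reL (-(Complex.I • f)) = imL f := by
  apply Lp.ext
  filter_upwards [coeFn_reL (-(Complex.I • f)), coeFn_imL f, Lp.coeFn_smul Complex.I f,
    Lp.coeFn_neg (Complex.I • f)] with x h1 h2 h3 h4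
  rw [h1, h4, Pi.neg_apply, h3, h2]
  simp

theorem norm_reL_le (f : L2C) : ‖reL f‖ ≤ ‖f‖ := by
  refine Lp.norm_le_norm_of_ae_le ?_
  filter_upwards [coeFn_reL f] with x h
  rw [h]
  exact Complex.abs_re_le_norm _

theorem norm_imL_le (f : L2C) : ‖imL f‖ ≤ ‖f‖ := by
  refine Lp.norm_le_norm_of_ae_le ?_
  filter_upwards [coeFn_imL f] with x h
  rw [h]
  exact Complex.abs_im_le_norm _

theorem norm_ofRealL (f : L2R) : ‖ofRealL f‖ = ‖f‖ := by
  have h : ∀ᵐ x ∂haarT, ‖ofRealL f x‖ = ‖f x‖ := by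
    filter_upwards [coeFn_ofRealL f] with x h
    rw [h, Complex.norm_real]
  exact le_antisymm (Lp.norm_le_norm_of_ae_le (h.mono fun _ h => h.le))
    (Lp.norm_le_norm_of_ae_le (h.mono fun _ h => h.ge))

theorem re_inner_ofRealL_right (f : L2C) (g : L2R) :
    (inner ℂ f (ofRealL g)).re = inner ℝ (reL f) g := by
  rw [L2.inner_def, L2.inner_def]
  have h := integral_re (L2.integrable_inner (𝕜 := ℂ) f (ofRealL g))
  have h' : ∀ z : ℂ, RCLike.re z = z.re := fun _ => rfl
  simp only [h'] at h
  rw [← h]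
  refine integral_congr_ae ?_
  filter_upwards [coeFn_ofRealL g, coeFn_reL f] with x h1 h2
  rw [h1, h2]
  simp [RCLike.inner_apply]

theorem re_inner_neg_I_smul_ofRealL (f : L2C) (g : L2R) :
    (inner ℂ f (-(Complex.I • ofRealL g))).re = -inner ℝ (imL f) g := by
  have h : inner ℂ f (-(Complex.I • ofRealL g)) = -inner ℂ (-(Complex.I • f)) (ofRealL g) := by
    simp [inner_smul_left, inner_smul_right]
  rw [h, Complex.neg_re, re_inner_ofRealL_right, reL_neg_I_smul]


/-! ### Translation of Sobolev norms and frequency projections to `L²`. -/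

theorem ae_haarT_iff {p : Torus → Prop} :
    (∀ᵐ x ∂(volume : Measure Torus), p x) ↔ ∀ᵐ x ∂haarT, p x := by
  rw [AddCircle.volume_eq_smul_haarAddCircle]
  exact Measure.ae_ennreal_smul_measure_iff (by simpa using Real.pi_pos)

theorem tsum_ofReal_norm_coef_sq (f : L2C) :
    ∑' k, ENNReal.ofReal (‖coef k f‖ ^ 2) = ENNReal.ofReal (‖f‖ ^ 2) := by
  rw [← (hasSum_norm_coef_sq f).tsum_eq,
    ENNReal.ofReal_tsum_of_nonneg (fun _ => by positivity) (hasSum_norm_coef_sq f).summable]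

theorem bracket_rpow_mul_sq {σ : ℝ} (hσ : 0 ≤ σ) (w : L2C) (k : ℤ) :
    bracket k ^ (2 * σ) * ‖coef k (smoothing σ w)‖ ^ 2 = ‖coef k w‖ ^ 2 := by
  rw [coef_smoothing hσ, norm_mul, Complex.norm_real,
    Real.norm_of_nonneg (bracket_rpow_pos _ _).le, mul_pow, ← Real.rpow_natCast (_ ^ (-σ)),
    ← Real.rpow_mul (bracket_pos k).le, ← mul_assoc, ← Real.rpow_add (bracket_pos k)]
  norm_num
  rw [show 2 * σ + -(σ * 2) = 0 by ring]
  simp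

theorem sobolevNormSq_of_ae {σ : ℝ} (hσ : 0 ≤ σ) {f : Torus → ℂ} {w : L2C}
    (h : f =ᵐ[haarT] smoothing σ w) :
    sobolevNormSq σ f = ENNReal.ofReal (2 * Real.pi * ‖w‖ ^ 2) := by
  rw [sobolevNormSq, ENNReal.ofReal_mul Real.two_pi_pos.le, ← tsum_ofReal_norm_coef_sq]
  congr 1
  refine tsum_congr fun k => ?_
  rw [fourierCoeff_eq_coef h, bracket_rpow_mul_sq hσ]

theorem memSobolev_of_ae {σ : ℝ} (hσ : 0 ≤ σ) {f : Torus → ℂ} {w : L2C}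
    (h : f =ᵐ[haarT] smoothing σ w) : MemSobolev σ f := by
  refine ⟨memLp_haarAddCircle_iff.1 ((memLp_congr_ae h).2 (Lp.memLp _)), ?_⟩
  rw [sobolevNormSq_of_ae hσ h]
  exact ENNReal.ofReal_lt_top

/-- Riesz-Fischer applied to `⟨k⟩^σ f̂(k)`. The whole analysis can thus be carried out for `w = B^s
u` in the fixed space `L²`. -/
theorem MemSobolev.exists_ae {σ : ℝ} (hσ : 0 ≤ σ) {f : Torus → ℂ} (h : MemSobolev σ f) :
    ∃ w : L2C, f =ᵐ[haarT] smoothing σ w := by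
  have hm : MemLp f 2 haarT := memLp_haarAddCircle_iff.2 h.1
  set g : L2C := hm.toLp f with hg
  have hfg : f =ᵐ[haarT] g := hm.coeFn_toLp.symm
  have hs : Summable fun k => ‖((bracket k ^ σ : ℝ) : ℂ) * coef k g‖ ^ 2 := by
    have h2 := h.2
    rw [sobolevNormSq] at h2
    have h3 : ∑' k : ℤ, ENNReal.ofReal (bracket k ^ (2 * σ) * ‖fourierCoeff f k‖ ^ 2) ≠ ∞ := by
      intro h4
      rw [h4, ENNReal.mul_top (by simpa using Real.pi_pos)] at h2
      exact lt_irrefl _ h2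
    have h4 := ENNReal.summable_toReal h3
    refine h4.congr fun k => ?_
    have := bracket_rpow_pos (2 * σ) k
    rw [ENNReal.toReal_ofReal (by positivity), fourierCoeff_eq_coef hfg, norm_mul,
      Complex.norm_real, Real.norm_of_nonneg (bracket_rpow_pos _ _).le, mul_pow,
      ← Real.rpow_natCast (_ ^ σ), ← Real.rpow_mul (bracket_pos k).le]
    congr 2
    push_cast; ring
  obtain ⟨w, hw⟩ := exists_coef_eq hs
  refine ⟨w, hfg.trans (Eq.eventuallyEq ?_)⟩
  congr 1
  refine congrArg _ (coef_ext fun k => ?_)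
  rw [coef_smoothing hσ, hw, ← mul_assoc, ← Complex.ofReal_mul, ← Real.rpow_add (bracket_pos k)]
  simp

theorem lowModes_ae {f : Torus → ℂ} {g : L2C} (h : f =ᵐ[haarT] g) (N : ℕ) :
    lowModes N f =ᵐ[haarT] lowPower N 0 g := by
  have h1 : lowPower N 0 g = ∑ k ∈ Finset.Icc (-(N : ℤ)) N, coef k g • fourierBasis k := by
    refine coef_ext fun j => ?_
    have horth : ∀ k, coef j (fourierBasis k) = if k = j then 1 else 0 := fun k => by
      rw [coef_eq_repr, HilbertBasis.repr_self, lp.single_apply, Pi.single_apply]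
      simp only [eq_comm]
    rw [coef_lowPower, map_sum]
    simp only [map_smul, horth, smul_eq_mul, mul_ite, mul_one, mul_zero, Finset.sum_ite_eq',
      Finset.mem_Icc, Real.rpow_zero, Complex.ofReal_one, ← abs_le]
    split_ifs <;> simp
  rw [h1]
  have h2 : ∀ k ∈ Finset.Icc (-(N : ℤ)) N,
      ⇑(coef k g • fourierBasis k : L2C) =ᵐ[haarT] fun x => fourierCoeff f k * fourier k x := by
    intro k _
    filter_upwards [Lp.coeFn_smul (coef k g) (fourierBasis k : L2C),
      coeFn_fourierLp (T := 2 * Real.pi) 2 k] with x hx1 hx2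
    rw [hx1, Pi.smul_apply, coe_fourierBasis, hx2, smul_eq_mul, fourierCoeff_eq_coef h]
  refine EventuallyEq.symm ?_
  refine (Lp.coeFn_finsetSum _ _).trans ?_
  have h3 := (Finset.eventually_all _).2 h2
  filter_upwards [h3] with x hx
  rw [Finset.sum_apply, lowModes]
  exact Finset.sum_congr rfl hx

theorem highModes_ae {f : Torus → ℂ} {g : L2C} (h : f =ᵐ[haarT] g) (N : ℕ) :
    highModes N f =ᵐ[haarT] highProj N g := by
  filter_upwards [h, lowModes_ae h N, Lp.coeFn_sub g (lowPower N 0 g)] with x h1 h2 h3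
  have : highProj N g = g - lowPower N 0 g := rfl
  rw [this, h3, highModes, Pi.sub_apply, Pi.sub_apply, h1, h2]

/-! ### The critical embedding `H^{1/3} ⊂ L⁶`. -/

/-- With `a`, `b` the cube roots of `n + 1` and `n`, `1 = a³ - b³ ≤ 3a²(a - b)`. This makes the sum
of `⟨k⟩^{-2/3}` telescope; the factor 2 counts `k` and `-k`. -/
theorem two_mul_rpow_le_sub (n : ℕ) :
    2 * ((n + 1 : ℕ) : ℝ) ^ (-(2 / 3) : ℝ) ≤
      6 * ((n + 1 : ℕ) : ℝ) ^ (1 / 3 : ℝ) - 6 * (n : ℝ) ^ (1 / 3 : ℝ) := by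
  set a : ℝ := ((n + 1 : ℕ) : ℝ) ^ (1 / 3 : ℝ) with ha
  set b : ℝ := (n : ℝ) ^ (1 / 3 : ℝ) with hb
  have ha0 : 0 < a := by positivity
  have hb0 : 0 ≤ b := by positivity
  have ha3 : a ^ 3 = n + 1 := by
    rw [ha, ← Real.rpow_natCast, ← Real.rpow_mul (by positivity)]; norm_num
  have hb3 : b ^ 3 = n := by
    rw [hb, ← Real.rpow_natCast, ← Real.rpow_mul (by positivity)]; norm_num
  have hab : b ≤ a := by
    apply Real.rpow_le_rpow (by positivity) _ (by norm_num); push_cast; linarith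
  have h2 : ((n + 1 : ℕ) : ℝ) ^ (-(2 / 3) : ℝ) = (a ^ 2)⁻¹ := by
    rw [ha, ← Real.rpow_natCast, ← Real.rpow_mul (by positivity), ← Real.rpow_neg (by positivity)]
    norm_num
  rw [h2]
  have h3 : 1 ≤ (3 * (a - b)) * a ^ 2 := by
    have : (a - b) * (a ^ 2 + a * b + b ^ 2) = 1 := by ring_nf; rw [ha3, hb3]; ring
    have h5 : a ^ 2 + a * b + b ^ 2 ≤ 3 * a ^ 2 := by nlinarith
    nlinarith [mul_le_mul_of_nonneg_left h5 (sub_nonneg.2 hab)]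
  have h4 : (a ^ 2)⁻¹ ≤ 3 * (a - b) := by
    rw [inv_le_iff_one_le_mul₀ (by positivity)]
    exact h3
  linarith

theorem sum_bracket_rpow_le (n : ℕ) :
    ∑ k ∈ Finset.Icc (-(n : ℤ)) n, bracket k ^ (-(2 / 3) : ℝ) ≤ 1 + 6 * (n : ℝ) ^ (1 / 3 : ℝ) := by
  induction n with
  | zero => simp [bracket]
  | succ n ih =>
    have h : Finset.Icc (-((n + 1 : ℕ) : ℤ)) ((n + 1 : ℕ) : ℤ) =
        insert (-((n + 1 : ℕ) : ℤ)) (insert ((n + 1 : ℕ) : ℤ) (Finset.Icc (-(n : ℤ)) n)) := by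
      ext k; simp only [Finset.mem_insert, Finset.mem_Icc]; push_cast; omega
    rw [h, Finset.sum_insert (by simp; omega), Finset.sum_insert (by simp), bracket_neg]
    have h1 : bracket ((n + 1 : ℕ) : ℤ) ^ (-(2 / 3) : ℝ) ≤ ((n + 1 : ℕ) : ℝ) ^ (-(2 / 3) : ℝ) := by
      apply Real.rpow_le_rpow_of_nonpos (by positivity) _ (by norm_num)
      have := abs_le_bracket ((n + 1 : ℕ) : ℤ)
      exact (le_abs_self _).trans (by simpa using this)
    have := two_mul_rpow_le_sub n
    linarith

/-- The modes `k` with `⟨k⟩ ≤ m`. -/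
def modesBelow (m : ℝ) : Finset ℤ :=
  (Finset.Icc (-(⌊m⌋₊ : ℤ)) ⌊m⌋₊).filter fun k => bracket k ≤ m

theorem mem_modesBelow {m : ℝ} {k : ℤ} : k ∈ modesBelow m ↔ bracket k ≤ m := by
  rw [modesBelow, Finset.mem_filter, and_iff_right_iff_imp, Finset.mem_Icc, ← abs_le]
  intro h
  have h1 := (abs_le_bracket k).trans h
  have h2 : (k.natAbs : ℝ) ≤ m := by rwa [Nat.cast_natAbs, Int.cast_abs]
  rw [Int.abs_eq_natAbs]
  exact_mod_cast Nat.le_floor h2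

theorem sum_modesBelow_le {m : ℝ} (hm : 0 ≤ m) :
    ∑ k ∈ modesBelow m, bracket k ^ (-(2 / 3) : ℝ) ≤ 7 * m ^ (1 / 3 : ℝ) := by
  rcases lt_or_ge m 1 with h | h
  · have : modesBelow m = ∅ := by
      ext k
      simp only [mem_modesBelow, Finset.notMem_empty, iff_false, not_le]
      exact h.trans_le (one_le_bracket k)
    rw [this, Finset.sum_empty]; positivity
  · calc _ ≤ ∑ k ∈ Finset.Icc (-(⌊m⌋₊ : ℤ)) ⌊m⌋₊, bracket k ^ (-(2 / 3) : ℝ) :=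
        Finset.sum_le_sum_of_subset_of_nonneg (Finset.filter_subset _ _)
          fun k _ _ => (bracket_rpow_pos _ _).le
      _ ≤ 1 + 6 * (⌊m⌋₊ : ℝ) ^ (1 / 3 : ℝ) := sum_bracket_rpow_le _
      _ ≤ m ^ (1 / 3 : ℝ) + 6 * m ^ (1 / 3 : ℝ) := by
        gcongr
        · exact Real.one_le_rpow h (by norm_num)
        · exact Nat.floor_le hm
      _ = _ := by ring

/-- The trigonometric polynomial with the coefficients of `f` over a finite set of modes. -/
def partialSum (S : Finset ℤ) (f : L2C) (x : Torus) : ℂ := ∑ k ∈ S, coef k f * fourier k x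

theorem norm_partialSum_le (S : Finset ℤ) (f : L2C) (x : Torus) :
    ‖partialSum S f x‖ ≤ ∑ k ∈ S, ‖coef k f‖ := by
  refine (norm_sum_le _ _).trans (Finset.sum_le_sum fun k _ => ?_)
  rw [norm_mul]
  have h : ‖fourier k x‖ = 1 := by rw [fourier_apply]; exact Circle.norm_coe _
  rw [h, mul_one]

/-- The projection to a finite set of modes. -/
def projModes (S : Finset ℤ) (f : L2C) : L2C := ∑ k ∈ S, coef k f • fourierBasis k

theorem coef_projModes (S : Finset ℤ) (f : L2C) (j : ℤ) :
    coef j (projModes S f) = if j ∈ S then coef j f else 0 := by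
  have horth : ∀ k, coef j (fourierBasis k) = if k = j then 1 else 0 := fun k => by
    rw [coef_eq_repr, HilbertBasis.repr_self, lp.single_apply, Pi.single_apply]
    simp only [eq_comm]
  rw [projModes, map_sum]
  simp only [map_smul, horth, smul_eq_mul, mul_ite, mul_one, mul_zero, Finset.sum_ite_eq']

theorem coeFn_projModes (S : Finset ℤ) (f : L2C) : projModes S f =ᵐ[haarT] partialSum S f := by
  have h2 : ∀ k ∈ S,
      ⇑(coef k f • fourierBasis k : L2C) =ᵐ[haarT] fun x => coef k f * fourier k x := by
    intro k _
    filter_upwards [Lp.coeFn_smul (coef k f) (fourierBasis k : L2C),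
      coeFn_fourierLp (T := 2 * Real.pi) 2 k] with x hx1 hx2
    rw [hx1, Pi.smul_apply, coe_fourierBasis, hx2, smul_eq_mul]
  refine (Lp.coeFn_finsetSum _ _).trans ?_
  filter_upwards [(Finset.eventually_all _).2 h2] with x hx
  rw [Finset.sum_apply, partialSum]
  exact Finset.sum_congr rfl hx

/-- Cauchy-Schwarz against the sum of `⟨k⟩^{-2/3}` over `⟨k⟩ ≤ m`, which is at most `7 m^{1/3}`. -/
theorem sum_norm_coef_smoothing_le (f : L2C) {m : ℝ} (hm : 0 ≤ m) :
    ∑ k ∈ modesBelow m, ‖coef k (smoothing (1 / 3) f)‖ ≤ Real.sqrt 7 * m ^ (1 / 6 : ℝ) * ‖f‖ := by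
  have h1 : ∀ k, ‖coef k (smoothing (1 / 3) f)‖ = bracket k ^ (-(1 / 3) : ℝ) * ‖coef k f‖ := by
    intro k
    rw [coef_smoothing (by norm_num), norm_mul, Complex.norm_real,
      Real.norm_of_nonneg (bracket_rpow_pos _ _).le]
  simp only [h1]
  refine (Real.sum_mul_le_sqrt_mul_sqrt _ _ _).trans ?_
  have h2 : ∑ k ∈ modesBelow m, ‖coef k f‖ ^ 2 ≤ ‖f‖ ^ 2 :=
    sum_le_hasSum _ (fun _ _ => by positivity) (hasSum_norm_coef_sq f)
  have h3 : ∑ k ∈ modesBelow m, (bracket k ^ (-(1 / 3) : ℝ)) ^ 2 ≤ 7 * m ^ (1 / 3 : ℝ) := by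
    refine le_of_eq_of_le (Finset.sum_congr rfl fun k _ => ?_) (sum_modesBelow_le hm)
    rw [← Real.rpow_natCast, ← Real.rpow_mul (bracket_pos k).le]; norm_num
  have h4 : Real.sqrt (m ^ (1 / 3 : ℝ)) = m ^ (1 / 6 : ℝ) := by
    rw [Real.sqrt_eq_rpow, ← Real.rpow_mul hm]; norm_num
  rw [← h4, ← Real.sqrt_mul (x := 7) (by norm_num)]
  exact mul_le_mul (Real.sqrt_le_sqrt h3)
    ((Real.sqrt_le_sqrt h2).trans (by rw [Real.sqrt_sq (norm_nonneg _)])) (Real.sqrt_nonneg _)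
    (Real.sqrt_nonneg _)

theorem ofReal_norm_sub_projModes_sq (S : Finset ℤ) (f : L2C) :
    ENNReal.ofReal (‖f - projModes S f‖ ^ 2) =
      ∑' k, if k ∈ S then 0 else ENNReal.ofReal (‖coef k f‖ ^ 2) := by
  rw [← tsum_ofReal_norm_coef_sq]
  refine tsum_congr fun k => ?_
  rw [map_sub, coef_projModes]
  split_ifs <;> simp

theorem lintegral_enorm_sq (f : L2C) : ∫⁻ x, ‖f x‖ₑ ^ 2 ∂haarT = ENNReal.ofReal (‖f‖ ^ 2) := by
  have h := eLpNorm_nnreal_pow_eq_lintegral (f := f) (μ := haarT) (p := 2) (by norm_num)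
  have h2 : eLpNorm f 2 haarT = ENNReal.ofReal ‖f‖ := by
    rw [Lp.norm_def, ENNReal.ofReal_toReal (Lp.eLpNorm_ne_top f)]
  rw [ENNReal.ofReal_pow (norm_nonneg _), ← h2]
  simpa using h.symm

/-- The frequency threshold depends on the level `t`: it is chosen so that the low modes contribute
at most `t/2` pointwise. The high modes must then exceed `t/2`, and Chebyshev with Parseval bounds
the measure of that set. -/
theorem measure_le_norm_smoothing {f : L2C} (hf : 0 < ‖f‖) {t : ℝ} (ht : 0 < t) :
    haarT {x | t ≤ ‖smoothing (1 / 3) f x‖} ≤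
      ∑' k, if (t / (2 * Real.sqrt 7 * ‖f‖)) ^ 6 < bracket k then
        ENNReal.ofReal (4 / t ^ 2) * ENNReal.ofReal (‖coef k (smoothing (1 / 3) f)‖ ^ 2) else 0 := by
  set g : L2C := smoothing (1 / 3) f with hg
  set a : ℝ := t / (2 * Real.sqrt 7 * ‖f‖) with ha
  have ha0 : 0 < a := by positivity
  set S := modesBelow (a ^ 6) with hS
  have hsup : ∀ x, ‖partialSum S g x‖ ≤ t / 2 := fun x => by
    refine (norm_partialSum_le S g x).trans
      ((sum_norm_coef_smoothing_le f (by positivity)).trans (le_of_eq ?_))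
    have h6 : (a ^ 6 : ℝ) ^ (1 / 6 : ℝ) = a := by
      rw [← Real.rpow_natCast, ← Real.rpow_mul ha0.le]; norm_num
    rw [h6, ha]
    field_simp
  have hsub : haarT {x | t ≤ ‖g x‖} ≤
      haarT {x | ENNReal.ofReal (t ^ 2 / 4) ≤ ‖(g - projModes S g : L2C) x‖ₑ ^ 2} := by
    refine measure_mono_ae ?_
    filter_upwards [Lp.coeFn_sub g (projModes S g), coeFn_projModes S g] with x h1 h2 h3
    change t ≤ ‖g x‖ at h3
    change ENNReal.ofReal (t ^ 2 / 4) ≤ ‖(g - projModes S g : L2C) x‖ₑ ^ 2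
    rw [h1, Pi.sub_apply, h2, ← ofReal_norm, ← ENNReal.ofReal_pow (norm_nonneg _)]
    apply ENNReal.ofReal_le_ofReal
    have h4 := norm_sub_norm_le (g x) (partialSum S g x)
    have h5 : t / 2 ≤ ‖g x - partialSum S g x‖ := by linarith [hsup x]
    calc t ^ 2 / 4 = (t / 2) ^ 2 := by ring
      _ ≤ _ := by gcongr
  refine hsub.trans ?_
  have hcheb := mul_meas_ge_le_lintegral₀ (μ := haarT)
    (f := fun x => ‖(g - projModes S g : L2C) x‖ₑ ^ 2)
    ((Lp.aestronglyMeasurable _).enorm.pow_const 2) (ENNReal.ofReal (t ^ 2 / 4))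
  rw [lintegral_enorm_sq, ofReal_norm_sub_projModes_sq] at hcheb
  have h6 : ENNReal.ofReal (4 / t ^ 2) * ENNReal.ofReal (t ^ 2 / 4) = 1 := by
    rw [← ENNReal.ofReal_mul (by positivity)]
    have : 4 / t ^ 2 * (t ^ 2 / 4) = 1 := by field_simp
    rw [this, ENNReal.ofReal_one]
  have h7 := mul_le_mul_right hcheb (ENNReal.ofReal (4 / t ^ 2))
  rw [← mul_assoc, h6, one_mul, ← ENNReal.tsum_mul_left] at h7
  refine h7.trans (le_of_eq (tsum_congr fun k => ?_))
  simp only [hS, mem_modesBelow]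
  by_cases hk : bracket k ≤ a ^ 6
  · rw [if_pos hk, if_neg (not_lt.2 hk), mul_zero]
  · rw [if_neg hk, if_pos (not_le.1 hk)]

/-- The critical Sobolev embedding `H^{1/3} ⊂ L⁶`. -/
theorem lintegral_smoothing_six_le (f : L2C) :
    ∫⁻ x, ‖smoothing (1 / 3) f x‖ₑ ^ 6 ∂haarT ≤
      ENNReal.ofReal (24 * (2 * Real.sqrt 7) ^ 4 * ‖f‖ ^ 6) := by
  rcases eq_or_lt_of_le (norm_nonneg f) with hf | hf
  · have hf0 : f = 0 := norm_eq_zero.1 hf.symm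
    subst hf0
    rw [map_zero]
    have : ∫⁻ x, ‖(0 : L2C) x‖ₑ ^ 6 ∂haarT = ∫⁻ _x, 0 ∂haarT := by
      apply lintegral_congr_ae
      filter_upwards [Lp.coeFn_zero ℂ 2 haarT] with x hx
      rw [hx]; simp
    rw [this]; simp
  set g : L2C := smoothing (1 / 3) f with hg
  set A : ℝ := 2 * Real.sqrt 7 * ‖f‖ with hA
  have hA0 : 0 < A := by positivity
  have hlc := lintegral_rpow_eq_lintegral_meas_le_mul haarT (f := fun x => ‖g x‖)
    (Eventually.of_forall fun _ => norm_nonneg _) (Lp.aestronglyMeasurable g).norm.aemeasurable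
    (p := 6) (by norm_num)
  have h1 : ∫⁻ x, ‖g x‖ₑ ^ 6 ∂haarT = ∫⁻ x, ENNReal.ofReal (‖g x‖ ^ (6 : ℝ)) ∂haarT := by
    refine lintegral_congr fun x => ?_
    rw [← ofReal_norm, ← ENNReal.ofReal_pow (norm_nonneg _)]
    congr 1
    exact_mod_cast (Real.rpow_natCast ‖g x‖ 6).symm
  rw [h1, hlc]
  -- Mode `k` contributes only at levels `t < A ⟨k⟩^{1/6}`. Integrating in `t` mode by mode gives
  -- `⟨k⟩^{2/3} |ĝ(k)|² = |f̂(k)|²`, which is summable.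
  have h2 : ∀ t ∈ Set.Ioi (0 : ℝ), haarT {x | t ≤ ‖g x‖} * ENNReal.ofReal (t ^ ((6 : ℝ) - 1)) ≤
      ∑' k, (Set.Ioo 0 (A * bracket k ^ (1 / 6 : ℝ))).indicator (fun _ =>
        ENNReal.ofReal (4 * (A * bracket k ^ (1 / 6 : ℝ)) ^ 3 * ‖coef k g‖ ^ 2)) t := by
    intro t ht
    have ht' : 0 < t := ht
    refine (mul_le_mul_left (measure_le_norm_smoothing hf ht') _).trans ?_
    rw [← ENNReal.tsum_mul_right]
    refine ENNReal.tsum_le_tsum fun k => ?_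
    rw [← hA, ← hg]
    split_ifs with hk
    · have hb : t < A * bracket k ^ (1 / 6 : ℝ) := by
        rw [mul_comm, ← div_lt_iff₀ hA0]
        have h3 := Real.rpow_lt_rpow (by positivity) hk (show (0 : ℝ) < 1 / 6 by norm_num)
        rwa [← Real.rpow_natCast, ← Real.rpow_mul (by positivity),
          show (((6 : ℕ) : ℝ) * (1 / 6)) = 1 by norm_num, Real.rpow_one] at h3
      rw [Set.indicator_of_mem (Set.mem_Ioo.2 ⟨ht', hb⟩), ← ENNReal.ofReal_mul (by positivity),
        ← ENNReal.ofReal_mul (by positivity)]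
      apply ENNReal.ofReal_le_ofReal
      have h5 : t ^ ((6 : ℝ) - 1) = t ^ 5 := by
        rw [← Real.rpow_natCast]; norm_num
      rw [h5]
      calc 4 / t ^ 2 * ‖coef k g‖ ^ 2 * t ^ 5 = 4 * t ^ 3 * ‖coef k g‖ ^ 2 := by
            field_simp
        _ ≤ _ := by gcongr
    · simp
  have h3 := setLIntegral_mono' (μ := volume) measurableSet_Ioi h2
  refine (mul_le_mul_right h3 _).trans ?_
  rw [lintegral_tsum (fun k => (measurable_const.indicator measurableSet_Ioo).aemeasurable)]
  have h4 : ∀ k, ∫⁻ t in Set.Ioi (0 : ℝ), (Set.Ioo 0 (A * bracket k ^ (1 / 6 : ℝ))).indicator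
      (fun _ => ENNReal.ofReal (4 * (A * bracket k ^ (1 / 6 : ℝ)) ^ 3 * ‖coef k g‖ ^ 2)) t ≤
      ENNReal.ofReal (4 * A ^ 4) * ENNReal.ofReal (‖coef k f‖ ^ 2) := by
    intro k
    have hb : 0 ≤ bracket k ^ (1 / 6 : ℝ) := (bracket_rpow_pos _ _).le
    rw [lintegral_indicator measurableSet_Ioo, lintegral_const, Measure.restrict_apply .univ,
      Set.univ_inter]
    refine (mul_le_mul_right (Measure.restrict_le_self _) _).trans ?_
    rw [Real.volume_Ioo, sub_zero, ← ENNReal.ofReal_mul (by positivity),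
      ← ENNReal.ofReal_mul (by positivity)]
    apply ENNReal.ofReal_le_ofReal
    apply le_of_eq
    have h5 := bracket_rpow_mul_sq (σ := 1 / 3) (by norm_num) f k
    have h6 : bracket k ^ (2 * (1 / 3) : ℝ) = (bracket k ^ (1 / 6 : ℝ)) ^ 4 := by
      rw [← Real.rpow_natCast, ← Real.rpow_mul (bracket_pos k).le]; norm_num
    rw [← h5, h6, ← hg]
    ring
  refine (mul_le_mul_right (ENNReal.tsum_le_tsum h4) _).trans ?_
  rw [ENNReal.tsum_mul_left, tsum_ofReal_norm_coef_sq, ← ENNReal.ofReal_mul (by positivity),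
    ← ENNReal.ofReal_mul (by positivity)]
  apply ENNReal.ofReal_le_ofReal
  apply le_of_eq
  rw [hA]; ring

/-! ### The cubic map from `L⁶` to `L²`. -/

instance factOneLeSix : Fact ((1 : ℝ≥0∞) ≤ 6) := ⟨by norm_num⟩
instance factOneLeThree : Fact ((1 : ℝ≥0∞) ≤ 3) := ⟨by norm_num⟩

abbrev L6R : Type := Lp ℝ 6 haarT
abbrev L3R : Type := Lp ℝ 3 haarT

instance holderTripleSixSix : ENNReal.HolderTriple 6 6 3 := ⟨by
  rw [← two_mul, show (6 : ℝ≥0∞) = 2 * 3 by norm_num, ENNReal.mul_inv (by simp) (by simp),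
    ← mul_assoc, ENNReal.mul_inv_cancel (by simp) (by simp), one_mul]⟩

instance holderTripleSixThree : ENNReal.HolderTriple 6 3 2 := ⟨by
  have h6 : (6 : ℝ≥0∞)⁻¹ = ENNReal.ofReal (1 / 6) := by
    rw [ENNReal.ofReal_div_of_pos (by norm_num)]; simp
  have h3 : (3 : ℝ≥0∞)⁻¹ = ENNReal.ofReal (1 / 3) := by
    rw [ENNReal.ofReal_div_of_pos (by norm_num)]; simp
  have h2 : (2 : ℝ≥0∞)⁻¹ = ENNReal.ofReal (1 / 2) := by
    rw [ENNReal.ofReal_div_of_pos (by norm_num)]; simp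
  rw [h6, h3, h2, ← ENNReal.ofReal_add (by norm_num) (by norm_num)]
  norm_num⟩

/-- The product of three functions in `L⁶`, as a function in `L²`. -/
def mul3 (x y z : L6R) : L2R :=
  (ContinuousLinearMap.mul ℝ ℝ).holder 2 x ((ContinuousLinearMap.mul ℝ ℝ).holder 3 y z : L3R)

theorem coeFn_mul3 (x y z : L6R) : mul3 x y z =ᵐ[haarT] fun a => x a * y a * z a := by
  filter_upwards [(ContinuousLinearMap.mul ℝ ℝ).coeFn_holder (r := 2) x
    ((ContinuousLinearMap.mul ℝ ℝ).holder 3 y z : L3R),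
    (ContinuousLinearMap.mul ℝ ℝ).coeFn_holder (r := 3) y z] with a h1 h2
  rw [mul3, h1, h2]
  simp [mul_assoc]

theorem norm_mul3_le (x y z : L6R) : ‖mul3 x y z‖ ≤ ‖x‖ * ‖y‖ * ‖z‖ := by
  have h1 := (ContinuousLinearMap.mul ℝ ℝ).norm_holder_apply_apply_le (r := 2) x
    ((ContinuousLinearMap.mul ℝ ℝ).holder 3 y z : L3R)
  have h2 := (ContinuousLinearMap.mul ℝ ℝ).norm_holder_apply_apply_le (r := 3) y z
  have h3 : ‖ContinuousLinearMap.mul ℝ ℝ‖ ≤ 1 := ContinuousLinearMap.opNorm_mul_le ℝ ℝ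
  refine h1.trans ?_
  calc _ ≤ 1 * ‖x‖ * (1 * ‖y‖ * ‖z‖) := by
        gcongr
        exact h2.trans (by gcongr)
    _ = _ := by ring

theorem continuous_mul3 : Continuous fun p : L6R × L6R × L6R => mul3 p.1 p.2.1 p.2.2 := by
  have h : ∀ p : L6R × L6R × L6R, mul3 p.1 p.2.1 p.2.2 =
      (ContinuousLinearMap.mul ℝ ℝ).holderL haarT 6 3 2 p.1
        ((ContinuousLinearMap.mul ℝ ℝ).holderL haarT 6 6 3 p.2.1 p.2.2) := fun p => rfl
  simp only [h]
  fun_prop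

theorem cube_sub_cube (x y : L6R) :
    mul3 x x x - mul3 y y y = mul3 (x - y) x x + mul3 y (x - y) x + mul3 y y (x - y) := by
  apply Lp.ext
  filter_upwards [Lp.coeFn_sub (mul3 x x x) (mul3 y y y), coeFn_mul3 x x x, coeFn_mul3 y y y,
    Lp.coeFn_add (mul3 (x - y) x x + mul3 y (x - y) x) (mul3 y y (x - y)),
    Lp.coeFn_add (mul3 (x - y) x x) (mul3 y (x - y) x), coeFn_mul3 (x - y) x x,
    coeFn_mul3 y (x - y) x, coeFn_mul3 y y (x - y), Lp.coeFn_sub x y]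
    with a h1 h2 h3 h4 h5 h6 h7 h8 h9
  rw [h1, h4, Pi.sub_apply, Pi.add_apply, h5, Pi.add_apply, h2, h3, h6, h7, h8, h9, Pi.sub_apply]
  ring

theorem norm_cube_sub_cube_le {x y : L6R} {M : ℝ} (hx : ‖x‖ ≤ M) (hy : ‖y‖ ≤ M) :
    ‖mul3 x x x - mul3 y y y‖ ≤ 3 * M ^ 2 * ‖x - y‖ := by
  have hM : 0 ≤ M := (norm_nonneg x).trans hx
  rw [cube_sub_cube]
  refine (norm_add₃_le).trans ?_
  calc _ ≤ ‖x - y‖ * M * M + M * ‖x - y‖ * M + M * M * ‖x - y‖ := by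
        gcongr <;> refine (norm_mul3_le _ _ _).trans ?_ <;> gcongr
    _ = _ := by ring

/-- The constant of the embedding `H^{1/3} ⊂ L⁶`. -/
def sobolevConst : ℝ := (24 * (2 * Real.sqrt 7) ^ 4) ^ (1 / 6 : ℝ)

theorem sobolevConst_nonneg : 0 ≤ sobolevConst := by unfold sobolevConst; positivity

theorem sobolevConst_pow : sobolevConst ^ 6 = 24 * (2 * Real.sqrt 7) ^ 4 := by
  rw [sobolevConst, ← Real.rpow_natCast (_ ^ (1 / 6 : ℝ)), ← Real.rpow_mul (by positivity)]
  norm_num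

theorem eLpNorm_re_smoothing_le (f : L2C) :
    eLpNorm (fun x => (smoothing (1 / 3) f x).re) 6 haarT ≤ ENNReal.ofReal (sobolevConst * ‖f‖) := by
  have h := eLpNorm_nnreal_pow_eq_lintegral (f := fun x => (smoothing (1 / 3) f x).re)
    (μ := haarT) (p := 6) (by norm_num)
  rw [show ((6 : ℝ≥0) : ℝ≥0∞) = 6 by norm_num] at h
  have h2 : eLpNorm (fun x => (smoothing (1 / 3) f x).re) 6 haarT ^ (6 : ℝ) ≤
      (ENNReal.ofReal (sobolevConst * ‖f‖)) ^ (6 : ℝ) := by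
    refine (le_of_eq h).trans ?_
    refine (lintegral_mono (g := fun x => ‖smoothing (1 / 3) f x‖ₑ ^ 6) fun x => ?_).trans
      ((lintegral_smoothing_six_le f).trans (le_of_eq ?_))
    · have : ‖(smoothing (1 / 3) f x).re‖ₑ ≤ ‖smoothing (1 / 3) f x‖ₑ := by
        rw [← ofReal_norm, ← ofReal_norm]
        exact ENNReal.ofReal_le_ofReal (Complex.abs_re_le_norm _)
      have h3 : ((6 : ℝ≥0) : ℝ) = ((6 : ℕ) : ℝ) := by norm_num
      rw [h3, ENNReal.rpow_natCast]
      exact pow_le_pow_left' this 6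
    · have h3 : (6 : ℝ) = ((6 : ℕ) : ℝ) := by norm_num
      rw [h3, ENNReal.rpow_natCast, ← ENNReal.ofReal_pow (mul_nonneg sobolevConst_nonneg
        (norm_nonneg _)), mul_pow sobolevConst, sobolevConst_pow]
  exact (ENNReal.rpow_le_rpow_iff (by norm_num)).1 h2

theorem memLp_re_smoothing (f : L2C) :
    MemLp (fun x => (smoothing (1 / 3) f x).re) 6 haarT :=
  ⟨Complex.continuous_re.comp_aestronglyMeasurable (Lp.aestronglyMeasurable _),
    (eLpNorm_re_smoothing_le f).trans_lt ENNReal.ofReal_lt_top⟩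

/-- The map `f ↦ Re B^{-1/3} f` from `L²` to `L⁶`. -/
def reSobolev : L2C →L[ℝ] L6R :=
  LinearMap.mkContinuous
    { toFun := fun f => (memLp_re_smoothing f).toLp _
      map_add' := fun f g => by
        rw [← MemLp.toLp_add]
        apply MemLp.toLp_congr
        rw [map_add]
        filter_upwards [Lp.coeFn_add (smoothing (1 / 3) f) (smoothing (1 / 3) g)] with x hx
        rw [hx]; simp
      map_smul' := fun c f => by
        rw [RingHom.id_apply, ← MemLp.toLp_const_smul]
        apply MemLp.toLp_congr
        rw [(smoothing (1 / 3)).map_smul_of_tower c f]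
        filter_upwards [Lp.coeFn_smul c (smoothing (1 / 3) f)] with x hx
        rw [hx]; simp }
    sobolevConst (fun f => by
      change ‖(memLp_re_smoothing f).toLp _‖ ≤ _
      rw [Lp.norm_toLp]
      exact ENNReal.toReal_le_of_le_ofReal (mul_nonneg sobolevConst_nonneg (norm_nonneg _))
        (eLpNorm_re_smoothing_le f))

theorem coeFn_reSobolev (f : L2C) : reSobolev f =ᵐ[haarT] fun x => (smoothing (1 / 3) f x).re :=
  (memLp_re_smoothing f).coeFn_toLp

theorem norm_reSobolev_le (f : L2C) : ‖reSobolev f‖ ≤ sobolevConst * ‖f‖ := by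
  change ‖(memLp_re_smoothing f).toLp _‖ ≤ _
  rw [Lp.norm_toLp]
  exact ENNReal.toReal_le_of_le_ofReal (mul_nonneg sobolevConst_nonneg (norm_nonneg _))
    (eLpNorm_re_smoothing_le f)

/-- The same function occurs as an element of `L⁶`, where it can be cubed, and of `L²`, where it can
be paired; this identifies the two. -/
theorem coeFn_reSobolev_smoothing {σ : ℝ} (hσ : 0 ≤ σ) (f : L2C) :
    reSobolev (smoothing σ f) =ᵐ[haarT] reL (smoothing (1 / 3 + σ) f) := by
  filter_upwards [coeFn_reSobolev (smoothing σ f), coeFn_reL (smoothing (1 / 3 + σ) f)] with x h1 h2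
  rw [h1, h2, smoothing_add (by norm_num) hσ]

/-! ### The quartic energy and the Gagliardo-Nirenberg inequality. -/

/-- The integral of the fourth power of `Re B^{-1} V`, for the normalised measure. -/
def quartic (V : L2C) : ℝ := ∫ x, (reL (smoothing 1 V) x) ^ 4 ∂haarT

/-- Writing `ψ⁴ = ψ · ψ³` reduces the continuity and the size of the quartic term to those of the
cubic map. -/
theorem quartic_eq_inner (V : L2C) :
    quartic V = inner ℝ (reL (smoothing 1 V)) (mul3 (reSobolev (smoothing (2 / 3) V))
      (reSobolev (smoothing (2 / 3) V)) (reSobolev (smoothing (2 / 3) V))) := by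
  rw [L2.inner_def, quartic]
  refine integral_congr_ae ?_
  have h := coeFn_reSobolev_smoothing (σ := 2 / 3) (by norm_num) V
  rw [show (1 / 3 + 2 / 3 : ℝ) = 1 by norm_num] at h
  filter_upwards [h, coeFn_mul3 (reSobolev (smoothing (2 / 3) V))
      (reSobolev (smoothing (2 / 3) V)) (reSobolev (smoothing (2 / 3) V))] with x h1 h2
  rw [h2, h1]
  simp; ring

theorem continuous_quartic : Continuous quartic := by
  have h : quartic = fun V => _ := funext quartic_eq_inner
  rw [h]
  refine Continuous.inner (by fun_prop) ?_
  exact continuous_mul3.comp (by fun_prop : Continuous fun V : L2C =>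
    (reSobolev (smoothing (2 / 3) V), reSobolev (smoothing (2 / 3) V),
      reSobolev (smoothing (2 / 3) V)))

theorem quartic_nonneg (V : L2C) : 0 ≤ quartic V := integral_nonneg fun x => by positivity

theorem continuous_partialSum (S : Finset ℤ) (f : L2C) : Continuous (partialSum S f) := by
  unfold partialSum
  fun_prop

theorem hasDerivAt_partialSum (S : Finset ℤ) {f g : L2C}
    (h : ∀ k, coef k g = Complex.I * k * coef k f) (y : ℝ) :
    HasDerivAt (fun y : ℝ => partialSum S f (y : Torus)) (partialSum S g (y : Torus)) y := by
  unfold partialSum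
  refine HasDerivAt.fun_sum fun k _ => ?_
  have h1 := (hasDerivAt_fourier (2 * Real.pi) k y).const_mul (coef k f)
  refine h1.congr_deriv ?_
  rw [h]
  have : (Real.pi : ℂ) ≠ 0 := by exact_mod_cast Real.pi_ne_zero
  push_cast
  field_simp

theorem integral_sq_eq (f : L2R) : ∫ x, (f x) ^ 2 ∂haarT = ‖f‖ ^ 2 := by
  rw [← real_inner_self_eq_norm_sq, L2.inner_def]
  refine integral_congr_ae (Eventually.of_forall fun x => ?_)
  simp

theorem norm_projModes_le (S : Finset ℤ) (f : L2C) : ‖projModes S f‖ ≤ ‖f‖ := by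
  rw [← one_mul ‖f‖]
  refine norm_le_of_coef zero_le_one fun k => ?_
  rw [coef_projModes]
  split_ifs <;> simp

theorem coeFn_reL_projModes (S : Finset ℤ) (f : L2C) :
    reL (projModes S f) =ᵐ[haarT] fun x => (partialSum S f x).re := by
  filter_upwards [coeFn_reL (projModes S f), coeFn_projModes S f] with x h1 h2
  rw [h1, h2]

theorem integral_re_partialSum_sq_le (S : Finset ℤ) (f : L2C) :
    ∫ x, (partialSum S f x).re ^ 2 ∂haarT ≤ ‖f‖ ^ 2 := by
  have h : ∫ x, (partialSum S f x).re ^ 2 ∂haarT = ‖reL (projModes S f)‖ ^ 2 := by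
    rw [← integral_sq_eq]
    refine integral_congr_ae ?_
    filter_upwards [coeFn_reL_projModes S f] with x hx
    rw [hx]
  rw [h]
  have := (norm_reL_le _).trans (norm_projModes_le S f)
  gcongr

theorem integral_abs_mul_abs_le {f g : Torus → ℝ} (hf : Continuous f) (hg : Continuous g) :
    ∫ x, |f x| * |g x| ∂haarT ≤
      Real.sqrt (∫ x, f x ^ 2 ∂haarT) * Real.sqrt (∫ x, g x ^ 2 ∂haarT) := by
  have hm : ∀ {f : Torus → ℝ}, Continuous f → MemLp (fun x => |f x|) (ENNReal.ofReal 2) haarT :=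
    fun {f} hf => by
      obtain ⟨C, hC⟩ := isCompact_univ.exists_bound_of_continuousOn hf.continuousOn
      refine MemLp.of_bound (by fun_prop) C (Eventually.of_forall fun x => ?_)
      simpa using hC x trivial
  have h := integral_mul_le_Lp_mul_Lq_of_nonneg (μ := haarT) (p := 2) (q := 2)
    (by norm_num [Real.holderConjugate_iff]) (Eventually.of_forall fun x => abs_nonneg (f x))
    (Eventually.of_forall fun x => abs_nonneg (g x)) (hm hf) (hm hg)
  rw [Real.sqrt_eq_rpow, Real.sqrt_eq_rpow]
  simpa using h

theorem integrable_haarT {E : Type*} [NormedAddCommGroup E] {f : Torus → E} (hf : Continuous f) :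
    Integrable f haarT :=
  hf.integrable_of_hasCompactSupport (HasCompactSupport.of_compactSpace _)

/-- The Gagliardo-Nirenberg inequality for trigonometric polynomials. -/
theorem re_partialSum_cube_le (S : Finset ℤ) (V : L2C) (x : Torus) :
    |(partialSum S (smoothing 1 V) x).re| ^ 3 ≤
      (1 + 6 * Real.pi) * ‖V‖ *
        Real.sqrt (∫ y, (partialSum S (smoothing 1 V) y).re ^ 4 ∂haarT) := by
  have hsym : ∀ k : ℤ, ‖Complex.I * k * ((bracket k ^ (-1 : ℝ) : ℝ) : ℂ)‖ ≤ 1 := fun k => by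
    rw [norm_mul, norm_mul, Complex.norm_I, one_mul, Complex.norm_real, Complex.norm_intCast,
      Real.norm_of_nonneg (bracket_rpow_pos _ _).le, Real.rpow_neg_one, ← div_eq_mul_inv,
      div_le_one (bracket_pos k)]
    exact abs_le_bracket k
  -- `G` is `∂ₓB⁻¹V`, and `|k| ≤ ⟨k⟩` gives `‖G‖ ≤ ‖V‖`.
  set G : L2C := mult (fun k : ℤ => Complex.I * k * ((bracket k ^ (-1 : ℝ) : ℝ) : ℂ)) V with hG
  have hGc : ∀ k, coef k G = Complex.I * k * coef k (smoothing 1 V) := fun k => by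
    rw [hG, coef_mult hsym, coef_smoothing zero_le_one]; ring
  have hGn : ‖G‖ ≤ ‖V‖ := by
    rw [← one_mul ‖V‖]
    refine norm_le_of_coef zero_le_one fun k => ?_
    rw [hG, coef_mult hsym, norm_mul]
    gcongr
    exact hsym k
  set h : Torus → ℝ := fun y => (partialSum S (smoothing 1 V) y).re with hh
  set d : Torus → ℝ := fun y => (partialSum S G y).re with hd
  have hhc : Continuous h := Complex.continuous_re.comp (continuous_partialSum _ _)
  have hdc : Continuous d := Complex.continuous_re.comp (continuous_partialSum _ _)
  have hder : ∀ y : ℝ, HasDerivAt (fun y : ℝ => h (y : Torus)) (d (y : Torus)) y := fun y =>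
    Complex.reCLM.hasFDerivAt.comp_hasDerivAt y (hasDerivAt_partialSum S hGc y)
  have hcoe : Continuous ((↑) : ℝ → Torus) := AddCircle.continuous_mk' _
  set Q : ℝ := Real.sqrt (∫ y, h y ^ 4 ∂haarT) with hQ
  have hsq4 : ∀ y, (h y ^ 2) ^ 2 = h y ^ 4 := fun y => by ring
  have hCS : ∫ y, |h y ^ 2| * |d y| ∂haarT ≤ Q * ‖V‖ := by
    refine (integral_abs_mul_abs_le (f := fun y => h y ^ 2) (hhc.pow 2) hdc).trans ?_
    simp only [hsq4]
    gcongr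
    refine (Real.sqrt_le_sqrt (integral_re_partialSum_sq_le S G)).trans ?_
    rw [Real.sqrt_sq (norm_nonneg _)]
    exact hGn
  have hCS2 : ∫ y, |h y| ^ 3 ∂haarT ≤ Q * ‖V‖ := by
    have h3 : ∀ y, |h y| ^ 3 = |h y ^ 2| * |h y| := fun y => by rw [abs_pow]; ring
    simp only [h3]
    refine (integral_abs_mul_abs_le (f := fun y => h y ^ 2) (hhc.pow 2) hhc).trans ?_
    simp only [hsq4]
    gcongr
    refine (Real.sqrt_le_sqrt (integral_re_partialSum_sq_le S _)).trans ?_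
    rw [Real.sqrt_sq (norm_nonneg _)]
    exact norm_smoothing_le zero_le_one _
  -- The oscillation of `|h|³` is at most the integral of `3h²|h'|` over the circle. The constant
  -- `6π` is this 3 times the length `2π`, as the Haar measure is normalised.
  have hdiff : ∀ a ∈ Set.Ico 0 (2 * Real.pi), ∀ b ∈ Set.Ico 0 (2 * Real.pi),
      |h (a : Torus)| ^ 3 - |h (b : Torus)| ^ 3 ≤ 6 * Real.pi * (Q * ‖V‖) := by
    intro a ha b hb
    have hint : ∫ y in b..a, 3 * h (y : Torus) ^ 2 * d (y : Torus) =
        h (a : Torus) ^ 3 - h (b : Torus) ^ 3 := by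
      refine intervalIntegral.integral_eq_sub_of_hasDerivAt
        (f := fun y : ℝ => h (y : Torus) ^ 3) (fun y _ => ?_) ?_
      · exact ((hder y).fun_pow 3).congr_deriv (by norm_num)
      · exact Continuous.intervalIntegrable (by fun_prop) _ _
    have h1 : |h (a : Torus)| ^ 3 - |h (b : Torus)| ^ 3 ≤
        |h (a : Torus) ^ 3 - h (b : Torus) ^ 3| := by
      rw [← abs_pow, ← abs_pow]; exact abs_sub_abs_le_abs_sub _ _
    refine h1.trans ?_
    rw [← hint, ← Real.norm_eq_abs]
    refine intervalIntegral.norm_integral_le_integral_norm_uIoc.trans ?_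
    have hsub : Set.uIoc b a ⊆ Set.Ioc 0 (0 + 2 * Real.pi) := by
      intro y hy
      rw [Set.mem_uIoc] at hy
      simp only [Set.mem_Ico] at ha hb
      simp only [Set.mem_Ioc, zero_add]
      rcases hy with hy | hy <;> constructor <;> linarith
    have hc : Continuous fun y : ℝ => ‖3 * h (y : Torus) ^ 2 * d (y : Torus)‖ := by fun_prop
    refine (setIntegral_mono_set (hc.integrableOn_Icc.mono_set Set.Ioc_subset_Icc_self)
      (Eventually.of_forall fun _ => norm_nonneg _) (LE.le.eventuallyLE hsub)).trans ?_
    rw [AddCircle.integral_preimage (2 * Real.pi) 0 (fun y => ‖3 * h y ^ 2 * d y‖),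
      AddCircle.volume_eq_smul_haarAddCircle, integral_smul_measure,
      ENNReal.toReal_ofReal Real.two_pi_pos.le, smul_eq_mul]
    have h4 : ∀ y, ‖3 * h y ^ 2 * d y‖ = 3 * (|h y ^ 2| * |d y|) := fun y => by
      rw [norm_mul, norm_mul, Real.norm_eq_abs, Real.norm_eq_abs, Real.norm_eq_abs]
      norm_num; ring
    simp only [h4]
    rw [integral_const_mul]
    have := Real.pi_pos
    calc _ ≤ 2 * Real.pi * (3 * (Q * ‖V‖)) := by gcongr
      _ = _ := by ring
  have hall : ∀ y, |h x| ^ 3 - 6 * Real.pi * (Q * ‖V‖) ≤ |h y| ^ 3 := by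
    intro y
    have hx' : ∃ a ∈ Set.Ico 0 (2 * Real.pi), (a : Torus) = x := by
      have := AddCircle.coe_image_Ico_eq (2 * Real.pi) 0
      rw [zero_add] at this
      have hx := Set.mem_univ x
      rwa [← this] at hx
    have hy' : ∃ a ∈ Set.Ico 0 (2 * Real.pi), (a : Torus) = y := by
      have := AddCircle.coe_image_Ico_eq (2 * Real.pi) 0
      rw [zero_add] at this
      have hx := Set.mem_univ y
      rwa [← this] at hx
    obtain ⟨a, ha, rfl⟩ := hx'
    obtain ⟨b, hb, rfl⟩ := hy'
    linarith [hdiff a ha b hb]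
  -- Averaging in `y` replaces the comparison value `|h y|³` by its mean, itself at most `Q‖V‖`.
  have hmono := integral_mono (μ := haarT) (integrable_const _)
    (g := fun y => |h y| ^ 3) (integrable_haarT (hhc.abs.pow 3)) hall
  rw [integral_const] at hmono
  simp only [probReal_univ, one_smul] at hmono
  have : |h x| ^ 3 ≤ (1 + 6 * Real.pi) * ‖V‖ * Q := by nlinarith
  exact this

/-- The Gagliardo-Nirenberg inequality `‖ψ‖_∞³ ≤ C ‖ψ‖_{H¹} ‖ψ‖_{L⁴}²`. -/
theorem reL_smoothing_cube_le (V : L2C) :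
    ∀ᵐ x ∂haarT, |reL (smoothing 1 V) x| ^ 3 ≤
      (1 + 6 * Real.pi) * ‖V‖ * Real.sqrt (quartic V) := by
  have hlim : Tendsto (fun S : Finset ℤ => projModes S V) atTop (𝓝 V) := by
    have h := fourierBasis.hasSum_repr V
    simp only [← coef_eq_repr] at h
    exact h
  have h1 : Tendsto (fun S : Finset ℤ => reL (smoothing 1 (projModes S V))) atTop
      (𝓝 (reL (smoothing 1 V))) :=
    ((reL.continuous.comp (smoothing 1).continuous).tendsto V).comp hlim
  -- Convergence in `L²` gives pointwise convergence only along a subsequence, which suffices to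
  -- pass to the limit almost everywhere.
  obtain ⟨ns, hns, hae⟩ := (tendstoInMeasure_of_tendsto_Lp h1).exists_seq_tendsto_ae'
  have h2 : Tendsto (fun n => quartic (projModes (ns n) V)) atTop (𝓝 (quartic V)) :=
    (continuous_quartic.tendsto V).comp (hlim.comp hns)
  have hcomm : ∀ S, smoothing 1 (projModes S V) = projModes S (smoothing 1 V) := fun S => by
    refine coef_ext fun k => ?_
    rw [coef_smoothing zero_le_one, coef_projModes, coef_projModes, coef_smoothing zero_le_one]
    split_ifs <;> simp
  have h3 : ∀ᵐ x ∂haarT, ∀ n, reL (smoothing 1 (projModes (ns n) V)) x =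
      (partialSum (ns n) (smoothing 1 V) x).re := by
    refine ae_all_iff.2 fun n => ?_
    rw [hcomm]
    exact coeFn_reL_projModes _ _
  have h4 : ∀ n, quartic (projModes (ns n) V) =
      ∫ y, (partialSum (ns n) (smoothing 1 V) y).re ^ 4 ∂haarT := fun n => by
    rw [quartic]
    refine integral_congr_ae ?_
    rw [hcomm]
    filter_upwards [coeFn_reL_projModes (ns n) (smoothing 1 V)] with x hx
    rw [hx]
  filter_upwards [hae, h3] with x hx1 hx2
  refine le_of_tendsto_of_tendsto' (hx1.abs.pow 3)
    ((h2.sqrt).const_mul ((1 + 6 * Real.pi) * ‖V‖)) fun n => ?_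
  rw [hx2, h4]
  exact re_partialSum_cube_le _ _ _

/-! ### The wave group and Duhamel's formula. -/

/-- By Parseval the squared norm of the difference is a series of continuous functions dominated by
`4|f̂(k)|²`. -/
theorem continuous_waveGroup_apply (f : L2C) : Continuous fun t => waveGroup t f := by
  rw [continuous_iff_continuousAt]
  intro t₀
  rw [ContinuousAt, tendsto_iff_norm_sub_tendsto_zero]
  have h1 : ∀ t, ‖waveGroup t f - waveGroup t₀ f‖ ^ 2 =
      ∑' k, ‖(Complex.exp (-(bracket k * t : ℝ) * Complex.I) -
        Complex.exp (-(bracket k * t₀ : ℝ) * Complex.I)) * coef k f‖ ^ 2 := fun t => by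
    rw [← (hasSum_norm_coef_sq _).tsum_eq]
    refine tsum_congr fun k => ?_
    rw [map_sub, coef_waveGroup, coef_waveGroup, sub_mul]
  have h2 : Continuous fun t => ‖waveGroup t f - waveGroup t₀ f‖ ^ 2 := by
    simp only [h1]
    refine continuous_tsum (fun k => by fun_prop)
      ((hasSum_norm_coef_sq f).summable.mul_left 4) fun k t => ?_
    rw [norm_pow, norm_norm, norm_mul, mul_pow]
    refine mul_le_mul_of_nonneg_right ?_ (sq_nonneg _)
    have h3 : ∀ s : ℝ, ‖Complex.exp (-(bracket k * s : ℝ) * Complex.I)‖ = 1 := fun s => by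
      rw [← Complex.ofReal_neg, Complex.norm_exp_ofReal_mul_I]
    have h4 := norm_sub_le (Complex.exp (-(bracket k * t : ℝ) * Complex.I))
      (Complex.exp (-(bracket k * t₀ : ℝ) * Complex.I))
    rw [h3, h3] at h4
    nlinarith [norm_nonneg (Complex.exp (-(bracket k * t : ℝ) * Complex.I) -
      Complex.exp (-(bracket k * t₀ : ℝ) * Complex.I))]
  have h5 := (h2.tendsto t₀).sqrt
  simpa [Real.sqrt_sq (norm_nonneg _)] using h5

theorem continuous_waveGroup : Continuous fun p : ℝ × L2C => waveGroup p.1 p.2 := by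
  rw [continuous_iff_continuousAt]
  rintro ⟨t₀, f₀⟩
  have h1 : Tendsto (fun p : ℝ × L2C => waveGroup p.1 f₀) (𝓝 (t₀, f₀)) (𝓝 (waveGroup t₀ f₀)) :=
    ((continuous_waveGroup_apply f₀).comp continuous_fst).tendsto (t₀, f₀)
  have h2 : Tendsto (fun p : ℝ × L2C => waveGroup p.1 (p.2 - f₀)) (𝓝 (t₀, f₀)) (𝓝 0) := by
    rw [tendsto_zero_iff_norm_tendsto_zero]
    simp only [norm_waveGroup]
    have : Continuous fun p : ℝ × L2C => ‖p.2 - f₀‖ := by fun_prop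
    simpa using this.tendsto (t₀, f₀)
  have h3 := h1.add h2
  rw [add_zero] at h3
  refine h3.congr fun p => ?_
  rw [map_sub]; abel

theorem Continuous.waveGroup {X : Type*} [TopologicalSpace X] {a : X → ℝ} {f : X → L2C}
    (ha : Continuous a) (hf : Continuous f) : Continuous fun x => _root_.waveGroup (a x) (f x) :=
  continuous_waveGroup.comp (ha.prodMk hf)

/-- The solution `V` of `i V' = B V + F` with `V(0) = V₀`. -/
def duhamel (V₀ : L2C) (F : ℝ → L2C) (t : ℝ) : L2C :=
  waveGroup t (V₀ + ∫ t' in (0 : ℝ)..t, -(Complex.I • waveGroup (-t') (F t')))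

section Duhamel

variable {V₀ : L2C} {F : ℝ → L2C}

theorem duhamel_zero : duhamel V₀ F 0 = V₀ := by simp [duhamel, waveGroup_zero]

theorem continuous_duhamel_integrand (hF : Continuous F) :
    Continuous fun t' => -(Complex.I • waveGroup (-t') (F t')) :=
  ((continuous_neg.waveGroup hF).const_smul Complex.I).neg

theorem hasDerivAt_duhamel_integral (hF : Continuous F) (t : ℝ) :
    HasDerivAt (fun t => V₀ + ∫ t' in (0 : ℝ)..t, -(Complex.I • waveGroup (-t') (F t')))
      (-(Complex.I • waveGroup (-t) (F t))) t :=
  ((continuous_duhamel_integrand hF).integral_hasStrictDerivAt 0 t).hasDerivAt.const_add V₀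

theorem continuous_duhamel (hF : Continuous F) : Continuous (duhamel V₀ F) := by
  refine continuous_id.waveGroup (continuous_iff_continuousAt.2 fun t => ?_)
  exact (hasDerivAt_duhamel_integral hF t).continuousAt

theorem coef_duhamel (hF : Continuous F) (k : ℤ) (t : ℝ) :
    coef k (duhamel V₀ F t) = Complex.exp (-(bracket k * t : ℝ) * Complex.I) *
      (coef k V₀ + ∫ t' in (0 : ℝ)..t,
        -(Complex.I * (Complex.exp ((bracket k * t' : ℝ) * Complex.I) * coef k (F t')))) := by
  rw [duhamel, coef_waveGroup, map_add, ← ContinuousLinearMap.intervalIntegral_comp_comm (coef k)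
    ((continuous_duhamel_integrand hF).intervalIntegrable _ _)]
  congr 2
  refine intervalIntegral.integral_congr fun t' _ => ?_
  simp only [map_neg, map_smul, coef_waveGroup, smul_eq_mul]
  push_cast
  ring_nf

theorem hasDerivAt_coef_duhamel (hF : Continuous F) (k : ℤ) (t : ℝ) :
    HasDerivAt (fun t => coef k (duhamel V₀ F t))
      (-(Complex.I * (bracket k * coef k (duhamel V₀ F t) + coef k (F t)))) t := by
  have h0 : (fun t => coef k (duhamel V₀ F t)) = fun t => _ :=
    funext fun t => coef_duhamel hF k t
  have hc : Continuous fun t' : ℝ =>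
      -(Complex.I * (Complex.exp ((bracket k * t' : ℝ) * Complex.I) * coef k (F t'))) := by
    fun_prop
  have h1 := (hc.integral_hasStrictDerivAt 0 t).hasDerivAt.const_add (coef k V₀)
  have h2 : HasDerivAt (fun t : ℝ => Complex.exp (-(bracket k * t : ℝ) * Complex.I))
      (Complex.exp (-(bracket k * t : ℝ) * Complex.I) * (-(bracket k : ℂ) * Complex.I)) t := by
    have h3 : HasDerivAt (fun t : ℝ => (-(bracket k * t : ℝ) : ℂ) * Complex.I)
        (-(bracket k : ℂ) * Complex.I) t := by
      have h4 : HasDerivAt (fun t : ℝ => (t : ℂ)) 1 t := Complex.ofRealCLM.hasDerivAt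
      have h5 := (h4.const_mul (-(bracket k : ℂ))).mul_const Complex.I
      simp only [mul_one] at h5
      refine h5.congr_of_eventuallyEq (Eventually.of_forall fun s => ?_)
      push_cast; ring
    exact h3.cexp
  rw [h0]
  refine (h2.mul h1).congr_deriv ?_
  rw [coef_duhamel hF]
  have h6 : Complex.exp (-(bracket k * t : ℝ) * Complex.I) *
      Complex.exp ((bracket k * t : ℝ) * Complex.I) = 1 := by
    rw [← Complex.exp_add, neg_mul, neg_add_cancel, Complex.exp_zero]
  linear_combination (-Complex.I * coef k (F t)) * h6

theorem real_inner_eq_re (f g : L2C) : (inner ℝ f g : ℝ) = (inner ℂ f g).re := by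
  rw [L2.inner_def, L2.inner_def]
  have h := integral_re (L2.integrable_inner (𝕜 := ℂ) f g)
  have h' : ∀ z : ℂ, RCLike.re z = z.re := fun _ => rfl
  simp only [h'] at h
  rw [← h]
  rfl

theorem inner_waveGroup (t : ℝ) (f g : L2C) :
    inner ℂ (waveGroup t f) g = inner ℂ f (waveGroup (-t) g) := by
  refine (hasSum_inner_coef _ _).unique ?_
  have h := hasSum_inner_coef f (waveGroup (-t) g)
  convert h using 2 with k
  rw [coef_waveGroup, coef_waveGroup, map_mul, ← Complex.exp_conj, map_mul, Complex.conj_I,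
    map_neg, Complex.conj_ofReal]
  push_cast
  ring_nf

/-- Unitarity allows differentiation in the interaction picture. The unbounded operator `B` never
appears, so `V` need not lie in its domain. -/
theorem hasDerivAt_norm_duhamel_sq (hF : Continuous F) (t : ℝ) :
    HasDerivAt (fun t => ‖duhamel V₀ F t‖ ^ 2)
      (2 * (inner ℂ (duhamel V₀ F t) (-(Complex.I • F t))).re) t := by
  have h := (hasDerivAt_duhamel_integral (V₀ := V₀) hF t).norm_sq
  simp only [duhamel, norm_waveGroup]
  refine h.congr_deriv ?_
  rw [real_inner_eq_re, inner_waveGroup, map_neg, map_smul]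

/-- `V` itself need not be differentiable in `L²`, but `B⁻¹` compensates the `B` in the equation.
The identity is checked mode by mode and the resulting integral is differentiated in `L²`. -/
theorem hasDerivAt_smoothing_duhamel (hF : Continuous F) (t : ℝ) :
    HasDerivAt (fun t => smoothing 1 (duhamel V₀ F t))
      (-(Complex.I • (duhamel V₀ F t + smoothing 1 (F t)))) t := by
  have hc : Continuous fun t => -(Complex.I • (duhamel V₀ F t + smoothing 1 (F t))) :=
    (((continuous_duhamel hF).add ((smoothing 1).continuous.comp hF)).const_smul Complex.I).neg
  have h1 := (hc.integral_hasStrictDerivAt 0 t).hasDerivAt.const_add (smoothing 1 V₀)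
  refine h1.congr_of_eventuallyEq (Eventually.of_forall fun s => coef_ext fun k => ?_)
  dsimp only
  rw [map_add, ← ContinuousLinearMap.intervalIntegral_comp_comm (coef k) (hc.intervalIntegrable _ _)]
  have hb : ((bracket k ^ (-1 : ℝ) : ℝ) : ℂ) * (bracket k : ℂ) = 1 := by
    rw [← Complex.ofReal_mul, Real.rpow_neg_one, inv_mul_cancel₀ (bracket_pos k).ne',
      Complex.ofReal_one]
  have h2 : ∀ r ∈ Set.uIcc 0 s, HasDerivAt (fun t => coef k (smoothing 1 (duhamel V₀ F t)))
      (coef k (-(Complex.I • (duhamel V₀ F r + smoothing 1 (F r))))) r := by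
    intro r _
    simp only [coef_smoothing zero_le_one]
    refine ((hasDerivAt_coef_duhamel hF k r).const_mul _).congr_deriv ?_
    rw [map_neg, map_smul, map_add, coef_smoothing zero_le_one, smul_eq_mul]
    linear_combination (-Complex.I * coef k (duhamel V₀ F r)) * hb
  rw [intervalIntegral.integral_eq_sub_of_hasDerivAt h2
    (((coef k).continuous.comp hc).intervalIntegrable _ _), duhamel_zero]
  ring

theorem hasDerivAt_reL_smoothing_duhamel {G : ℝ → L2R} (hF : Continuous F)
    (hG : ∀ t, F t = ofRealL (G t)) (t : ℝ) :
    HasDerivAt (fun t => reL (smoothing 1 (duhamel V₀ F t))) (imL (duhamel V₀ F t)) t := by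
  have h := reL.hasFDerivAt.comp_hasDerivAt t (hasDerivAt_smoothing_duhamel (V₀ := V₀) hF t)
  refine h.congr_deriv ?_
  rw [reL_neg_I_smul, map_add, hG, imL_smoothing_ofRealL zero_le_one, add_zero]

end Duhamel

theorem integrable_quartic (V : L2C) :
    Integrable (fun x => reL (smoothing 1 V) x ^ 4) haarT := by
  refine (L2.integrable_inner (𝕜 := ℝ) (reL (smoothing 1 V))
    (mul3 (reSobolev (smoothing (2 / 3) V)) (reSobolev (smoothing (2 / 3) V))
      (reSobolev (smoothing (2 / 3) V)))).congr ?_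
  have h := coeFn_reSobolev_smoothing (σ := 2 / 3) (by norm_num) V
  rw [show (1 / 3 + 2 / 3 : ℝ) = 1 by norm_num] at h
  filter_upwards [h, coeFn_mul3 (reSobolev (smoothing (2 / 3) V))
      (reSobolev (smoothing (2 / 3) V)) (reSobolev (smoothing (2 / 3) V))] with x h1 h2
  rw [h2, h1]
  simp; ring

/-- Factoring `p⁴ - q⁴ = (p - q)(p³ + p²q + pq² + q³)` puts the difference quotient in `L²` against
a cubic factor continuous in `L²`. Differentiability of `ψ` in `L²` is then enough, without
differentiability in `L⁴`. -/
theorem hasDerivAt_quartic {V : ℝ → L2C} {D : L2R} {t : ℝ} (hV : ContinuousAt V t)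
    (hD : HasDerivAt (fun t => reL (smoothing 1 (V t))) D t) :
    HasDerivAt (fun t => quartic (V t))
      (4 * inner ℝ D (mul3 (reSobolev (smoothing (2 / 3) (V t)))
        (reSobolev (smoothing (2 / 3) (V t))) (reSobolev (smoothing (2 / 3) (V t))))) t := by
  set x : ℝ → L6R := fun t => reSobolev (smoothing (2 / 3) (V t)) with hx
  set p : ℝ → L2R := fun t => reL (smoothing 1 (V t)) with hp
  set S : ℝ → L2R := fun t' => mul3 (x t') (x t') (x t') + mul3 (x t') (x t') (x t) +
    mul3 (x t') (x t) (x t) + mul3 (x t) (x t) (x t) with hS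
  have hxc : ContinuousAt x t :=
    (reSobolev.continuous.comp (smoothing (2 / 3)).continuous).continuousAt.comp hV
  have hSc : ContinuousAt S t := by
    have h3 : ∀ {a b c : ℝ → L6R}, ContinuousAt a t → ContinuousAt b t → ContinuousAt c t →
        ContinuousAt (fun t' => mul3 (a t') (b t') (c t')) t := fun ha hb hc =>
      continuous_mul3.continuousAt.comp (f := fun t' => (_, _, _)) (ha.prodMk (hb.prodMk hc))
    exact (((h3 hxc hxc hxc).add (h3 hxc hxc continuousAt_const)).add
      (h3 hxc continuousAt_const continuousAt_const)).add
      (h3 continuousAt_const continuousAt_const continuousAt_const)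
  have hae : ∀ t, x t =ᵐ[haarT] p t := fun t => by
    have h := coeFn_reSobolev_smoothing (σ := 2 / 3) (by norm_num) (V t)
    rwa [show (1 / 3 + 2 / 3 : ℝ) = 1 by norm_num] at h
  have hkey : ∀ t', quartic (V t') - quartic (V t) = inner ℝ (p t' - p t) (S t') := by
    intro t'
    rw [quartic, quartic, L2.inner_def, ← integral_sub]
    · refine integral_congr_ae ?_
      filter_upwards [hae t, hae t', Lp.coeFn_sub (p t') (p t),
        Lp.coeFn_add (mul3 (x t') (x t') (x t') + mul3 (x t') (x t') (x t) +
          mul3 (x t') (x t) (x t)) (mul3 (x t) (x t) (x t)),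
        Lp.coeFn_add (mul3 (x t') (x t') (x t') + mul3 (x t') (x t') (x t))
          (mul3 (x t') (x t) (x t)),
        Lp.coeFn_add (mul3 (x t') (x t') (x t')) (mul3 (x t') (x t') (x t)),
        coeFn_mul3 (x t') (x t') (x t'), coeFn_mul3 (x t') (x t') (x t),
        coeFn_mul3 (x t') (x t) (x t), coeFn_mul3 (x t) (x t) (x t)]
        with a h1 h2 h3 h4 h5 h6 h7 h8 h9 h10
      rw [h3, Pi.sub_apply, h4, Pi.add_apply, h5, Pi.add_apply, h6, Pi.add_apply, h7, h8, h9, h10,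
        h1, h2]
      simp
      ring
    · exact integrable_quartic _
    · exact integrable_quartic _
  rw [hasDerivAt_iff_tendsto_slope]
  have hslope := (hasDerivAt_iff_tendsto_slope.1 hD).inner (hSc.tendsto.mono_left nhdsWithin_le_nhds)
    (𝕜 := ℝ)
  have hSt : S t = (4 : ℝ) • mul3 (x t) (x t) (x t) := by
    rw [hS]; module
  rw [hSt, inner_smul_right] at hslope
  refine hslope.congr fun t' => ?_
  rw [slope_def_module, slope_def_module, hkey, inner_smul_left, smul_eq_mul]
  simp [p]

/-! ### Mild solutions and their equivalence with solutions of the integrated system. -/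

/-- The force `μ φ³ + r · α`, where `φ = Re B^{-s} w`. -/
def force {K : ℕ} (μ s : ℝ) (a : Fin K → L2R) (w : L2C) (r : EuclideanSpace ℝ (Fin K)) : L2R :=
  μ • mul3 (reSobolev (smoothing (s - 1 / 3) w)) (reSobolev (smoothing (s - 1 / 3) w))
    (reSobolev (smoothing (s - 1 / 3) w)) + ∑ j, r j • a j

/-- The solution `w = B^s u` of `i ∂ₜ u = B u + B⁻¹ F` with `w(0) = w₀`. -/
def mildField (s : ℝ) (w₀ : L2C) (F : ℝ → L2R) : ℝ → L2C :=
  duhamel w₀ fun t => smoothing (1 - s) (ofRealL (F t))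

/-- Mild solutions on `[0, b]`: `F` is the force and the field is `B^{-s}` of `mildField s w₀ F`. -/
structure IsMildSolution {K : ℕ} (μ s : ℝ) (a : Fin K → L2R) (σ : Fin K → ℝ) (ω : ℝ → Fin K → ℝ)
    (w₀ : L2C) (r₀ : EuclideanSpace ℝ (Fin K)) (b : ℝ) (F : ℝ → L2R)
    (r : ℝ → EuclideanSpace ℝ (Fin K)) : Prop where
  continuous_force : Continuous F
  force_eq : ∀ t ∈ Set.Icc 0 b, F t = force μ s a (mildField s w₀ F t) (r t)
  continuous_reservoir : ContinuousOn r (Set.Icc 0 b)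
  init_reservoir : r 0 = r₀
  reservoir_eq : ∀ t ∈ Set.Icc 0 b, ∀ j, r t j = r₀ j - (∫ t' in (0 : ℝ)..t, r t' j) +
    2 * Real.pi * inner ℝ (a j) (reL (smoothing s (mildField s w₀ F t - w₀))) + σ j * ω t j

theorem continuous_mildField_force {s : ℝ} {F : ℝ → L2R} (hF : Continuous F) :
    Continuous fun t => smoothing (1 - s) (ofRealL (F t)) :=
  (smoothing (1 - s)).continuous.comp (ofRealL.continuous.comp hF)

theorem continuous_mildField {s : ℝ} {w₀ : L2C} {F : ℝ → L2R} (hF : Continuous F) :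
    Continuous (mildField s w₀ F) := continuous_duhamel (continuous_mildField_force hF)

theorem mildField_zero {s : ℝ} {w₀ : L2C} {F : ℝ → L2R} : mildField s w₀ F 0 = w₀ := duhamel_zero

theorem hasDerivAt_coef_mildField {s : ℝ} (hs : 0 ≤ s) (hs1 : s ≤ 1) {w₀ : L2C} {F : ℝ → L2R}
    (hF : Continuous F) (k : ℤ) (t : ℝ) :
    HasDerivAt (fun t => coef k (smoothing s (mildField s w₀ F t)))
      (-(Complex.I * (bracket k * coef k (smoothing s (mildField s w₀ F t)) +
        (bracket k : ℂ)⁻¹ * coef k (ofRealL (F t))))) t := by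
  simp only [coef_smoothing hs]
  refine ((hasDerivAt_coef_duhamel (continuous_mildField_force hF) k t).const_mul _).congr_deriv ?_
  rw [coef_smoothing (by linarith : 0 ≤ 1 - s), ← mildField]
  have h1 : ((bracket k ^ (-s) : ℝ) : ℂ) * ((bracket k ^ (-(1 - s)) : ℝ) : ℂ) =
      (bracket k : ℂ)⁻¹ := by
    rw [← Complex.ofReal_mul, ← Real.rpow_add (bracket_pos k), ← Complex.ofReal_inv,
      ← Real.rpow_neg_one]
    congr 2; ring
  linear_combination (-Complex.I * coef k (ofRealL (F t))) * h1

theorem inner_ofRealL (f g : L2R) : inner ℂ (ofRealL f) (ofRealL g) = ((inner ℝ f g : ℝ) : ℂ) := by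
  rw [L2.inner_def, L2.inner_def, ← integral_complex_ofReal]
  refine integral_congr_ae ?_
  filter_upwards [coeFn_ofRealL f, coeFn_ofRealL g] with x h1 h2
  rw [h1, h2]
  simp

/-- This is `∂ₜφ = π`, mode by mode. The time integral of the distribution `π` is the displacement
of `φ`, which is an `L²` function; this gives the reservoir drift a closed form. -/
theorem integral_bracket_coef_imL {s : ℝ} (hs : 0 ≤ s) (hs1 : s ≤ 1) {w₀ : L2C} {F : ℝ → L2R}
    (hF : Continuous F) (k : ℤ) (t : ℝ) :
    ∫ t' in (0 : ℝ)..t, (bracket k : ℂ) *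
        coef k (ofRealL (imL (smoothing s (mildField s w₀ F t')))) =
      coef k (ofRealL (reL (smoothing s (mildField s w₀ F t - w₀)))) := by
  have hder : ∀ r ∈ Set.uIcc 0 t,
      HasDerivAt (fun t => coef k (ofRealL (reL (smoothing s (mildField s w₀ F t)))))
        ((bracket k : ℂ) * coef k (ofRealL (imL (smoothing s (mildField s w₀ F r))))) r := by
    intro r _
    simp only [coef_ofRealL_reL, coef_ofRealL_imL]
    have h1 := hasDerivAt_coef_mildField hs hs1 (w₀ := w₀) hF k r
    have h2 := (hasDerivAt_coef_mildField hs hs1 (w₀ := w₀) hF (-k) r).star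
    refine ((h1.add h2).div_const 2).congr_deriv ?_
    rw [coef_ofRealL_neg, bracket_neg]
    simp only [Complex.star_def, map_neg, map_mul, map_add, map_inv₀, Complex.conj_I,
      Complex.conj_ofReal, Complex.conj_conj]
    have hbr : (bracket k : ℂ) ≠ 0 := by exact_mod_cast (bracket_pos k).ne'
    field_simp
    rw [Complex.I_sq]
    ring
  have hc : Continuous fun t' => (bracket k : ℂ) *
      coef k (ofRealL (imL (smoothing s (mildField s w₀ F t')))) := by
    have := continuous_mildField (s := s) (w₀ := w₀) hF
    fun_prop
  rw [intervalIntegral.integral_eq_sub_of_hasDerivAt hder (hc.intervalIntegrable _ _),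
    mildField_zero]
  simp only [map_sub]

theorem coeFn_reSobolev_of_ae {s : ℝ} (hs : 1 / 3 ≤ s) {f : Torus → ℂ} {w : L2C}
    (h : f =ᵐ[haarT] smoothing s w) :
    (fun x => (f x).re) =ᵐ[haarT] reSobolev (smoothing (s - 1 / 3) w) := by
  have h1 := coeFn_reSobolev_smoothing (σ := s - 1 / 3) (by linarith) w
  rw [show 1 / 3 + (s - 1 / 3) = s by ring] at h1
  filter_upwards [h, h1, coeFn_reL (smoothing s w)] with x hx1 hx2 hx3
  rw [hx1, hx2, hx3]

theorem coef_force {K : ℕ} {μ s : ℝ} (hs : 1 / 3 ≤ s) {α : Fin K → Torus → ℝ} {a : Fin K → L2R}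
    (ha : ∀ j, (fun x => (α j x : ℂ)) =ᵐ[haarT] ofRealL (a j)) {f : Torus → ℂ} {w : L2C}
    (h : f =ᵐ[haarT] smoothing s w) (r : EuclideanSpace ℝ (Fin K)) (k : ℤ) :
    coef k (ofRealL (force μ s a w r)) =
      (μ : ℂ) * fourierCoeff (fun x => (((f x).re ^ 3 : ℝ) : ℂ)) k +
        ∑ j, (r j : ℂ) * fourierCoeff (fun x => (α j x : ℂ)) k := by
  have h1 : (fun x => (((f x).re ^ 3 : ℝ) : ℂ)) =ᵐ[haarT]
      ofRealL (mul3 (reSobolev (smoothing (s - 1 / 3) w)) (reSobolev (smoothing (s - 1 / 3) w))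
        (reSobolev (smoothing (s - 1 / 3) w))) := by
    filter_upwards [coeFn_reSobolev_of_ae hs h, coeFn_ofRealL (mul3
      (reSobolev (smoothing (s - 1 / 3) w)) (reSobolev (smoothing (s - 1 / 3) w))
        (reSobolev (smoothing (s - 1 / 3) w))), coeFn_mul3
      (reSobolev (smoothing (s - 1 / 3) w)) (reSobolev (smoothing (s - 1 / 3) w))
        (reSobolev (smoothing (s - 1 / 3) w))] with x h2 h3 h4
    rw [h3, h4, h2]
    congr 1; ring
  have hsm : ∀ (c : ℝ) (g : L2R), coef k (ofRealL (c • g)) = (c : ℂ) * coef k (ofRealL g) :=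
    fun c g => by
      rw [map_smul, (coef k).map_smul_of_tower c (ofRealL g), Complex.real_smul]
  rw [force, map_add, map_add, hsm, fourierCoeff_eq_coef h1, map_sum, map_sum]
  congr 1
  refine Finset.sum_congr rfl fun j _ => ?_
  rw [hsm, fourierCoeff_eq_coef (ha j)]

theorem Continuous.mul3 {X : Type*} [TopologicalSpace X] {x y z : X → L6R} (hx : Continuous x)
    (hy : Continuous y) (hz : Continuous z) : Continuous fun t => _root_.mul3 (x t) (y t) (z t) :=
  continuous_mul3.comp (hx.prodMk (hy.prodMk hz))

theorem Continuous.force {X : Type*} [TopologicalSpace X] {K : ℕ} {μ s : ℝ} {a : Fin K → L2R}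
    {w : X → L2C} {r : X → EuclideanSpace ℝ (Fin K)} (hw : Continuous w) (hr : Continuous r) :
    Continuous fun x => _root_.force μ s a (w x) (r x) := by
  unfold _root_.force
  have hx : Continuous fun x => reSobolev (smoothing (s - 1 / 3) (w x)) :=
    reSobolev.continuous.comp ((smoothing (s - 1 / 3)).continuous.comp hw)
  refine Continuous.add ((hx.mul3 hx hx).const_smul μ) ?_
  refine continuous_finsetSum _ fun j _ => ?_
  have hj : Continuous fun x => r x j := by fun_prop
  exact hj.smul continuous_const

/-- The projection of the line to `[0, b]`. -/
def clamp (b t : ℝ) : ℝ := max 0 (min b t)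

theorem continuous_clamp (b : ℝ) : Continuous (clamp b) := by unfold clamp; fun_prop

theorem clamp_mem {b : ℝ} (hb : 0 ≤ b) (t : ℝ) : clamp b t ∈ Set.Icc 0 b :=
  ⟨le_max_left _ _, max_le hb (min_le_left _ _)⟩

theorem clamp_of_mem {b t : ℝ} (ht : t ∈ Set.Icc 0 b) : clamp b t = t := by
  rw [clamp, min_eq_right ht.2, max_eq_right ht.1]

theorem ContinuousOn.clamp {X : Type*} [TopologicalSpace X] {b : ℝ} (hb : 0 ≤ b) {f : ℝ → X}
    (hf : ContinuousOn f (Set.Icc 0 b)) : Continuous fun t => f (_root_.clamp b t) :=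
  hf.comp_continuous (continuous_clamp b) (clamp_mem hb)

/-- Uniqueness for `i y' = λ y + g`. -/
theorem eq_of_integral_eq {b lam : ℝ} {y g z : ℝ → ℂ} (hb : 0 ≤ b)
    (hy : ContinuousOn y (Set.Icc 0 b)) (hg : Continuous g)
    (hyeq : ∀ t ∈ Set.Icc 0 b, Complex.I * (y t - y 0) = ∫ t' in (0 : ℝ)..t, (lam * y t' + g t'))
    (hz : ∀ t, HasDerivAt z (-(Complex.I * (lam * z t + g t))) t) (h0 : z 0 = y 0) :
    ∀ t ∈ Set.Icc 0 b, y t = z t := by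
  set y' : ℝ → ℂ := fun t => y (clamp b t) with hy'
  have hc : Continuous fun t => -(Complex.I * (lam * y' t + g t)) := by
    have : Continuous y' := hy.clamp hb
    fun_prop
  -- Only continuity of `y` on `[0, b]` is known. `Y` agrees with it there and is differentiable
  -- everywhere; the factor `e^{iλt}` then makes `Y - z` constant.
  set Y : ℝ → ℂ := fun t => y 0 + ∫ t' in (0 : ℝ)..t, -(Complex.I * (lam * y' t' + g t')) with hY
  have hYd : ∀ t, HasDerivAt Y (-(Complex.I * (lam * y' t + g t))) t := fun t =>
    (hc.integral_hasStrictDerivAt 0 t).hasDerivAt.const_add (y 0)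
  have hYy : ∀ t ∈ Set.Icc 0 b, y t = Y t := by
    intro t ht
    have h1 : ∫ t' in (0 : ℝ)..t, -(Complex.I * (lam * y' t' + g t')) =
        -(Complex.I * ∫ t' in (0 : ℝ)..t, (lam * y t' + g t')) := by
      rw [← intervalIntegral.integral_const_mul, ← intervalIntegral.integral_neg]
      refine intervalIntegral.integral_congr fun t' ht' => ?_
      rw [Set.uIcc_of_le ht.1] at ht'
      simp only [hy', clamp_of_mem ⟨ht'.1, ht'.2.trans ht.2⟩]
    simp only [hY]
    rw [h1, ← hyeq t ht]
    linear_combination (y t - y 0) * Complex.I_sq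
  set D : ℝ → ℂ := fun t => Complex.exp (lam * t * Complex.I) * (Y t - z t) with hD
  have hDd : ∀ t ∈ Set.Ico 0 b, HasDerivWithinAt D 0 (Set.Ici t) t := by
    intro t ht
    have h4 : HasDerivAt (fun t : ℝ => (t : ℂ)) 1 t := Complex.ofRealCLM.hasDerivAt
    have h5 := ((h4.const_mul (lam : ℂ)).mul_const Complex.I).cexp
    refine ((h5.mul ((hYd t).sub (hz t))).congr_deriv ?_).hasDerivWithinAt
    have ht' : t ∈ Set.Icc 0 b := ⟨ht.1, ht.2.le⟩
    have h6 : y' t = Y t := by rw [← hYy t ht']; simp only [hy', clamp_of_mem ht']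
    rw [h6, Pi.sub_apply]
    ring
  have hDc : Continuous D := by
    have h1 : Continuous Y := continuous_iff_continuousAt.2 fun t => (hYd t).continuousAt
    have h2 : Continuous z := continuous_iff_continuousAt.2 fun t => (hz t).continuousAt
    fun_prop
  intro t ht
  have h7 := constant_of_has_deriv_right_zero hDc.continuousOn hDd t ht
  have h8 : D 0 = 0 := by
    simp only [hD]
    rw [← hYy 0 ⟨le_rfl, hb⟩, h0]; ring
  rw [h8] at h7
  have h9 := (mul_eq_zero.1 h7).resolve_left (Complex.exp_ne_zero _)
  rw [hYy t ht, sub_eq_zero.1 h9]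

section Equivalence

variable {K : ℕ} {μ s : ℝ} {α : Fin K → Torus → ℝ} {T : Fin K → ℝ} {ω : ℝ → Fin K → ℝ}
  {u₀ : Torus → ℂ} {r₀ : EuclideanSpace ℝ (Fin K)} {b : ℝ} {a : Fin K → L2R} {w₀ : L2C}

theorem hasSum_reservoir (hs : 0 ≤ s) (hs1 : s ≤ 1)
    (ha : ∀ j, (fun x => (α j x : ℂ)) =ᵐ[haarT] ofRealL (a j)) {F : ℝ → L2R} (hF : Continuous F)
    {u : ℝ → Torus → ℂ} (hu : ∀ t ∈ Set.Icc 0 b, u t =ᵐ[haarT] smoothing s (mildField s w₀ F t))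
    {t : ℝ} (ht : t ∈ Set.Icc 0 b) (j : Fin K) :
    HasSum (fun k : ℤ => 2 * (Real.pi : ℂ) *
        starRingEnd ℂ (fourierCoeff (fun x => (α j x : ℂ)) k) *
        ∫ t' in (0 : ℝ)..t, (bracket k : ℂ) * fourierCoeff (fun x => ((u t' x).im : ℂ)) k)
      ((2 * Real.pi * inner ℝ (a j) (reL (smoothing s (mildField s w₀ F t - w₀))) : ℝ) : ℂ) := by
  have h1 : ∀ k, ∫ t' in (0 : ℝ)..t,
      (bracket k : ℂ) * fourierCoeff (fun x => ((u t' x).im : ℂ)) k =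
      coef k (ofRealL (reL (smoothing s (mildField s w₀ F t - w₀)))) := fun k => by
    rw [← integral_bracket_coef_imL hs hs1 hF]
    refine intervalIntegral.integral_congr fun t' ht' => ?_
    rw [Set.uIcc_of_le ht.1] at ht'
    have h2 : (fun x => ((u t' x).im : ℂ)) =ᵐ[haarT]
        ofRealL (imL (smoothing s (mildField s w₀ F t'))) := by
      filter_upwards [hu t' ⟨ht'.1, ht'.2.trans ht.2⟩, coeFn_ofRealL
        (imL (smoothing s (mildField s w₀ F t'))), coeFn_imL (smoothing s (mildField s w₀ F t'))]
        with x h3 h4 h5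
      rw [h4, h5, h3]
    simp only [fourierCoeff_eq_coef h2]
  have h6 := (hasSum_inner_coef (ofRealL (a j))
    (ofRealL (reL (smoothing s (mildField s w₀ F t - w₀))))).mul_left (2 * (Real.pi : ℂ))
  rw [inner_ofRealL] at h6
  simp only [h1, fourierCoeff_eq_coef (ha j)]
  push_cast
  simpa only [mul_assoc] using h6

/-- Integrating the modewise derivative of the Duhamel formula gives the field equation, and `∂ₜφ =
π` with Parseval gives the reservoir equation. This turns constructed mild solutions into the
solutions of the statement. -/
theorem IsMildSolution.isSolutionOn (hs : 1 / 3 ≤ s) (hs1 : s ≤ 1)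
    (ha : ∀ j, (fun x => (α j x : ℂ)) =ᵐ[haarT] ofRealL (a j))
    (hu₀ : u₀ =ᵐ[haarT] smoothing s w₀) {F : ℝ → L2R} {r : ℝ → EuclideanSpace ℝ (Fin K)}
    (h : IsMildSolution μ s a (fun j => Real.sqrt (2 * T j)) ω w₀ r₀ b F r) :
    IsSolutionOn μ s α T ω u₀ r₀ b (fun t => smoothing s (mildField s w₀ F t)) r where
  mem t _ := memSobolev_of_ae (by linarith) EventuallyEq.rfl
  continuous_field t _ := by
    have h1 : ∀ t', sobolevNormSq s (⇑(smoothing s (mildField s w₀ F t')) -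
        ⇑(smoothing s (mildField s w₀ F t))) =
        ENNReal.ofReal (2 * Real.pi * ‖mildField s w₀ F t' - mildField s w₀ F t‖ ^ 2) := fun t' => by
      refine sobolevNormSq_of_ae (by linarith) ?_
      rw [map_sub]
      exact (Lp.coeFn_sub _ _).symm
    simp only [h1]
    have h2 : Continuous fun t' => ENNReal.ofReal
        (2 * Real.pi * ‖mildField s w₀ F t' - mildField s w₀ F t‖ ^ 2) := by
      have := continuous_mildField (s := s) (w₀ := w₀) h.continuous_force
      exact ENNReal.continuous_ofReal.comp (by fun_prop)
    have h3 := h2.tendsto t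
    simp only [sub_self, norm_zero] at h3
    norm_num at h3
    exact h3.mono_left nhdsWithin_le_nhds
  continuous_reservoir := h.continuous_reservoir
  init_field := by
    rw [mildField_zero]
    exact ae_haarT_iff.2 hu₀.symm
  init_reservoir := h.init_reservoir
  field_eq t ht k := by
    have h1 : ∀ t' ∈ Set.uIcc 0 t, HasDerivAt
        (fun t => Complex.I * coef k (smoothing s (mildField s w₀ F t))) _ t' := fun t' _ =>
      (hasDerivAt_coef_mildField (by linarith) hs1 h.continuous_force k t').const_mul Complex.I
    have hc := continuous_mildField (s := s) (w₀ := w₀) h.continuous_force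
    have hc2 := h.continuous_force
    have h2 := intervalIntegral.integral_eq_sub_of_hasDerivAt h1
      (Continuous.intervalIntegrable (by fun_prop) _ _)
    rw [← coef_eq_fourierCoeff, ← coef_eq_fourierCoeff, mul_sub, ← h2]
    refine intervalIntegral.integral_congr fun t' ht' => ?_
    rw [Set.uIcc_of_le ht.1] at ht'
    have h3 := coef_force (μ := μ) hs ha (f := smoothing s (mildField s w₀ F t'))
      (w := mildField s w₀ F t') EventuallyEq.rfl (r t') k
    rw [← h.force_eq t' ⟨ht'.1, ht'.2.trans ht.2⟩] at h3
    simp only [← h3, ← coef_eq_fourierCoeff]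
    linear_combination (-((bracket k : ℂ) * coef k (smoothing s (mildField s w₀ F t')) +
      (bracket k : ℂ)⁻¹ * coef k (ofRealL (F t')))) * Complex.I_sq
  reservoir_eq t ht j := by
    have h1 := hasSum_reservoir (b := b) (by linarith : 0 ≤ s) hs1 ha (w₀ := w₀)
      h.continuous_force (u := fun t => smoothing s (mildField s w₀ F t))
      (fun _ _ => EventuallyEq.rfl) ht j
    convert h1 using 2
    rw [h.init_reservoir]
    linarith [h.reservoir_eq t ht j]

theorem continuousOn_of_sobolevNormSq (hs0 : 0 ≤ s) {u : ℝ → Torus → ℂ} {w : ℝ → L2C}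
    (hw : ∀ t, t ∈ Set.Icc 0 b → u t =ᵐ[haarT] smoothing s (w t))
    (hu : ∀ t ∈ Set.Icc 0 b,
      Tendsto (fun t' => sobolevNormSq s (u t' - u t)) (𝓝[Set.Icc 0 b] t) (𝓝 0)) :
    ContinuousOn w (Set.Icc 0 b) := by
  intro t ht
  rw [ContinuousWithinAt, tendsto_iff_norm_sub_tendsto_zero]
  have h1 : ∀ t' ∈ Set.Icc 0 b, sobolevNormSq s (u t' - u t) =
      ENNReal.ofReal (2 * Real.pi * ‖w t' - w t‖ ^ 2) := fun t' ht' => by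
    refine sobolevNormSq_of_ae hs0 ?_
    rw [map_sub]
    exact ((hw t' ht').sub (hw t ht)).trans (Lp.coeFn_sub _ _).symm
  have h2 := hu t ht
  have h3 := (ENNReal.tendsto_toReal (by simp : (0 : ℝ≥0∞) ≠ ∞)).comp h2
  have h4 := ((h3.const_mul (2 * Real.pi)⁻¹).sqrt)
  simp only [ENNReal.toReal_zero, mul_zero, Real.sqrt_zero] at h4
  refine h4.congr' ?_
  filter_upwards [self_mem_nhdsWithin] with t' ht'
  have hpi := Real.two_pi_pos
  rw [Function.comp_apply, h1 t' ht', ENNReal.toReal_ofReal (by positivity), ← mul_assoc,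
    inv_mul_cancel₀ hpi.ne', one_mul, Real.sqrt_sq (norm_nonneg _)]

theorem smoothing_injective {s : ℝ} (hs0 : 0 ≤ s) : Function.Injective (smoothing s) := by
  intro f g h
  refine coef_ext fun k => ?_
  have h3 := congrArg (coef k) h
  rw [coef_smoothing hs0, coef_smoothing hs0] at h3
  exact mul_left_cancel₀ (by exact_mod_cast (bracket_rpow_pos _ _).ne') h3

/-- Given the force along the solution, each Fourier mode solves a scalar linear equation, whose
uniqueness identifies it with the Duhamel mode. Energy bounds for mild solutions therefore apply to
arbitrary solutions. -/
theorem IsSolutionOn.exists_isMildSolution (hs : 1 / 3 ≤ s) (hs1 : s ≤ 1) (hb : 0 ≤ b)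
    (ha : ∀ j, (fun x => (α j x : ℂ)) =ᵐ[haarT] ofRealL (a j))
    (hu₀ : u₀ =ᵐ[haarT] smoothing s w₀) {u : ℝ → Torus → ℂ} {r : ℝ → EuclideanSpace ℝ (Fin K)}
    (h : IsSolutionOn μ s α T ω u₀ r₀ b u r) :
    ∃ F, IsMildSolution μ s a (fun j => Real.sqrt (2 * T j)) ω w₀ r₀ b F r ∧
      ∀ t ∈ Set.Icc 0 b, u t =ᵐ[haarT] smoothing s (mildField s w₀ F t) := by
  have hs0 : 0 ≤ s := by linarith
  have hw : ∀ t, ∃ w : L2C, t ∈ Set.Icc 0 b → u t =ᵐ[haarT] smoothing s w := fun t => by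
    by_cases ht : t ∈ Set.Icc 0 b
    · obtain ⟨w, hw⟩ := (h.mem t ht).exists_ae hs0
      exact ⟨w, fun _ => hw⟩
    · exact ⟨0, fun h => absurd h ht⟩
  choose w hw using hw
  have h0 : (0 : ℝ) ∈ Set.Icc 0 b := ⟨le_rfl, hb⟩
  have hw0 : w 0 = w₀ := by
    have h1 : u 0 =ᵐ[haarT] u₀ := ae_haarT_iff.1 h.init_field
    exact smoothing_injective hs0 (Lp.ext (((hw 0 h0).symm.trans h1).trans hu₀))
  have hwc := continuousOn_of_sobolevNormSq hs0 hw h.continuous_field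
  -- Freezing the force outside `[0, b]` makes it continuous on the line, so that Duhamel terms have
  -- two-sided derivatives at the endpoints as well.
  obtain ⟨F, hFdef⟩ : ∃ F : ℝ → L2R, F = fun t => force μ s a (w (clamp b t)) (r (clamp b t)) :=
    ⟨_, rfl⟩
  have hw' : Continuous fun t => w (clamp b t) := hwc.clamp hb
  have hr' : Continuous fun t => r (clamp b t) := h.continuous_reservoir.clamp hb
  have hF : Continuous F := by
    rw [hFdef]
    exact hw'.force hr'
  have hFeq : ∀ t ∈ Set.Icc 0 b, F t = force μ s a (w t) (r t) := fun t ht => by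
    simp only [hFdef, clamp_of_mem ht]
  have hwF : ∀ t ∈ Set.Icc 0 b, w t = mildField s w₀ F t := by
    have h1 : ∀ k, ∀ t ∈ Set.Icc 0 b, coef k (smoothing s (w t)) =
        coef k (smoothing s (mildField s w₀ F t)) := fun k => by
      refine eq_of_integral_eq (lam := bracket k)
        (y := fun t => coef k (smoothing s (w t)))
        (z := fun t => coef k (smoothing s (mildField s w₀ F t)))
        (g := fun t => (bracket k : ℂ)⁻¹ * coef k (ofRealL (F t))) hb ?_ (by fun_prop) ?_ ?_ ?_
      · exact ((coef k).continuous.comp (smoothing s).continuous).comp_continuousOn hwc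
      · intro t ht
        have h2 := h.field_eq t ht k
        rw [fourierCoeff_eq_coef (hw t ht), fourierCoeff_eq_coef (hw 0 h0)] at h2
        rw [h2]
        refine intervalIntegral.integral_congr fun t' ht' => ?_
        rw [Set.uIcc_of_le ht.1] at ht'
        have ht'' : t' ∈ Set.Icc 0 b := ⟨ht'.1, ht'.2.trans ht.2⟩
        dsimp only
        rw [fourierCoeff_eq_coef (hw t' ht''), hFeq t' ht'', coef_force hs ha (hw t' ht'')]
      · exact fun t => hasDerivAt_coef_mildField hs0 hs1 hF k t
      · rw [mildField_zero, hw0]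
    exact fun t ht => smoothing_injective hs0 (coef_ext fun k => h1 k t ht)
  have hu : ∀ t ∈ Set.Icc 0 b, u t =ᵐ[haarT] smoothing s (mildField s w₀ F t) := fun t ht => by
    rw [← hwF t ht]; exact hw t ht
  refine ⟨F, ⟨hF, fun t ht => by rw [hFeq t ht, hwF t ht], h.continuous_reservoir,
    h.init_reservoir, fun t ht j => ?_⟩, hu⟩
  have h1 := (hasSum_reservoir hs0 hs1 ha hF hu ht j).unique (h.reservoir_eq t ht j)
  have h2 := Complex.ofReal_injective h1
  rw [h.init_reservoir] at h2
  linarith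

end Equivalence

/-! ### The free and forced parts, and the linear energy estimate. -/

theorem continuous_ofRealL_comp {F : ℝ → L2R} (hF : Continuous F) :
    Continuous fun t => ofRealL (F t) := ofRealL.continuous.comp hF

theorem duhamel_add {V₀ V₁ : L2C} {F G : ℝ → L2C} (hF : Continuous F) (hG : Continuous G) (t : ℝ) :
    duhamel (V₀ + V₁) (fun t => F t + G t) t = duhamel V₀ F t + duhamel V₁ G t := by
  simp only [duhamel, map_add, smul_add, neg_add]
  rw [intervalIntegral.integral_add ((continuous_duhamel_integrand hF).intervalIntegrable _ _)
    ((continuous_duhamel_integrand hG).intervalIntegrable _ _), map_add]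
  abel

theorem map_duhamel (A : L2C →L[ℂ] L2C) (hA : ∀ t f, A (waveGroup t f) = waveGroup t (A f))
    {V₀ : L2C} {F : ℝ → L2C} (hF : Continuous F) (t : ℝ) :
    A (duhamel V₀ F t) = duhamel (A V₀) (fun t => A (F t)) t := by
  simp only [duhamel]
  rw [hA, map_add, ← ContinuousLinearMap.intervalIntegral_comp_comm A
    ((continuous_duhamel_integrand hF).intervalIntegrable _ _)]
  simp only [map_neg, map_smul, hA]

theorem duhamel_eq_add (V₀ : L2C) (F : ℝ → L2C) (t : ℝ) :
    duhamel V₀ F t = waveGroup t V₀ + duhamel 0 F t := by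
  simp only [duhamel, map_add, zero_add]

/-- The forced part gains `1 - s` derivatives over the free wave: in terms of `u = B^{-s}w` it lies
in `H¹`. This gain is what makes energy methods available for rough data. -/
theorem mildField_eq {s : ℝ} (hs1 : s ≤ 1) (w₀ : L2C) {F : ℝ → L2R} (hF : Continuous F) (t : ℝ) :
    mildField s w₀ F t =
      waveGroup t w₀ + smoothing (1 - s) (duhamel 0 (fun t => ofRealL (F t)) t) := by
  have hs : 0 ≤ 1 - s := by linarith
  rw [map_duhamel _ (fun t f => (waveGroup_smoothing hs t f).symm) (continuous_ofRealL_comp hF),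
    map_zero, mildField, duhamel_eq_add]

theorem smoothing_mildField_sub {s : ℝ} (hs : 0 ≤ s) (hs1 : s ≤ 1) (w₀ : L2C) {F : ℝ → L2R}
    (hF : Continuous F) (t : ℝ) :
    smoothing s (mildField s w₀ F t - w₀) = smoothing s (waveGroup t w₀ - w₀) +
      smoothing 1 (duhamel 0 (fun t => ofRealL (F t)) t) := by
  have h1 : mildField s w₀ F t - w₀ = (waveGroup t w₀ - w₀) +
      smoothing (1 - s) (duhamel 0 (fun t => ofRealL (F t)) t) := by
    rw [mildField_eq hs1 w₀ hF]; abel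
  rw [h1, map_add, smoothing_add hs (by linarith), add_sub_cancel]

theorem hasDerivAt_inner_reL_smoothing_duhamel (f : L2R) {V₀ : L2C} {F : ℝ → L2R}
    (hF : Continuous F) (t : ℝ) :
    HasDerivAt (fun t => inner ℝ f (reL (smoothing 1 (duhamel V₀ (fun t => ofRealL (F t)) t))))
      (inner ℝ f (imL (duhamel V₀ (fun t => ofRealL (F t)) t))) t :=
  (innerSL ℝ f).hasFDerivAt.comp_hasDerivAt t
    (hasDerivAt_reL_smoothing_duhamel (continuous_ofRealL_comp hF) (fun _ => rfl) t)

theorem continuous_coord {X : Type*} [TopologicalSpace X] {K : ℕ}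
    {r : X → EuclideanSpace ℝ (Fin K)} (hr : Continuous r) (j : Fin K) :
    Continuous fun x => r x j := by fun_prop

/-- The growth constant of the linear system. -/
def couplingConst {K : ℕ} (a : Fin K → L2R) : ℝ := 1 + ∑ j, (2 * Real.pi * ‖a j‖ + 2)

theorem one_le_couplingConst {K : ℕ} (a : Fin K → L2R) : 1 ≤ couplingConst a := by
  have h : 0 ≤ ∑ j, (2 * Real.pi * ‖a j‖ + 2) := Finset.sum_nonneg fun j _ => by positivity
  unfold couplingConst
  linarith

/-- The energy bound for the part of the linear solution that is driven by the reservoirs. -/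
theorem linear_energy_bound {K : ℕ} {s : ℝ} {a : Fin K → L2R} {σ : Fin K → ℝ}
    {ω : ℝ → Fin K → ℝ} {w₀ : L2C} {r₀ : EuclideanSpace ℝ (Fin K)} {b : ℝ} {F : ℝ → L2R}
    {r : ℝ → EuclideanSpace ℝ (Fin K)} (h : IsMildSolution 0 s a σ ω w₀ r₀ b F r)
    (hs : 0 ≤ s) (hs1 : s ≤ 1) {β G : ℝ} (hβ : 0 < β) (hG : 0 < G) (hr₀ : ‖r₀‖ ≤ β)
    (hg : ∀ t ∈ Set.Icc 0 b, ∀ j, |2 * Real.pi * inner ℝ (a j)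
      (reL (smoothing s (waveGroup t w₀ - w₀))) + σ j * ω t j| ≤ G) :
    ∀ t ∈ Set.Icc 0 b,
      ‖duhamel 0 (fun t => ofRealL (F t)) t‖ ≤ β + G * couplingConst a * t ∧
      ∀ j, |r t j| ≤ G + 2 * (β + G * couplingConst a * t) := by
  intro t₁ ht₁
  have hb : 0 ≤ b := ht₁.1.trans ht₁.2
  have hF := h.continuous_force
  obtain ⟨Y, hY⟩ : ∃ Y : ℝ → L2C, Y = duhamel 0 (fun t => ofRealL (F t)) := ⟨_, rfl⟩
  have hYc : Continuous Y := hY ▸ continuous_duhamel (continuous_ofRealL_comp hF)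
  have hYn : ∀ t, HasDerivAt (fun t => ‖Y t‖ ^ 2) (2 * -inner ℝ (imL (Y t)) (F t)) t := fun t => by
    have h1 := hasDerivAt_norm_duhamel_sq (V₀ := 0) (continuous_ofRealL_comp hF) t
    rwa [re_inner_neg_I_smul_ofRealL, ← hY] at h1
  have hYa : ∀ j t, HasDerivAt (fun t => inner ℝ (a j) (reL (smoothing 1 (Y t))))
      (inner ℝ (a j) (imL (Y t))) t := fun j t => by
    rw [hY]; exact hasDerivAt_inner_reL_smoothing_duhamel (a j) hF t
  have hr' : Continuous fun t => r (clamp b t) := h.continuous_reservoir.clamp hb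
  have hrc : ∀ j, Continuous fun t => r (clamp b t) j := continuous_coord hr'
  -- `p` is the reservoir variable without the free wave and the noise, which may fail to be
  -- differentiable in time.
  set p : Fin K → ℝ → ℝ := fun j t => r₀ j - (∫ t' in (0 : ℝ)..t, r (clamp b t') j) +
    2 * Real.pi * inner ℝ (a j) (reL (smoothing 1 (Y t))) with hp
  have hpd : ∀ j t, HasDerivAt (p j)
      (-r (clamp b t) j + 2 * Real.pi * inner ℝ (a j) (imL (Y t))) t := fun j t => by
    have h1 := ((hrc j).integral_hasStrictDerivAt 0 t).hasDerivAt.const_sub (r₀ j)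
    exact h1.add ((hYa j t).const_mul _)
  have hrp : ∀ t ∈ Set.Icc 0 b, ∀ j, r t j = p j t + (2 * Real.pi * inner ℝ (a j)
      (reL (smoothing s (waveGroup t w₀ - w₀))) + σ j * ω t j) := fun t ht j => by
    have h1 : ∫ t' in (0 : ℝ)..t, r (clamp b t') j = ∫ t' in (0 : ℝ)..t, r t' j := by
      refine intervalIntegral.integral_congr fun t' ht' => ?_
      rw [Set.uIcc_of_le ht.1] at ht'
      simp only [clamp_of_mem ⟨ht'.1, ht'.2.trans ht.2⟩]
    rw [h.reservoir_eq t ht j, smoothing_mildField_sub hs hs1 w₀ hF, ← hY, map_add, inner_add_right]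
    simp only [hp, h1]
    ring
  set e : ℝ → ℝ := fun t => Real.pi * ‖Y t‖ ^ 2 + ∑ j, p j t ^ 2 / 2 with he
  set e' : ℝ → ℝ := fun t => Real.pi * (2 * -inner ℝ (imL (Y t)) (F t)) +
    ∑ j, p j t * (-r (clamp b t) j + 2 * Real.pi * inner ℝ (a j) (imL (Y t))) with he'
  have hed : ∀ t, HasDerivAt e (e' t) t := fun t => by
    refine ((hYn t).const_mul _).add (HasDerivAt.fun_sum fun j _ => ?_)
    refine (((hpd j t).fun_pow 2).div_const 2).congr_deriv ?_
    simp only [Nat.cast_ofNat]; ring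
  set A := couplingConst a with hA
  have hA1 : 1 ≤ A := one_le_couplingConst a
  have hYe : ∀ t, ‖Y t‖ ^ 2 ≤ e t := fun t => by
    have h1 : 0 ≤ ∑ j, p j t ^ 2 / 2 := Finset.sum_nonneg fun j _ => by positivity
    simp only [he]
    nlinarith [Real.pi_gt_three, sq_nonneg ‖Y t‖]
  have hpe : ∀ t j, p j t ^ 2 ≤ 2 * e t := fun t j => by
    have h1 := Finset.single_le_sum (f := fun j => p j t ^ 2 / 2) (fun j _ => by positivity)
      (Finset.mem_univ j)
    have h2 : 0 ≤ Real.pi * ‖Y t‖ ^ 2 := by have := Real.pi_pos; positivity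
    simp only [he]
    linarith
  -- The derivative of `e` need be compared with that of the barrier only where the two meet. There
  -- `√e = m`, and `e' ≤ GAm` is strictly below the barrier's slope `2GAm`.
  have hfence : ∀ t ∈ Set.Icc 0 b, e t ≤ (β + G * A * t) ^ 2 := by
    intro t ht
    refine image_le_of_deriv_right_lt_deriv_boundary' (f := e) (f' := e')
      (B := fun t => (β + G * A * t) ^ 2) (B' := fun t => 2 * (β + G * A * t) * (G * A))
      (continuous_iff_continuousAt.2 fun t => (hed t).continuousAt).continuousOn
      (fun t _ => (hed t).hasDerivWithinAt) ?_ (by fun_prop) (fun t _ => ?_) ?_ ht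
    · have h1 : ∀ j, p j 0 = r₀ j := fun j => by
        simp only [hp, hY, duhamel_zero, map_zero, inner_zero_right, mul_zero,
          intervalIntegral.integral_same]; ring
      have h2 : ∑ j, r₀ j ^ 2 = ‖r₀‖ ^ 2 := by
        rw [EuclideanSpace.norm_sq_eq]; simp
      simp only [he, h1, hY, duhamel_zero, norm_zero]
      rw [← Finset.sum_div, h2]
      nlinarith [norm_nonneg r₀]
    · have h1 := ((((hasDerivAt_id t).const_mul (G * A)).const_add β).fun_pow 2)
      refine (h1.congr_deriv ?_).hasDerivWithinAt
      simp
    · intro t ht hte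
      have ht' : t ∈ Set.Icc 0 b := ⟨ht.1, ht.2.le⟩
      set m := β + G * A * t with hm
      have hm0 : 0 < m := by
        have := ht.1
        positivity
      have hY2 : ‖Y t‖ ≤ m := le_of_sq_le_sq ((hYe t).trans hte.le) hm0.le
      have hp2 : ∀ j, |p j t| ≤ 2 * m := fun j => by
        refine le_of_sq_le_sq ?_ (by positivity)
        rw [sq_abs]
        nlinarith [hpe t j]
      have hF' : F t = ∑ j, r t j • a j := by
        rw [h.force_eq t ht', force, zero_smul, zero_add]
      set g : Fin K → ℝ := fun j => 2 * Real.pi * inner ℝ (a j)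
        (reL (smoothing s (waveGroup t w₀ - w₀))) + σ j * ω t j with hgdef
      -- Since `r = p + g`, the work of `p` on the field cancels the work of the field on `p`. The
      -- dissipation `-p²` and terms linear in `g` remain.
      have h1 : e' t = ∑ j, (-p j t ^ 2 - g j * (p j t + 2 * Real.pi * inner ℝ (a j) (imL (Y t)))) := by
        simp only [he', hF', clamp_of_mem ht', inner_sum, inner_smul_right]
        rw [mul_neg, Finset.mul_sum, mul_neg, Finset.mul_sum, ← Finset.sum_neg_distrib,
          ← Finset.sum_add_distrib]
        refine Finset.sum_congr rfl fun j _ => ?_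
        rw [real_inner_comm (a j), hrp t ht' j]
        ring
      have h2 : ∀ j, -p j t ^ 2 - g j * (p j t + 2 * Real.pi * inner ℝ (a j) (imL (Y t))) ≤
          G * m * (2 * Real.pi * ‖a j‖ + 2) := fun j => by
        have h3 : |inner ℝ (a j) (imL (Y t))| ≤ ‖a j‖ * m :=
          (abs_real_inner_le_norm _ _).trans (by
            have := (norm_imL_le (Y t)).trans hY2
            gcongr)
        have h4 : |p j t + 2 * Real.pi * inner ℝ (a j) (imL (Y t))| ≤
            2 * m + 2 * Real.pi * (‖a j‖ * m) := by
          refine (abs_add_le _ _).trans (add_le_add (hp2 j) ?_)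
          rw [abs_mul, abs_of_pos Real.two_pi_pos]
          have := Real.two_pi_pos
          gcongr
        have h5 : -(g j * (p j t + 2 * Real.pi * inner ℝ (a j) (imL (Y t)))) ≤
            G * (2 * m + 2 * Real.pi * (‖a j‖ * m)) := by
          refine (neg_le_abs _).trans ?_
          rw [abs_mul]
          have h6 := hg t ht' j
          have h7 : (0 : ℝ) ≤ 2 * m + 2 * Real.pi * (‖a j‖ * m) := (abs_nonneg _).trans h4
          gcongr
        nlinarith [sq_nonneg (p j t)]
      have h3 : e' t ≤ G * m * ∑ j, (2 * Real.pi * ‖a j‖ + 2) := by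
        rw [h1, Finset.mul_sum]
        exact Finset.sum_le_sum fun j _ => h2 j
      have h4 : ∑ j, (2 * Real.pi * ‖a j‖ + 2) ≤ A := by
        rw [hA, couplingConst]; linarith
      calc e' t ≤ G * m * A := h3.trans (by gcongr)
        _ < 2 * m * (G * A) := by
          have : 0 < G * m * A := by positivity
          linarith
  have hm0 : 0 ≤ β + G * A * t₁ := by
    have := ht₁.1
    positivity
  refine ⟨?_, fun j => ?_⟩
  · rw [← hY]
    exact le_of_sq_le_sq ((hYe t₁).trans (hfence t₁ ht₁)) hm0
  · have h1 : |p j t₁| ≤ 2 * (β + G * A * t₁) := by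
      refine le_of_sq_le_sq ?_ (by positivity)
      rw [sq_abs]
      nlinarith [hpe t₁ j, hfence t₁ ht₁]
    rw [hrp t₁ ht₁ j]
    refine (abs_add_le _ _).trans ?_
    linarith [hg t₁ ht₁ j]

/-! Projections and the field difference. -/

theorem ofRealL_reL_of_conjL {f : L2C} (h : conjL f = f) : ofRealL (reL f) = f := by
  rw [ofRealL_reL, h, ← two_smul ℂ, smul_smul]; norm_num

/-- The projection `P_{> N}` on the real `L²`. -/
def highR (N : ℕ) (f : L2R) : L2R := reL (highProj N (ofRealL f))

theorem ofRealL_highR (N : ℕ) (f : L2R) : ofRealL (highR N f) = highProj N (ofRealL f) := by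
  refine ofRealL_reL_of_conjL (coef_ext fun k => ?_)
  rw [coef_conjL, coef_highProj, coef_highProj, abs_neg, coef_ofRealL_neg]
  split_ifs <;> simp

theorem norm_highR_le (N : ℕ) (f : L2R) : ‖highR N f‖ ≤ ‖f‖ :=
  ((norm_reL_le _).trans (norm_highProj_le N _)).trans (norm_ofRealL f).le

theorem continuous_highR (N : ℕ) : Continuous (highR N) :=
  reL.continuous.comp ((highProj N).continuous.comp ofRealL.continuous)

theorem highProj_waveGroup (N : ℕ) (t : ℝ) (f : L2C) :
    highProj N (waveGroup t f) = waveGroup t (highProj N f) := by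
  refine coef_ext fun k => ?_
  rw [coef_highProj, coef_waveGroup, coef_waveGroup, coef_highProj]
  split_ifs <;> simp

theorem lowPower_waveGroup (N : ℕ) (σ t : ℝ) (f : L2C) :
    lowPower N σ (waveGroup t f) = waveGroup t (lowPower N σ f) := by
  refine coef_ext fun k => ?_
  rw [coef_lowPower, coef_waveGroup, coef_waveGroup, coef_lowPower]
  ring

theorem highProj_smoothing (N : ℕ) {σ : ℝ} (hσ : 0 ≤ σ) (f : L2C) :
    highProj N (smoothing σ f) = smoothing σ (highProj N f) := by
  refine coef_ext fun k => ?_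
  rw [coef_highProj, coef_smoothing hσ, coef_smoothing hσ, coef_highProj]
  split_ifs <;> simp

theorem norm_smoothing_highProj_le {N : ℕ} (hN : 1 ≤ N) {σ : ℝ} (hσ : 0 ≤ σ) (f : L2C) :
    ‖smoothing σ (highProj N f)‖ ≤ (N : ℝ) ^ (-σ) * ‖f‖ := by
  have hN' : (0 : ℝ) < N := by exact_mod_cast hN
  refine norm_le_of_coef (by positivity) fun k => ?_
  rw [coef_smoothing hσ, coef_highProj, norm_mul, Complex.norm_real,
    Real.norm_of_nonneg (bracket_rpow_pos _ _).le]
  split_ifs with h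
  · simp only [norm_zero, mul_zero]; positivity
  · gcongr ?_ * _
    refine Real.rpow_le_rpow_of_nonpos hN' ?_ (by linarith)
    refine le_trans ?_ (abs_le_bracket k)
    have h1 : (N : ℤ) ≤ |k| := (not_le.1 h).le
    rw [← Int.cast_abs]
    exact_mod_cast h1

/-- This identifies `P_{≤N}B^{1-s}w₀` as `B P_{≤N} u₀`, the initial value of `V`: at time zero the
two fields coincide, so only low modes are left. -/
theorem smoothing_one_lowPower (N : ℕ) {s : ℝ} (hs : 0 ≤ s) (f : L2C) :
    smoothing 1 (lowPower N (1 - s) f) = smoothing s (lowPower N 0 f) := by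
  refine coef_ext fun k => ?_
  rw [coef_smoothing zero_le_one, coef_smoothing hs, coef_lowPower, coef_lowPower]
  split_ifs
  · rw [← mul_assoc, ← mul_assoc, ← Complex.ofReal_mul, ← Complex.ofReal_mul,
      ← Real.rpow_add (bracket_pos k), ← Real.rpow_add (bracket_pos k)]
    congr 3; ring
  · simp

/-- The field `V = B (u - P_{>N} uₒ)`, in terms of the two forces. -/
def diffField (N : ℕ) (s : ℝ) (w₀ : L2C) (F Fo : ℝ → L2R) : ℝ → L2C :=
  duhamel (lowPower N (1 - s) w₀) fun t => ofRealL (F t - highR N (Fo t))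

theorem diffField_eq {N : ℕ} {s : ℝ} (w₀ : L2C) {F Fo : ℝ → L2R} (hF : Continuous F)
    (hFo : Continuous Fo) (t : ℝ) :
    diffField N s w₀ F Fo t = waveGroup t (lowPower N (1 - s) w₀) +
      (duhamel 0 (fun t => ofRealL (F t)) t -
        highProj N (duhamel 0 (fun t => ofRealL (Fo t)) t)) := by
  have h1 := map_duhamel (V₀ := 0) (F := fun t => ofRealL (Fo t)) (-highProj N)
    (fun t f => by simp [highProj_waveGroup]) (continuous_ofRealL_comp hFo) t
  have h2 := duhamel_add (V₀ := lowPower N (1 - s) w₀) (V₁ := (-highProj N) 0)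
    (continuous_ofRealL_comp hF)
    ((-highProj N).continuous.comp (continuous_ofRealL_comp hFo)) t
  rw [sub_eq_add_neg (duhamel 0 (fun t => ofRealL (F t)) t), ← add_assoc, ← duhamel_eq_add]
  have h3 : -highProj N (duhamel 0 (fun t => ofRealL (Fo t)) t) =
    (-highProj N) (duhamel 0 (fun t => ofRealL (Fo t)) t) := rfl
  rw [h3, h1]
  refine Eq.trans ?_ h2
  rw [map_zero, add_zero, diffField]
  congr 1
  funext t
  rw [map_sub, ofRealL_highR, sub_eq_add_neg]
  rfl

/-- The high modes of the two free waves cancel, the data being the same. This justifies reading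
`diffField` as `B(u - P_{>N} uₒ)`. -/
theorem smoothing_one_diffField {N : ℕ} {s : ℝ} (hs : 0 ≤ s) (hs1 : s ≤ 1) (w₀ : L2C)
    {F Fo : ℝ → L2R} (hF : Continuous F) (hFo : Continuous Fo) (t : ℝ) :
    smoothing 1 (diffField N s w₀ F Fo t) = smoothing s (mildField s w₀ F t) -
      highProj N (smoothing s (mildField s w₀ Fo t)) := by
  have hs' : 0 ≤ 1 - s := by linarith
  have h3 : highProj N (smoothing s (waveGroup t w₀)) =
      smoothing s (waveGroup t w₀) - lowPower N 0 (smoothing s (waveGroup t w₀)) := rfl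
  have h4 : lowPower N 0 (smoothing s (waveGroup t w₀)) =
      smoothing s (lowPower N 0 (waveGroup t w₀)) := by
    refine coef_ext fun k => ?_
    rw [coef_smoothing hs, coef_lowPower, coef_lowPower, coef_smoothing hs]
    ring
  rw [diffField_eq w₀ hF hFo, mildField_eq hs1 w₀ hF, mildField_eq hs1 w₀ hFo, map_add, map_add,
    map_add, map_add, ← lowPower_waveGroup, smoothing_one_lowPower N hs, smoothing_add hs hs',
    smoothing_add hs hs', add_sub_cancel, map_sub, h3, h4, highProj_smoothing N zero_le_one]
  abel

/-- The reservoir difference is driven by `B(u - uₒ)`, whereas the energy contains `V`. They differ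
by `B P_{≤N} uₒ`, split here into free and forced parts because the two are estimated differently.
-/
theorem duhamel_sub_eq {N : ℕ} {s : ℝ} (w₀ : L2C) {F Fo : ℝ → L2R} (hF : Continuous F)
    (hFo : Continuous Fo) (t : ℝ) :
    duhamel 0 (fun t => ofRealL (F t - Fo t)) t = diffField N s w₀ F Fo t -
      lowPower N (1 - s) (waveGroup t w₀) -
      lowPower N 0 (duhamel 0 (fun t => ofRealL (Fo t)) t) := by
  have h1 := map_duhamel (V₀ := 0) (F := fun t => ofRealL (Fo t)) (-ContinuousLinearMap.id ℂ L2C)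
    (fun t f => by simp) (continuous_ofRealL_comp hFo) t
  have h2 := duhamel_add (V₀ := 0) (V₁ := 0) (continuous_ofRealL_comp hF)
    ((-ContinuousLinearMap.id ℂ L2C).continuous.comp (continuous_ofRealL_comp hFo)) t
  rw [map_zero] at h1
  have h3 : ∀ f, highProj N f = f - lowPower N 0 f := fun f => rfl
  have h4 : duhamel 0 (fun t => ofRealL (F t - Fo t)) t =
      duhamel 0 (fun t => ofRealL (F t)) t - duhamel 0 (fun t => ofRealL (Fo t)) t := by
    have h5 : (fun t => ofRealL (F t - Fo t)) =
        fun t => ofRealL (F t) + (-ContinuousLinearMap.id ℂ L2C) (ofRealL (Fo t)) := by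
      funext t
      rw [map_sub, sub_eq_add_neg]; rfl
    rw [h5, sub_eq_add_neg]
    rw [add_zero] at h2
    refine h2.trans ?_
    rw [add_right_inj]
    exact h1.symm
  rw [h4, diffField_eq w₀ hF hFo, h3, lowPower_waveGroup]
  abel

/-! The cubic nonlinearity. -/

/-- The constant function `1` in `L⁶`. -/
def oneL : L6R := Lp.const 6 haarT (1 : ℝ)

theorem norm_oneL_le : ‖oneL‖ ≤ 1 := by
  exact (Lp.norm_const_le 6 haarT (1 : ℝ)).trans (by simp)

/-- Expand into `3x²z + 3xz² + z³`. In the term linear in `z` both factors `x` are taken in the sup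
norm, so that `z` is needed only in `L²`, where it is small. -/
theorem norm_cube_add_sub_le {x z : L6R} {z₂ : L2R} {S : ℝ}
    (hz : z =ᵐ[haarT] z₂) (hx : ∀ᵐ a ∂haarT, |x a| ≤ S) :
    ‖mul3 (x + z) (x + z) (x + z) - mul3 x x x‖ ≤
      3 * (S ^ 2 * ‖z₂‖) + 3 * (S * ‖z‖ ^ 2) + ‖z‖ ^ 3 := by
  have hS : 0 ≤ S := by
    obtain ⟨a, ha⟩ := hx.exists
    exact (abs_nonneg _).trans ha
  have h1 : mul3 (x + z) (x + z) (x + z) - mul3 x x x =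
      (3 : ℝ) • mul3 x x z + (3 : ℝ) • mul3 x z z + mul3 z z z := by
    apply Lp.ext
    filter_upwards [Lp.coeFn_sub (mul3 (x + z) (x + z) (x + z)) (mul3 x x x),
      coeFn_mul3 (x + z) (x + z) (x + z), coeFn_mul3 x x x, Lp.coeFn_add x z,
      Lp.coeFn_add ((3 : ℝ) • mul3 x x z + (3 : ℝ) • mul3 x z z) (mul3 z z z),
      Lp.coeFn_add ((3 : ℝ) • mul3 x x z) ((3 : ℝ) • mul3 x z z),
      Lp.coeFn_smul (3 : ℝ) (mul3 x x z), Lp.coeFn_smul (3 : ℝ) (mul3 x z z),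
      coeFn_mul3 x x z, coeFn_mul3 x z z, coeFn_mul3 z z z]
      with a e1 e2 e3 e4 e5 e6 e7 e8 e9 e10 e11
    rw [e1, Pi.sub_apply, e2, e3, e4, e5, Pi.add_apply, Pi.add_apply, e6, Pi.add_apply, e7, e8,
      Pi.smul_apply, Pi.smul_apply, e9, e10, e11, smul_eq_mul, smul_eq_mul]
    ring
  have h2 : ‖mul3 x x z‖ ≤ S ^ 2 * ‖z₂‖ := by
    refine Lp.norm_le_mul_norm_of_ae_le_mul ?_
    filter_upwards [hx, hz, coeFn_mul3 x x z] with a e1 e2 e3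
    rw [e3, e2, norm_mul, norm_mul, Real.norm_eq_abs, Real.norm_eq_abs, sq]
    gcongr
  have h3 : ‖mul3 x z z‖ ≤ S * ‖z‖ ^ 2 := by
    -- Inserting the constant 1 writes `z²` as a triple product, so that its `L²` norm is bounded by
    -- `‖z‖²` in `L⁶`.
    have h4 : ‖mul3 x z z‖ ≤ S * ‖mul3 oneL z z‖ := by
      refine Lp.norm_le_mul_norm_of_ae_le_mul ?_
      filter_upwards [hx, coeFn_mul3 x z z, coeFn_mul3 oneL z z,
        Lp.coeFn_const 6 haarT (1 : ℝ)] with a e1 e2 e3 e4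
      have e5 : oneL a = 1 := e4
      rw [e2, e3, e5, one_mul, mul_assoc, norm_mul]
      gcongr
      exact e1
    refine h4.trans ?_
    gcongr
    refine (norm_mul3_le _ _ _).trans ?_
    rw [sq, mul_assoc]
    exact mul_le_of_le_one_left (by positivity) norm_oneL_le
  have h5 : ‖mul3 z z z‖ ≤ ‖z‖ ^ 3 := (norm_mul3_le _ _ _).trans (le_of_eq (by ring))
  rw [h1]
  refine norm_add₃_le.trans ?_
  rw [norm_smul, norm_smul, Real.norm_of_nonneg (by norm_num : (0 : ℝ) ≤ 3)]
  gcongr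

/-- A constant for the interpolation of the sup norm with the energy. -/
def cubeConst (μ : ℝ) : ℝ :=
  (μ * (1 + 6 * Real.pi)) ^ (2 / 3 : ℝ) + (μ ^ 2 * Real.sqrt μ * (1 + 6 * Real.pi)) ^ (1 / 3 : ℝ)

theorem cubeConst_nonneg {μ : ℝ} (hμ : 0 ≤ μ) : 0 ≤ cubeConst μ := by
  have := Real.pi_pos
  unfold cubeConst; positivity

/-- Compare cubes. Keeping the powers of `μ` on the left avoids dividing by `√μ`, so `μ = 0` is
covered. -/
theorem mul_sq_le_cubeConst {μ S M : ℝ} (hμ : 0 ≤ μ) (hS : 0 ≤ S) (hM : 0 ≤ M)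
    (h : Real.sqrt μ * S ^ 3 ≤ (1 + 6 * Real.pi) * M) :
    μ * S ^ 2 ≤ cubeConst μ * M ^ (2 / 3 : ℝ) ∧ μ * S ≤ cubeConst μ * M ^ (1 / 3 : ℝ) := by
  have hpi := Real.pi_pos
  have hsq := Real.sq_sqrt hμ
  constructor
  · have h1 : μ * S ^ 2 ≤ (μ * (1 + 6 * Real.pi)) ^ (2 / 3 : ℝ) * M ^ (2 / 3 : ℝ) := by
      rw [← Real.mul_rpow (by positivity) hM]
      refine le_of_pow_le_pow_left₀ (n := 3) (by norm_num) (by positivity) ?_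
      rw [← Real.rpow_natCast (_ ^ (2 / 3 : ℝ)), ← Real.rpow_mul (by positivity)]
      norm_num
      calc (μ * S ^ 2) ^ 3 = μ ^ 2 * (Real.sqrt μ * S ^ 3) ^ 2 := by
            rw [mul_pow (Real.sqrt μ), hsq]; ring
        _ ≤ μ ^ 2 * ((1 + 6 * Real.pi) * M) ^ 2 := by gcongr
        _ = _ := by ring
    refine h1.trans ?_
    unfold cubeConst
    gcongr
    have : 0 ≤ (μ ^ 2 * Real.sqrt μ * (1 + 6 * Real.pi)) ^ (1 / 3 : ℝ) := by positivity
    linarith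
  · have h1 : μ * S ≤ (μ ^ 2 * Real.sqrt μ * (1 + 6 * Real.pi)) ^ (1 / 3 : ℝ) * M ^ (1 / 3 : ℝ) := by
      rw [← Real.mul_rpow (by positivity) hM]
      refine le_of_pow_le_pow_left₀ (n := 3) (by norm_num) (by positivity) ?_
      rw [← Real.rpow_natCast (_ ^ (1 / 3 : ℝ)), ← Real.rpow_mul (by positivity)]
      norm_num
      calc (μ * S) ^ 3 = μ ^ 2 * Real.sqrt μ * (Real.sqrt μ * S ^ 3) := by
            linear_combination (-μ ^ 2 * S ^ 3) * hsq
        _ ≤ μ ^ 2 * Real.sqrt μ * ((1 + 6 * Real.pi) * M) := by gcongr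
        _ = _ := by ring
    refine h1.trans ?_
    unfold cubeConst
    gcongr
    have : 0 ≤ (μ * (1 + 6 * Real.pi)) ^ (2 / 3 : ℝ) := by positivity
    linarith

/-- `B^{-γ}` is self-adjoint, so the smoothness of `a` can be spent on the field, saving a factor
`⟨N⟩^γ`. This is the source of the condition involving `γ`. -/
theorem abs_inner_imL_lowPower_le {N : ℕ} {ρ γ : ℝ} (hγ : 0 ≤ γ) (hργ : γ ≤ ρ) {a : L2R} {c : L2C}
    (hc : ofRealL a = smoothing γ c) (f : L2C) :
    |inner ℝ a (imL (lowPower N ρ f))| ≤ bracket N ^ (ρ - γ) * ‖f‖ * ‖c‖ := by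
  have h1 : inner ℂ (lowPower N ρ f) (ofRealL a) = inner ℂ (lowPower N (ρ - γ) f) c := by
    rw [hc]
    refine (hasSum_inner_coef _ _).unique ?_
    have h := hasSum_inner_coef (lowPower N (ρ - γ) f) c
    convert h using 2 with k
    rw [coef_lowPower, coef_lowPower, coef_smoothing hγ]
    split_ifs
    · rw [map_mul, map_mul, Complex.conj_ofReal, Complex.conj_ofReal, sub_eq_add_neg,
        Real.rpow_add (bracket_pos k), Complex.ofReal_mul]
      ring
    · simp
  rw [real_inner_comm, ← reL_neg_I_smul, ← re_inner_ofRealL_right]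
  refine (Complex.abs_re_le_norm _).trans ?_
  rw [inner_neg_left, inner_smul_left, norm_neg, norm_mul, h1]
  simp only [Complex.conj_I, norm_neg, Complex.norm_I, one_mul]
  refine (norm_inner_le_norm _ _).trans ?_
  gcongr
  exact norm_lowPower_le N (by linarith) f

/-! ### Growth of the energy of the difference. -/

/-- The energy of the difference, where `V = B (u - P_{>N} uₒ)` and `q = r - rₒ`. -/
def diffEnergy {K : ℕ} (μ : ℝ) (V : L2C) (q : EuclideanSpace ℝ (Fin K)) : ℝ :=
  Real.pi * ‖V‖ ^ 2 + ‖q‖ ^ 2 / 2 + μ * Real.pi / 2 * quartic V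

theorem diffEnergy_bounds {K : ℕ} {μ M : ℝ} (hμ : 0 ≤ μ) {V : L2C}
    {q : EuclideanSpace ℝ (Fin K)} (h : diffEnergy μ V q ≤ M) :
    ‖V‖ ≤ Real.sqrt M ∧ (∀ j, |q j| ≤ 2 * Real.sqrt M) ∧ μ * quartic V ≤ M := by
  have hpi := Real.pi_gt_three
  have hq := quartic_nonneg V
  have h1 : 0 ≤ μ * quartic V := mul_nonneg hμ hq
  have h2 : μ * quartic V ≤ μ * Real.pi / 2 * quartic V := by nlinarith
  have h3 : ‖V‖ ^ 2 ≤ Real.pi * ‖V‖ ^ 2 := by nlinarith [sq_nonneg ‖V‖]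
  unfold diffEnergy at h
  have h4 := sq_nonneg ‖q‖
  have h5 := sq_nonneg ‖V‖
  have hM : 0 ≤ M := by linarith
  refine ⟨Real.le_sqrt_of_sq_le (by linarith), fun j => ?_, by linarith⟩
  refine le_of_sq_le_sq ?_ (by positivity)
  rw [mul_pow, Real.sq_sqrt hM]
  have h6 : |q j| ≤ ‖q‖ := by simpa using PiLp.norm_apply_le q j
  have h7 : |q j| ^ 2 ≤ ‖q‖ ^ 2 := by gcongr
  linarith

/-- The energy bound supplies both factors of Gagliardo-Nirenberg, `‖V‖ ≤ √M` and `√(μ · quartic V)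
≤ √M`; hence the sup norm of `ψ` costs only `M^{1/3}`. -/
theorem norm_mul_cube_sub_le {μ M : ℝ} (hμ : 0 ≤ μ) {V : L2C} (hV : ‖V‖ ≤ Real.sqrt M)
    (hq : μ * quartic V ≤ M) (hM : 0 ≤ M) {x z : L6R} {z₂ : L2R}
    (hx : x = reSobolev (smoothing (2 / 3) V)) (hz : z =ᵐ[haarT] z₂) :
    μ * ‖mul3 (x + z) (x + z) (x + z) - mul3 x x x‖ ≤
      3 * (cubeConst μ * M ^ (2 / 3 : ℝ) * ‖z₂‖) + 3 * (cubeConst μ * M ^ (1 / 3 : ℝ) * ‖z‖ ^ 2) +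
        μ * ‖z‖ ^ 3 := by
  have hpi := Real.pi_pos
  have hL : 0 ≤ (1 + 6 * Real.pi) * ‖V‖ * Real.sqrt (quartic V) := by positivity
  obtain ⟨S, hS⟩ : ∃ S, S = ((1 + 6 * Real.pi) * ‖V‖ * Real.sqrt (quartic V)) ^ (1 / 3 : ℝ) :=
    ⟨_, rfl⟩
  have hS0 : 0 ≤ S := hS ▸ Real.rpow_nonneg hL _
  have hS3 : S ^ 3 = (1 + 6 * Real.pi) * ‖V‖ * Real.sqrt (quartic V) := by
    rw [hS, ← Real.rpow_natCast, ← Real.rpow_mul hL]; norm_num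
  have hxS : ∀ᵐ a ∂haarT, |x a| ≤ S := by
    have h := coeFn_reSobolev_smoothing (σ := 2 / 3) (by norm_num) V
    rw [show (1 / 3 + 2 / 3 : ℝ) = 1 by norm_num, ← hx] at h
    filter_upwards [h, reL_smoothing_cube_le V] with a h1 h2
    rw [h1]
    rw [← hS3] at h2
    exact le_of_pow_le_pow_left₀ (by norm_num) hS0 h2
  have hc := mul_sq_le_cubeConst hμ hS0 hM (by
    rw [hS3]
    calc Real.sqrt μ * ((1 + 6 * Real.pi) * ‖V‖ * Real.sqrt (quartic V)) =
        (1 + 6 * Real.pi) * (‖V‖ * Real.sqrt (μ * quartic V)) := by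
          rw [Real.sqrt_mul hμ]; ring
      _ ≤ (1 + 6 * Real.pi) * (Real.sqrt M * Real.sqrt M) := by gcongr
      _ = _ := by rw [Real.mul_self_sqrt hM])
  calc μ * ‖mul3 (x + z) (x + z) (x + z) - mul3 x x x‖
      ≤ μ * (3 * (S ^ 2 * ‖z₂‖) + 3 * (S * ‖z‖ ^ 2) + ‖z‖ ^ 3) := by
        gcongr; exact norm_cube_add_sub_le hz hxS
    _ = 3 * (μ * S ^ 2 * ‖z₂‖) + 3 * (μ * S * ‖z‖ ^ 2) + μ * ‖z‖ ^ 3 := by ring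
    _ ≤ _ := by
        have h1 := hc.1
        have h2 := hc.2
        gcongr

/-- A bound for the growth rate of the energy of the difference while it is at most `M`. -/
def energyRate {K : ℕ} (μ s γ : ℝ) (a : Fin K → L2R) (c : Fin K → L2C) (N : ℕ)
    (w Y R M : ℝ) : ℝ :=
  2 * Real.pi * Real.sqrt M *
    (3 * (cubeConst μ * M ^ (2 / 3 : ℝ) * ((N : ℝ) ^ (-s) * (w + (N : ℝ) ^ (-(1 - s)) * Y))) +
      3 * (cubeConst μ * M ^ (1 / 3 : ℝ) * (sobolevConst * (w + (N : ℝ) ^ (-(1 - s)) * Y)) ^ 2) +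
      μ * (sobolevConst * (w + (N : ℝ) ^ (-(1 - s)) * Y)) ^ 3 + 2 * (R * ∑ j, ‖a j‖)) +
    4 * Real.pi * Real.sqrt M * ∑ j, (bracket N ^ (1 - s - γ) * w * ‖c j‖ + ‖a j‖ * Y)

theorem le_energyRate {K : ℕ} {μ s γ : ℝ} {a : Fin K → L2R} {c : Fin K → L2C} {N : ℕ}
    {w Y R M : ℝ} (hμ : 0 ≤ μ) {V : L2C} (hV : ‖V‖ ≤ Real.sqrt M) (hq : μ * quartic V ≤ M)
    (hM : 0 ≤ M) {x z : L6R} {z₂ : L2R} (hx : x = reSobolev (smoothing (2 / 3) V))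
    (hz : z =ᵐ[haarT] z₂) (hz1 : ‖z‖ ≤ sobolevConst * (w + (N : ℝ) ^ (-(1 - s)) * Y))
    (hz2 : ‖z₂‖ ≤ (N : ℝ) ^ (-s) * (w + (N : ℝ) ^ (-(1 - s)) * Y)) {f : L2R}
    (hf : ‖f‖ ≤ 2 * (R * ∑ j, ‖a j‖)) {Q d₁ d₂ : Fin K → ℝ}
    (hQ : ∀ j, |Q j| ≤ 2 * Real.sqrt M)
    (hd₁ : ∀ j, |d₁ j| ≤ bracket N ^ (1 - s - γ) * w * ‖c j‖) (hd₂ : ∀ j, |d₂ j| ≤ ‖a j‖ * Y) :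
    -(2 * Real.pi) * inner ℝ (imL V) (μ • (mul3 (x + z) (x + z) (x + z) - mul3 x x x) + f) +
        ∑ j, (-Q j ^ 2 - 2 * Real.pi * (Q j * (d₁ j + d₂ j))) ≤
      energyRate μ s γ a c N w Y R M := by
  have hcube := norm_mul_cube_sub_le hμ hV hq hM hx hz
  have hCn := cubeConst_nonneg hμ
  have hpi := Real.pi_pos
  rw [energyRate]
  refine add_le_add ?_ ((Finset.sum_le_sum fun j _ => ?_).trans_eq (Finset.mul_sum _ _ _).symm)
  · refine (le_abs_self _).trans ?_
    rw [abs_mul, abs_neg, abs_of_pos Real.two_pi_pos, mul_assoc (2 * Real.pi)]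
    gcongr 2 * Real.pi * ?_
    refine (abs_real_inner_le_norm _ _).trans ?_
    have h1 : ‖μ • (mul3 (x + z) (x + z) (x + z) - mul3 x x x) + f‖ ≤
        (3 * (cubeConst μ * M ^ (2 / 3 : ℝ) * ‖z₂‖) +
          3 * (cubeConst μ * M ^ (1 / 3 : ℝ) * ‖z‖ ^ 2) + μ * ‖z‖ ^ 3) +
          2 * (R * ∑ j, ‖a j‖) := by
      refine (norm_add_le _ _).trans (add_le_add ?_ hf)
      rw [norm_smul, Real.norm_of_nonneg hμ]
      exact hcube
    refine mul_le_mul ((norm_imL_le V).trans hV) (h1.trans ?_) (norm_nonneg _)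
      (Real.sqrt_nonneg _)
    gcongr
  · have h5 : -(Q j * (d₁ j + d₂ j)) ≤
        2 * Real.sqrt M * (bracket N ^ (1 - s - γ) * w * ‖c j‖ + ‖a j‖ * Y) := by
      refine (neg_le_abs _).trans ?_
      rw [abs_mul]
      exact mul_le_mul (hQ j) ((abs_add_le _ _).trans (add_le_add (hd₁ j) (hd₂ j)))
        (abs_nonneg _) (by positivity)
    have h7 := mul_le_mul_of_nonneg_left h5 Real.two_pi_pos.le
    nlinarith [sq_nonneg (Q j)]

theorem norm_highProj_mildField_le {N : ℕ} (hN : 1 ≤ N) {s : ℝ} (hs1 : s ≤ 1) {w₀ : L2C}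
    {F : ℝ → L2R} (hF : Continuous F) {t Y : ℝ}
    (hY : ‖duhamel 0 (fun t => ofRealL (F t)) t‖ ≤ Y) :
    ‖highProj N (mildField s w₀ F t)‖ ≤ ‖w₀‖ + (N : ℝ) ^ (-(1 - s)) * Y := by
  have hs' : 0 ≤ 1 - s := by linarith
  rw [mildField_eq hs1 w₀ hF, map_add, highProj_smoothing N hs']
  refine (norm_add_le _ _).trans (add_le_add ?_ ?_)
  · exact (norm_highProj_le N _).trans (norm_waveGroup _ _).le
  · exact (norm_smoothing_highProj_le hN hs' _).trans (by gcongr)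

theorem highProj_highProj (N : ℕ) (f : L2C) : highProj N (highProj N f) = highProj N f := by
  refine coef_ext fun k => ?_
  simp only [coef_highProj]
  split_ifs <;> rfl

theorem smoothing_diffField_eq {N : ℕ} {s : ℝ} (hs : 1 / 3 ≤ s) (hs1 : s ≤ 1) (w₀ : L2C)
    {F Fo : ℝ → L2R} (hF : Continuous F) (hFo : Continuous Fo) (t : ℝ) :
    smoothing (2 / 3) (diffField N s w₀ F Fo t) =
      smoothing (s - 1 / 3) (mildField s w₀ F t) -
        smoothing (s - 1 / 3) (highProj N (mildField s w₀ Fo t)) := by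
  have h1 : (0 : ℝ) ≤ 1 / 3 := by norm_num
  have h2 : 0 ≤ s - 1 / 3 := by linarith
  apply smoothing_injective h1
  rw [map_sub, smoothing_add h1 h2, smoothing_add h1 h2, smoothing_add h1 (by norm_num),
    add_sub_cancel, ← highProj_smoothing N (by linarith), ← smoothing_one_diffField (by linarith)
    hs1 w₀ hF hFo]
  norm_num

section Bound

variable {K : ℕ} {μ s γ : ℝ} {a : Fin K → L2R} {c : Fin K → L2C} {σ : Fin K → ℝ}
  {ω : ℝ → Fin K → ℝ} {w₀ : L2C} {r₀ : EuclideanSpace ℝ (Fin K)} {b : ℝ} {F Fo : ℝ → L2R}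
  {r ro : ℝ → EuclideanSpace ℝ (Fin K)}

/-- The initial reservoirs, the free wave and the noise are common to both systems and cancel. The
right side is differentiable in time even though each reservoir need not be. -/
theorem diff_reservoir_eq (h : IsMildSolution μ s a σ ω w₀ r₀ b F r)
    (ho : IsMildSolution 0 s a σ ω w₀ r₀ b Fo ro) (hs : 0 ≤ s) (hs1 : s ≤ 1) (hb : 0 ≤ b)
    {t : ℝ} (ht : t ∈ Set.Icc 0 b) (j : Fin K) :
    r t j - ro t j = -(∫ t' in (0 : ℝ)..t, (r (clamp b t') j - ro (clamp b t') j)) +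
      2 * Real.pi * inner ℝ (a j)
        (reL (smoothing 1 (duhamel 0 (fun t => ofRealL (F t - Fo t)) t))) := by
  have hr' : Continuous fun t => r (clamp b t) := h.continuous_reservoir.clamp hb
  have hro' : Continuous fun t => ro (clamp b t) := ho.continuous_reservoir.clamp hb
  have h1 : ∀ r : ℝ → EuclideanSpace ℝ (Fin K),
      ∫ t' in (0 : ℝ)..t, r (clamp b t') j = ∫ t' in (0 : ℝ)..t, r t' j := fun r => by
    refine intervalIntegral.integral_congr fun t' ht' => ?_
    rw [Set.uIcc_of_le ht.1] at ht'
    simp only [clamp_of_mem ⟨ht'.1, ht'.2.trans ht.2⟩]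
  rw [intervalIntegral.integral_sub ((continuous_coord hr' j).intervalIntegrable _ _)
    ((continuous_coord hro' j).intervalIntegrable _ _), h1, h1, h.reservoir_eq t ht j,
    ho.reservoir_eq t ht j, smoothing_mildField_sub hs hs1 w₀ h.continuous_force,
    smoothing_mildField_sub hs hs1 w₀ ho.continuous_force]
  have h2 : duhamel 0 (fun t => ofRealL (F t - Fo t)) t =
      duhamel 0 (fun t => ofRealL (F t)) t - duhamel 0 (fun t => ofRealL (Fo t)) t := by
    rw [duhamel_sub_eq (N := 0) (s := s) w₀ h.continuous_force ho.continuous_force,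
      diffField_eq w₀ h.continuous_force ho.continuous_force, lowPower_waveGroup]
    have h3 : ∀ f, highProj 0 f = f - lowPower 0 0 f := fun f => rfl
    rw [h3]
    abel
  have h4 : reL (smoothing 1 (duhamel 0 (fun t => ofRealL (F t - Fo t)) t)) =
      reL (smoothing 1 (duhamel 0 (fun t => ofRealL (F t)) t)) -
        reL (smoothing 1 (duhamel 0 (fun t => ofRealL (Fo t)) t)) := by
    rw [h2, map_sub, map_sub]
  rw [h4, map_add, map_add, inner_sub_right, inner_add_right, inner_add_right]
  ring

theorem force_sub_eq (h : IsMildSolution μ s a σ ω w₀ r₀ b F r)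
    (ho : IsMildSolution 0 s a σ ω w₀ r₀ b Fo ro) (hs : 1 / 3 ≤ s) (hs1 : s ≤ 1) {N : ℕ}
    {t : ℝ} (ht : t ∈ Set.Icc 0 b) {x z : L6R}
    (hx : x = reSobolev (smoothing (2 / 3) (diffField N s w₀ F Fo t)))
    (hz : z = reSobolev (smoothing (s - 1 / 3) (highProj N (mildField s w₀ Fo t)))) :
    F t = μ • mul3 (x + z) (x + z) (x + z) + ∑ j, (r t j - ro t j) • a j + Fo t := by
  have h1 : x + z = reSobolev (smoothing (s - 1 / 3) (mildField s w₀ F t)) := by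
    rw [hx, hz, smoothing_diffField_eq hs hs1 w₀ h.continuous_force ho.continuous_force, ← map_add,
      sub_add_cancel]
  rw [h.force_eq t ht, ho.force_eq t ht, force, force, ← h1, zero_smul, zero_add]
  simp only [sub_smul, Finset.sum_sub_distrib]
  abel

/-- The growth of the energy of the difference of the nonlinear and the linear solution. -/
theorem nonlinear_energy_bound (h : IsMildSolution μ s a σ ω w₀ r₀ b F r)
    (ho : IsMildSolution 0 s a σ ω w₀ r₀ b Fo ro) (hμ : 0 ≤ μ) (hs : 1 / 3 ≤ s) (hs1 : s ≤ 1)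
    (hγ : 0 ≤ γ) (hγs : γ ≤ 1 - s) (hc : ∀ j, ofRealL (a j) = smoothing γ (c j)) {N : ℕ}
    (hN : 1 ≤ N) {Y R : ℝ} (hY : ∀ t ∈ Set.Icc 0 b, ‖duhamel 0 (fun t => ofRealL (Fo t)) t‖ ≤ Y)
    (hR : ∀ t ∈ Set.Icc 0 b, ∀ j, |ro t j| ≤ R) {e η M : ℝ}
    (he : diffEnergy μ (lowPower N (1 - s) w₀) (0 : EuclideanSpace ℝ (Fin K)) ≤ e)
    (hη : energyRate μ s γ a c N ‖w₀‖ Y R M < η) (hη0 : 0 ≤ η) (hM : e + η * b ≤ M) :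
    ∀ t ∈ Set.Icc 0 b, diffEnergy μ (diffField N s w₀ F Fo t) (r t - ro t) ≤ M := by
  intro t₁ ht₁
  have hb : 0 ≤ b := ht₁.1.trans ht₁.2
  have hs0 : 0 ≤ s := by linarith
  have hs' : 0 ≤ 1 - s := by linarith
  have hF := h.continuous_force
  have hFo := ho.continuous_force
  obtain ⟨V, hV⟩ : ∃ V : ℝ → L2C, V = diffField N s w₀ F Fo := ⟨_, rfl⟩
  have hcd : Continuous fun t => F t - highR N (Fo t) := hF.sub ((continuous_highR N).comp hFo)
  have hVc : Continuous V := hV ▸ continuous_duhamel (continuous_ofRealL_comp hcd)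
  have hVn : ∀ t, HasDerivAt (fun t => ‖V t‖ ^ 2)
      (2 * -inner ℝ (imL (V t)) (F t - highR N (Fo t))) t := fun t => by
    have h1 := hasDerivAt_norm_duhamel_sq (V₀ := lowPower N (1 - s) w₀)
      (continuous_ofRealL_comp hcd) t
    rwa [re_inner_neg_I_smul_ofRealL, ← diffField, ← hV] at h1
  have hVd : ∀ t, HasDerivAt (fun t => reL (smoothing 1 (V t))) (imL (V t)) t := fun t => by
    rw [hV]
    exact hasDerivAt_reL_smoothing_duhamel (continuous_ofRealL_comp hcd) (fun _ => rfl) t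
  have hVq := fun t => hasDerivAt_quartic hVc.continuousAt (hVd t)
  obtain ⟨D, hD⟩ : ∃ D : ℝ → L2C, D = duhamel 0 (fun t => ofRealL (F t - Fo t)) := ⟨_, rfl⟩
  have hDd : ∀ j t, HasDerivAt (fun t => inner ℝ (a j) (reL (smoothing 1 (D t))))
      (inner ℝ (a j) (imL (D t))) t := fun j t => by
    rw [hD]; exact hasDerivAt_inner_reL_smoothing_duhamel (a j) (hF.sub hFo) t
  have hr' : Continuous fun t => r (clamp b t) := h.continuous_reservoir.clamp hb
  have hro' : Continuous fun t => ro (clamp b t) := ho.continuous_reservoir.clamp hb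
  have hrc : ∀ j, Continuous fun t => r (clamp b t) j - ro (clamp b t) j := fun j =>
    (continuous_coord hr' j).sub (continuous_coord hro' j)
  set Q : Fin K → ℝ → ℝ := fun j t =>
    -(∫ t' in (0 : ℝ)..t, (r (clamp b t') j - ro (clamp b t') j)) +
      2 * Real.pi * inner ℝ (a j) (reL (smoothing 1 (D t))) with hQ
  have hQd : ∀ j t, HasDerivAt (Q j) (-(r (clamp b t) j - ro (clamp b t) j) +
      2 * Real.pi * inner ℝ (a j) (imL (D t))) t := fun j t => by
    have h1 := ((hrc j).integral_hasStrictDerivAt 0 t).hasDerivAt.fun_neg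
    exact h1.add ((hDd j t).const_mul _)
  have hQr : ∀ t ∈ Set.Icc 0 b, ∀ j, r t j - ro t j = Q j t := fun t ht j => by
    rw [diff_reservoir_eq h ho hs0 hs1 hb ht j]
    simp only [hQ, hD]
  set E : ℝ → ℝ := fun t => Real.pi * ‖V t‖ ^ 2 + ∑ j, Q j t ^ 2 / 2 +
    μ * Real.pi / 2 * quartic (V t) with hE
  have hEe : ∀ t ∈ Set.Icc 0 b, diffEnergy μ (V t) (r t - ro t) = E t := fun t ht => by
    have h2 : ∑ j, Q j t ^ 2 / 2 = ‖r t - ro t‖ ^ 2 / 2 := by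
      rw [EuclideanSpace.norm_sq_eq, Finset.sum_div]
      refine Finset.sum_congr rfl fun j _ => ?_
      rw [← hQr t ht j]; simp
    simp only [diffEnergy, hE, h2]
  set E' : ℝ → ℝ := fun t => Real.pi * (2 * -inner ℝ (imL (V t)) (F t - highR N (Fo t))) +
    ∑ j, Q j t * (-(r (clamp b t) j - ro (clamp b t) j) +
      2 * Real.pi * inner ℝ (a j) (imL (D t))) +
    μ * Real.pi / 2 * (4 * inner ℝ (imL (V t)) (mul3 (reSobolev (smoothing (2 / 3) (V t)))
      (reSobolev (smoothing (2 / 3) (V t))) (reSobolev (smoothing (2 / 3) (V t))))) with hE'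
  have hEd : ∀ t, HasDerivAt E (E' t) t := fun t => by
    refine (((hVn t).const_mul _).add (HasDerivAt.fun_sum fun j _ => ?_)).add
      ((hVq t).const_mul _)
    refine (((hQd j t).fun_pow 2).div_const 2).congr_deriv ?_
    simp only [Nat.cast_ofNat]; ring
  -- The rate estimate presupposes the energy bound `M`. It is needed only where `E` meets the
  -- barrier, and the barrier stays below `M` on `[0, b]`, so the argument is not circular.
  have hfence : ∀ t ∈ Set.Icc 0 b, E t ≤ e + η * t := by
    intro t ht
    refine image_le_of_deriv_right_lt_deriv_boundary' (f := E) (f' := E')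
      (B := fun t => e + η * t) (B' := fun _ => η)
      (continuous_iff_continuousAt.2 fun t => (hEd t).continuousAt).continuousOn
      (fun t _ => (hEd t).hasDerivWithinAt) ?_ (by fun_prop) (fun t _ => ?_) ?_ ht
    · have h0 : (0 : ℝ) ∈ Set.Icc 0 b := ⟨le_rfl, hb⟩
      rw [← hEe 0 h0, h.init_reservoir, ho.init_reservoir, sub_self, mul_zero, add_zero, hV,
        diffField, duhamel_zero]
      exact he
    · have h1 := (((hasDerivAt_id t).const_mul η).const_add e)
      refine (h1.congr_deriv ?_).hasDerivWithinAt
      simp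
    · intro t ht hte
      have ht' : t ∈ Set.Icc 0 b := ⟨ht.1, ht.2.le⟩
      refine lt_of_le_of_lt ?_ hη
      have hEM : E t ≤ M := by
        have : η * t ≤ η * b := by gcongr; exact ht.2.le
        linarith
      have hM0 : 0 ≤ M := by
        refine le_trans ?_ hEM
        have := quartic_nonneg (V t)
        have := Real.pi_pos
        have : 0 ≤ ∑ j, Q j t ^ 2 / 2 := Finset.sum_nonneg fun j _ => by positivity
        simp only [hE]; positivity
      obtain ⟨hb1, hb2, hb3⟩ := diffEnergy_bounds hμ ((hEe t ht').trans_le hEM)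
      obtain ⟨x, hx⟩ : ∃ x, x = reSobolev (smoothing (2 / 3) (V t)) := ⟨_, rfl⟩
      obtain ⟨z, hz⟩ : ∃ z, z = reSobolev (smoothing (s - 1 / 3)
        (highProj N (mildField s w₀ Fo t))) := ⟨_, rfl⟩
      obtain ⟨z₂, hz₂⟩ : ∃ z₂, z₂ = reL (smoothing s (highProj N (mildField s w₀ Fo t))) :=
        ⟨_, rfl⟩
      have hFd := force_sub_eq h ho hs hs1 (N := N) (x := x) ht' (by rw [hx, hV]) hz
      have hDV : D t = V t - lowPower N (1 - s) (waveGroup t w₀) -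
          lowPower N 0 (duhamel 0 (fun t => ofRealL (Fo t)) t) := by
        rw [hD, hV]; exact duhamel_sub_eq w₀ hF hFo t
      -- Two exact cancellations: the derivative of the quartic term removes `ψ³` from the force,
      -- and the coupling of `q` with `V` drops out. The surviving reservoir terms come from the
      -- difference between `D` and `V`.
      have hE1 : E' t = -(2 * Real.pi) * inner ℝ (imL (V t))
            (μ • (mul3 (x + z) (x + z) (x + z) - mul3 x x x) + (Fo t - highR N (Fo t))) +
          ∑ j, (-Q j t ^ 2 - 2 * Real.pi * (Q j t *
            (inner ℝ (a j) (imL (lowPower N (1 - s) (waveGroup t w₀))) +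
              inner ℝ (a j) (imL (lowPower N 0 (duhamel 0 (fun t => ofRealL (Fo t)) t)))))) := by
        have h1 : F t - highR N (Fo t) = (μ • (mul3 (x + z) (x + z) (x + z) - mul3 x x x) +
            (Fo t - highR N (Fo t))) + μ • mul3 x x x + ∑ j, Q j t • a j := by
          have h2 : ∑ j, Q j t • a j = ∑ j, (r t j - ro t j) • a j :=
            Finset.sum_congr rfl fun j _ => by rw [hQr t ht' j]
          rw [h2, smul_sub]
          conv_lhs => rw [hFd]
          abel
        have h3 : ∑ j, Q j t * (-(r t j - ro t j) + 2 * Real.pi * inner ℝ (a j) (imL (D t))) =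
            2 * Real.pi * ∑ j, Q j t * inner ℝ (imL (V t)) (a j) +
            ∑ j, (-Q j t ^ 2 - 2 * Real.pi * (Q j t *
            (inner ℝ (a j) (imL (lowPower N (1 - s) (waveGroup t w₀))) +
              inner ℝ (a j) (imL (lowPower N 0 (duhamel 0 (fun t => ofRealL (Fo t)) t)))))) := by
          rw [Finset.mul_sum, ← Finset.sum_add_distrib]
          refine Finset.sum_congr rfl fun j _ => ?_
          rw [hQr t ht' j, hDV, map_sub, map_sub, inner_sub_right, inner_sub_right,
            real_inner_comm (a j) (imL (V t))]
          ring
        simp only [hE', clamp_of_mem ht']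
        rw [h3, h1, inner_add_right, inner_add_right, inner_sum, inner_smul_right, ← hx]
        simp only [inner_smul_right]
        ring
      have hA := norm_highProj_mildField_le hN hs1 (w₀ := w₀) hFo (hY t ht')
      have hY0 : 0 ≤ Y := (norm_nonneg _).trans (hY t ht')
      have hzz : z =ᵐ[haarT] z₂ := by
        have h1 := coeFn_reSobolev_smoothing (σ := s - 1 / 3) (by linarith)
          (highProj N (mildField s w₀ Fo t))
        rwa [add_sub_cancel, ← hz, ← hz₂] at h1
      have hz1 : ‖z‖ ≤ sobolevConst * (‖w₀‖ + (N : ℝ) ^ (-(1 - s)) * Y) := by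
        rw [hz]
        refine (norm_reSobolev_le _).trans ?_
        have := sobolevConst_nonneg
        gcongr
        exact (norm_smoothing_le (by linarith) _).trans hA
      have hz2 : ‖z₂‖ ≤ (N : ℝ) ^ (-s) * (‖w₀‖ + (N : ℝ) ^ (-(1 - s)) * Y) := by
        rw [hz₂, ← highProj_highProj]
        refine (norm_reL_le _).trans ((norm_smoothing_highProj_le hN hs0 _).trans ?_)
        gcongr
      have hcube := norm_mul_cube_sub_le hμ hb1 hb3 hM0 hx hzz
      have hFon : ‖Fo t - highR N (Fo t)‖ ≤ 2 * (R * ∑ j, ‖a j‖) := by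
        have h1 : ‖Fo t‖ ≤ R * ∑ j, ‖a j‖ := by
          rw [ho.force_eq t ht', force, zero_smul, zero_add, Finset.mul_sum]
          refine norm_sum_le_of_le _ fun j _ => ?_
          rw [norm_smul, Real.norm_eq_abs]
          gcongr
          exact hR t ht' j
        have h2 := norm_highR_le N (Fo t)
        have h3 := norm_sub_le (Fo t) (highR N (Fo t))
        linarith
      have hL1 : ∀ j, |inner ℝ (a j) (imL (lowPower N (1 - s) (waveGroup t w₀)))| ≤
          bracket N ^ (1 - s - γ) * ‖w₀‖ * ‖c j‖ := fun j => by
        have h2 := abs_inner_imL_lowPower_le (N := N) hγ hγs (hc j) (waveGroup t w₀)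
        rwa [norm_waveGroup] at h2
      have hL2 : ∀ j, |inner ℝ (a j)
          (imL (lowPower N 0 (duhamel 0 (fun t => ofRealL (Fo t)) t)))| ≤ ‖a j‖ * Y := fun j => by
        refine (abs_real_inner_le_norm _ _).trans ?_
        gcongr
        refine (norm_imL_le _).trans ((norm_lowPower_le N le_rfl _).trans ?_)
        rw [Real.rpow_zero, one_mul]
        exact hY t ht'
      have hQM : ∀ j, |Q j t| ≤ 2 * Real.sqrt M := fun j => by
        rw [← hQr t ht' j]
        exact hb2 j
      exact hE1.trans_le
        (le_energyRate hμ hb1 hb3 hM0 hx hzz hz1 hz2 hFon hQM hL1 hL2)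
  have h1 := hfence t₁ ht₁
  rw [← hEe t₁ ht₁, hV] at h1
  have h2 : η * t₁ ≤ η * b := by gcongr; exact ht₁.2
  linarith

end Bound

theorem bracket_sq_rpow_le {N : ℕ} {ρ : ℝ} (h0 : 0 ≤ ρ) (h1 : ρ ≤ 1) :
    (bracket N ^ ρ) ^ 2 ≤ 1 + (N : ℝ) ^ (2 * ρ) := by
  rw [← Real.rpow_natCast, ← Real.rpow_mul (bracket_pos _).le, mul_comm ρ, Real.rpow_mul
    (bracket_pos _).le]
  simp only [Nat.cast_ofNat, Real.rpow_two]
  rw [bracket_sq, Real.rpow_mul (by positivity), Real.rpow_two]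
  have h2 := Real.rpow_add_le_add_rpow zero_le_one (sq_nonneg (N : ℝ)) h0 h1
  simpa using h2

/-- The low-mode cut-off costs `⟨N⟩^{1-s}` in the quadratic part. The quartic part is bounded
independently of `N` through the embedding `H^{1/3} ⊂ L⁶`. -/
theorem diffEnergy_lowPower_le {K : ℕ} {μ s : ℝ} (hμ : 0 ≤ μ) (hs : 1 / 3 ≤ s) (hs1 : s ≤ 1)
    (N : ℕ) (w₀ : L2C) :
    diffEnergy μ (lowPower N (1 - s) w₀) (0 : EuclideanSpace ℝ (Fin K)) ≤
      Real.pi * ((1 + (N : ℝ) ^ (2 * (1 - s))) * ‖w₀‖ ^ 2) +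
        μ * Real.pi / 2 * (sobolevConst ^ 3 * ‖w₀‖ ^ 4) := by
  have hpi := Real.pi_pos
  have hlow : ‖lowPower N 0 w₀‖ ≤ ‖w₀‖ := by
    have := norm_lowPower_le N le_rfl w₀
    rwa [Real.rpow_zero, one_mul] at this
  have h1 : ‖lowPower N (1 - s) w₀‖ ^ 2 ≤ (1 + (N : ℝ) ^ (2 * (1 - s))) * ‖w₀‖ ^ 2 := by
    refine (pow_le_pow_left₀ (norm_nonneg _) (norm_lowPower_le N (by linarith) w₀) 2).trans ?_
    rw [mul_pow]
    gcongr
    exact bracket_sq_rpow_le (by linarith) (by linarith)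
  have h23 : smoothing (2 / 3) (lowPower N (1 - s) w₀) =
      smoothing (s - 1 / 3) (lowPower N 0 w₀) := by
    have h1 : (0 : ℝ) ≤ 1 / 3 := by norm_num
    apply smoothing_injective h1
    rw [smoothing_add h1 (by norm_num), smoothing_add h1 (by linarith), add_sub_cancel,
      ← smoothing_one_lowPower N (by linarith)]
    norm_num
  have h2 : quartic (lowPower N (1 - s) w₀) ≤ sobolevConst ^ 3 * ‖w₀‖ ^ 4 := by
    rw [quartic_eq_inner]
    refine (real_inner_le_norm _ _).trans ?_
    have h3 : ‖reL (smoothing 1 (lowPower N (1 - s) w₀))‖ ≤ ‖w₀‖ := by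
      rw [smoothing_one_lowPower N (by linarith)]
      exact ((norm_reL_le _).trans (norm_smoothing_le (by linarith) _)).trans hlow
    have h4 : ‖reSobolev (smoothing (2 / 3) (lowPower N (1 - s) w₀))‖ ≤ sobolevConst * ‖w₀‖ := by
      have := sobolevConst_nonneg
      rw [h23]
      refine (norm_reSobolev_le _).trans ?_
      gcongr
      exact (norm_smoothing_le (by linarith) _).trans hlow
    have h6 := sobolevConst_nonneg
    have h5 := norm_mul3_le (reSobolev (smoothing (2 / 3) (lowPower N (1 - s) w₀)))
      (reSobolev (smoothing (2 / 3) (lowPower N (1 - s) w₀)))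
      (reSobolev (smoothing (2 / 3) (lowPower N (1 - s) w₀)))
    calc _ ≤ ‖w₀‖ * (sobolevConst * ‖w₀‖ * (sobolevConst * ‖w₀‖) * (sobolevConst * ‖w₀‖)) := by
          refine mul_le_mul h3 (h5.trans ?_) (norm_nonneg _) (norm_nonneg _)
          gcongr
      _ = _ := by ring
  rw [diffEnergy, norm_zero]
  have : 0 ≤ μ * Real.pi / 2 := by positivity
  have h6 := mul_le_mul_of_nonneg_left h1 hpi.le
  have h7 := mul_le_mul_of_nonneg_left h2 this
  nlinarith

/-! Existence of mild solutions under an a priori bound. -/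

/-- The radial retraction to the ball of radius `M`. -/
def retract {E : Type*} [NormedAddCommGroup E] [NormedSpace ℝ E] (M : ℝ) (x : E) : E :=
  (M / max M ‖x‖) • x

section Retract

variable {E : Type*} [NormedAddCommGroup E] [NormedSpace ℝ E] {M : ℝ}

theorem retract_of_norm_le (hM : 0 < M) {x : E} (hx : ‖x‖ ≤ M) : retract M x = x := by
  rw [retract, max_eq_left hx, div_self hM.ne', one_smul]

theorem norm_retract_le (hM : 0 < M) (x : E) : ‖retract M x‖ ≤ M := by
  have h1 : 0 < max M ‖x‖ := lt_max_of_lt_left hM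
  rw [retract, norm_smul, Real.norm_of_nonneg (by positivity), div_mul_eq_mul_div, div_le_iff₀ h1]
  gcongr
  exact le_max_right _ _

theorem norm_retract_sub_le (hM : 0 < M) (x y : E) :
    ‖retract M x - retract M y‖ ≤ 2 * ‖x - y‖ := by
  have hx : 0 < max M ‖x‖ := lt_max_of_lt_left hM
  have hy : 0 < max M ‖y‖ := lt_max_of_lt_left hM
  have h1 : retract M x - retract M y =
      (M / max M ‖x‖) • (x - y) + (M / max M ‖x‖ - M / max M ‖y‖) • y := by
    rw [retract, retract, smul_sub, sub_smul]; abel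
  have h2 : M / max M ‖x‖ ≤ 1 := (div_le_one hx).2 (le_max_left _ _)
  have h3 : M / max M ‖x‖ - M / max M ‖y‖ =
      (M / max M ‖x‖) * ((max M ‖y‖ - max M ‖x‖) / max M ‖y‖) := by
    field_simp
  have h4 : |max M ‖y‖ - max M ‖x‖| ≤ ‖x - y‖ := by
    refine (abs_max_sub_max_le_max _ _ _ _).trans ?_
    rw [sub_self, abs_zero, max_eq_right (abs_nonneg _), norm_sub_rev]
    exact abs_norm_sub_norm_le y x
  have h5 : ‖y‖ / max M ‖y‖ ≤ 1 := (div_le_one hy).2 (le_max_right _ _)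
  rw [h1, two_mul]
  refine (norm_add_le _ _).trans (add_le_add ?_ ?_)
  · rw [norm_smul, Real.norm_of_nonneg (by positivity)]
    exact mul_le_of_le_one_left (norm_nonneg _) h2
  · rw [norm_smul, h3, norm_mul, Real.norm_of_nonneg (by positivity), norm_div, Real.norm_eq_abs,
      Real.norm_of_nonneg hy.le]
    calc _ = (M / max M ‖x‖) * (|max M ‖y‖ - max M ‖x‖| * (‖y‖ / max M ‖y‖)) := by ring
      _ ≤ 1 * (‖x - y‖ * 1) := by gcongr
      _ = _ := by ring

theorem continuous_retract (hM : 0 < M) : Continuous (retract M : E → E) := by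
  refine (LipschitzWith.of_dist_le_mul (K := 2) fun x y => ?_).continuous
  rw [dist_eq_norm, dist_eq_norm]
  exact norm_retract_sub_le hM x y

end Retract

/-- The coupling `w ↦ (⟨αⱼ, Re B^{-s} w⟩)ⱼ` of the field with the reservoirs. -/
def coupling {K : ℕ} (s : ℝ) (a : Fin K → L2R) : L2C →L[ℝ] EuclideanSpace ℝ (Fin K) :=
  ((EuclideanSpace.equiv (Fin K) ℝ).symm : (Fin K → ℝ) →L[ℝ] EuclideanSpace ℝ (Fin K)).comp
    (ContinuousLinearMap.pi fun j => (2 * Real.pi) • (innerSL ℝ (a j)).comp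
      (reL.comp ((smoothing s).restrictScalars ℝ)))

theorem coupling_apply {K : ℕ} (s : ℝ) (a : Fin K → L2R) (w : L2C) (j : Fin K) :
    coupling s a w j = 2 * Real.pi * inner ℝ (a j) (reL (smoothing s w)) := rfl

/-- A Lipschitz constant of the force on a ball. -/
def forceLip {K : ℕ} (μ : ℝ) (a : Fin K → L2R) (M : ℝ) : ℝ :=
  |μ| * (3 * (sobolevConst * M) ^ 2 * sobolevConst) + ∑ j, ‖a j‖

theorem forceLip_nonneg {K : ℕ} (μ : ℝ) (a : Fin K → L2R) (M : ℝ) : 0 ≤ forceLip μ a M := by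
  have := sobolevConst_nonneg
  unfold forceLip; positivity

theorem norm_force_sub_le {K : ℕ} {μ s : ℝ} (hs : 1 / 3 ≤ s) {a : Fin K → L2R} {M : ℝ}
    {w w' : L2C} (hw : ‖w‖ ≤ M) (hw' : ‖w'‖ ≤ M) (r r' : EuclideanSpace ℝ (Fin K)) :
    ‖force μ s a w r - force μ s a w' r'‖ ≤ forceLip μ a M * (‖w - w'‖ + ‖r - r'‖) := by
  have hκ := sobolevConst_nonneg
  have hx : ∀ w : L2C, ‖reSobolev (smoothing (s - 1 / 3) w)‖ ≤ sobolevConst * ‖w‖ := fun w =>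
    (norm_reSobolev_le _).trans (by
      gcongr; exact norm_smoothing_le (by linarith) w)
  have h1 := norm_cube_sub_cube_le (M := sobolevConst * M) ((hx w).trans (by gcongr))
    ((hx w').trans (by gcongr))
  have h2 : ‖reSobolev (smoothing (s - 1 / 3) w) - reSobolev (smoothing (s - 1 / 3) w')‖ ≤
      sobolevConst * ‖w - w'‖ := by
    rw [← map_sub, ← map_sub]; exact hx _
  have h3 : ‖∑ j, (r j - r' j) • a j‖ ≤ (∑ j, ‖a j‖) * ‖r - r'‖ := by
    rw [Finset.sum_mul]
    refine norm_sum_le_of_le _ fun j _ => ?_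
    rw [norm_smul, mul_comm]
    gcongr
    exact PiLp.norm_apply_le (r - r') j
  have h4 : force μ s a w r - force μ s a w' r' =
      μ • (mul3 (reSobolev (smoothing (s - 1 / 3) w)) (reSobolev (smoothing (s - 1 / 3) w))
        (reSobolev (smoothing (s - 1 / 3) w)) - mul3 (reSobolev (smoothing (s - 1 / 3) w'))
        (reSobolev (smoothing (s - 1 / 3) w')) (reSobolev (smoothing (s - 1 / 3) w'))) +
      ∑ j, (r j - r' j) • a j := by
    simp only [force, sub_smul, Finset.sum_sub_distrib, smul_sub]; abel
  rw [h4]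
  refine (norm_add_le _ _).trans ?_
  rw [norm_smul, Real.norm_eq_abs]
  have h5 : |μ| * (3 * (sobolevConst * M) ^ 2 * sobolevConst * ‖w - w'‖) +
      (∑ j, ‖a j‖) * ‖r - r'‖ ≤ forceLip μ a M * (‖w - w'‖ + ‖r - r'‖) := by
    have hp : 0 ≤ |μ| * (3 * (sobolevConst * M) ^ 2 * sobolevConst) * ‖r - r'‖ := by positivity
    have hq : 0 ≤ (∑ j, ‖a j‖) * ‖w - w'‖ := by positivity
    unfold forceLip
    linarith
  refine le_trans ?_ h5
  rw [mul_assoc (3 * (sobolevConst * M) ^ 2)]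
  have h6 : 0 ≤ 3 * (sobolevConst * M) ^ 2 := by positivity
  exact add_le_add (mul_le_mul_of_nonneg_left (h1.trans (mul_le_mul_of_nonneg_left h2 h6))
    (abs_nonneg μ)) h3

section Existence

variable {K : ℕ} (μ s : ℝ) (a : Fin K → L2R) (w₀ : L2C) (M : ℝ)
  (n : ℝ → EuclideanSpace ℝ (Fin K))

/-- The reservoirs in terms of the field in the interaction picture and the dissipated part. -/
def reservoir (t : ℝ) (x : L2C × EuclideanSpace ℝ (Fin K)) : EuclideanSpace ℝ (Fin K) :=
  x.2 + coupling s a (waveGroup t x.1 - w₀) + n t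

/-- The force of the truncated system. -/
def truncForce (t : ℝ) (x : L2C × EuclideanSpace ℝ (Fin K)) : L2R :=
  force μ s a (retract M (waveGroup t x.1)) (retract M (reservoir s a w₀ n t x))

/-- The truncated system in the interaction picture. -/
def truncField (t : ℝ) (x : L2C × EuclideanSpace ℝ (Fin K)) : L2C × EuclideanSpace ℝ (Fin K) :=
  (-(Complex.I • waveGroup (-t) (smoothing (1 - s) (ofRealL (truncForce μ s a w₀ M n t x)))),
    -retract M (reservoir s a w₀ n t x))

variable {μ s a w₀ M n}

theorem Continuous.reservoir {X : Type*} [TopologicalSpace X] {t : X → ℝ}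
    {x : X → L2C × EuclideanSpace ℝ (Fin K)} (hn : Continuous n) (ht : Continuous t)
    (hx : Continuous x) : Continuous fun y => _root_.reservoir s a w₀ n (t y) (x y) := by
  have h1 : Continuous fun y => _root_.waveGroup (t y) (x y).1 := ht.waveGroup hx.fst
  exact (hx.snd.add ((coupling s a).continuous.comp (h1.sub continuous_const))).add (hn.comp ht)

theorem Continuous.truncForce {X : Type*} [TopologicalSpace X] {t : X → ℝ}
    {x : X → L2C × EuclideanSpace ℝ (Fin K)} (hM : 0 < M) (hn : Continuous n) (ht : Continuous t)
    (hx : Continuous x) : Continuous fun y => _root_.truncForce μ s a w₀ M n (t y) (x y) := by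
  have h1 : Continuous fun y => retract M (_root_.waveGroup (t y) (x y).1) :=
    (continuous_retract hM).comp (ht.waveGroup hx.fst)
  have h2 : Continuous fun y => retract M (_root_.reservoir s a w₀ n (t y) (x y)) :=
    (continuous_retract hM).comp (hn.reservoir ht hx)
  exact h1.force h2

theorem Continuous.truncField {X : Type*} [TopologicalSpace X] {t : X → ℝ}
    {x : X → L2C × EuclideanSpace ℝ (Fin K)} (hM : 0 < M) (hn : Continuous n) (ht : Continuous t)
    (hx : Continuous x) : Continuous fun y => _root_.truncField μ s a w₀ M n (t y) (x y) := by
  have h1 : Continuous fun y => _root_.truncForce μ s a w₀ M n (t y) (x y) :=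
    Continuous.truncForce hM hn ht hx
  have h2 : Continuous fun y => smoothing (1 - s)
      (ofRealL (_root_.truncForce μ s a w₀ M n (t y) (x y))) :=
    (smoothing (1 - s)).continuous.comp (ofRealL.continuous.comp h1)
  have h3 : Continuous fun y => retract M (_root_.reservoir s a w₀ n (t y) (x y)) :=
    (continuous_retract hM).comp (hn.reservoir ht hx)
  exact ((ht.neg.waveGroup h2).const_smul Complex.I).neg.prodMk h3.neg

theorem norm_reservoir_sub_le (t : ℝ) (x y : L2C × EuclideanSpace ℝ (Fin K)) :
    ‖reservoir s a w₀ n t x - reservoir s a w₀ n t y‖ ≤ (1 + ‖coupling s a‖) * ‖x - y‖ := by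
  have h1 : reservoir s a w₀ n t x - reservoir s a w₀ n t y =
      (x - y).2 + coupling s a (waveGroup t (x - y).1) := by
    simp only [reservoir, Prod.fst_sub, Prod.snd_sub, map_sub]; abel
  rw [h1, add_mul, one_mul]
  refine (norm_add_le _ _).trans (add_le_add (norm_snd_le _) ?_)
  refine ((coupling s a).le_opNorm _).trans ?_
  rw [norm_waveGroup]
  gcongr
  exact norm_fst_le _

theorem norm_truncForce_sub_le (hs : 1 / 3 ≤ s) (hM : 0 < M) (t : ℝ)
    (x y : L2C × EuclideanSpace ℝ (Fin K)) :
    ‖truncForce μ s a w₀ M n t x - truncForce μ s a w₀ M n t y‖ ≤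
      forceLip μ a M * (2 * ‖x - y‖ + 2 * ((1 + ‖coupling s a‖) * ‖x - y‖)) := by
  refine (norm_force_sub_le hs (norm_retract_le hM _) (norm_retract_le hM _) _ _).trans ?_
  refine mul_le_mul_of_nonneg_left (add_le_add ?_ ?_) (forceLip_nonneg μ a M)
  · refine (norm_retract_sub_le hM _ _).trans ?_
    rw [← map_sub, norm_waveGroup]
    gcongr
    exact norm_fst_le (x - y)
  · refine (norm_retract_sub_le hM _ _).trans ?_
    gcongr
    exact norm_reservoir_sub_le t x y

/-- The cubic force is Lipschitz on balls, and retracting its arguments to a ball makes it globally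
so. The wave group is an isometry, hence the constant is uniform in time. -/
theorem exists_lipschitzWith_truncField (hs : 1 / 3 ≤ s) (hs1 : s ≤ 1) (hM : 0 < M) :
    ∃ L : ℝ≥0, ∀ t, LipschitzWith L (truncField μ s a w₀ M n t) := by
  obtain ⟨L, hL⟩ : ∃ L : ℝ, L = forceLip μ a M * (2 + 2 * (1 + ‖coupling s a‖)) +
    2 * (1 + ‖coupling s a‖) := ⟨_, rfl⟩
  have hf := forceLip_nonneg μ a M
  have hL0 : 0 ≤ L := by rw [hL]; positivity
  refine ⟨L.toNNReal, fun t => LipschitzWith.of_dist_le_mul fun x y => ?_⟩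
  rw [dist_eq_norm, dist_eq_norm, Real.coe_toNNReal _ hL0, Prod.norm_def, max_le_iff]
  constructor
  · have h1 : (truncField μ s a w₀ M n t x - truncField μ s a w₀ M n t y).1 =
        -(Complex.I • waveGroup (-t) (smoothing (1 - s)
          (ofRealL (truncForce μ s a w₀ M n t x - truncForce μ s a w₀ M n t y)))) := by
      simp only [truncField, Prod.fst_sub, map_sub, smul_sub]; abel
    rw [h1, norm_neg, norm_smul, Complex.norm_I, one_mul, norm_waveGroup]
    refine (norm_smoothing_le (by linarith) _).trans ?_
    rw [norm_ofRealL]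
    refine (norm_truncForce_sub_le hs hM t x y).trans ?_
    have h2 : 0 ≤ 2 * (1 + ‖coupling s a‖) * ‖x - y‖ := by positivity
    rw [hL]
    linarith
  · have h1 : (truncField μ s a w₀ M n t x - truncField μ s a w₀ M n t y).2 =
        -(retract M (reservoir s a w₀ n t x) - retract M (reservoir s a w₀ n t y)) := by
      simp only [truncField, Prod.snd_sub]; abel
    rw [h1, norm_neg]
    refine (norm_retract_sub_le hM _ _).trans ?_
    have h2 := norm_reservoir_sub_le (s := s) (a := a) (w₀ := w₀) (n := n) t x y
    have h3 : 0 ≤ forceLip μ a M * (2 + 2 * (1 + ‖coupling s a‖)) * ‖x - y‖ := by positivity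
    rw [hL]
    linarith

theorem exists_norm_truncField_le (hs : 1 / 3 ≤ s) (hs1 : s ≤ 1) (hM : 0 < M) :
    ∃ L : ℝ≥0, ∀ t x, ‖truncField μ s a w₀ M n t x‖ ≤ L := by
  have hf := forceLip_nonneg μ a M
  have hL0 : 0 ≤ ‖force μ s a 0 (0 : EuclideanSpace ℝ (Fin K))‖ + forceLip μ a M * (M + M) + M := by
    positivity
  refine ⟨(‖force μ s a 0 (0 : EuclideanSpace ℝ (Fin K))‖ + forceLip μ a M * (M + M) + M).toNNReal, fun t x => ?_⟩
  rw [Real.coe_toNNReal _ hL0, Prod.norm_def, max_le_iff]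
  constructor
  · simp only [truncField]
    rw [norm_neg, norm_smul, Complex.norm_I, one_mul, norm_waveGroup]
    refine (norm_smoothing_le (by linarith) _).trans ?_
    rw [norm_ofRealL]
    have h1 := norm_force_sub_le (μ := μ) hs (a := a) (norm_retract_le hM (waveGroup t x.1))
      (w' := 0) (by rw [norm_zero]; exact hM.le) (retract M (reservoir s a w₀ n t x)) 0
    rw [sub_zero, sub_zero] at h1
    have h2 := norm_le_norm_add_norm_sub' (truncForce μ s a w₀ M n t x) (force μ s a 0 0)
    have h3 : forceLip μ a M * (‖retract M (waveGroup t x.1)‖ +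
        ‖retract M (reservoir s a w₀ n t x)‖) ≤ forceLip μ a M * (M + M) := by
      gcongr
      · exact norm_retract_le hM _
      · exact norm_retract_le hM _
    have h4 : ‖truncForce μ s a w₀ M n t x - force μ s a 0 0‖ ≤ _ := h1
    linarith
  · simp only [truncField]
    rw [norm_neg]
    have := norm_retract_le hM (reservoir s a w₀ n t x)
    have : 0 ≤ forceLip μ a M * (M + M) := by positivity
    have := norm_nonneg (force μ s a 0 (0 : EuclideanSpace ℝ (Fin K)))
    linarith

end Existence

section Existence

variable {K : ℕ} {μ s : ℝ} {a : Fin K → L2R} {w₀ : L2C} {r₀ : EuclideanSpace ℝ (Fin K)} {M b : ℝ}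
  {n : ℝ → EuclideanSpace ℝ (Fin K)} {σ : Fin K → ℝ} {ω : ℝ → Fin K → ℝ}

/-- The truncated vector field is bounded by some `B`, so a ball of radius `B * b` contains every
trajectory up to time `b`. One application of Picard-Lindelöf covers the whole interval. -/
theorem exists_truncField_solution (hs : 1 / 3 ≤ s) (hs1 : s ≤ 1) (hM : 0 < M) (hb : 0 ≤ b)
    (hn : Continuous n) :
    ∃ X : ℝ → L2C × EuclideanSpace ℝ (Fin K), Continuous X ∧ ∀ t ∈ Set.Icc 0 b,
      X t = (w₀, r₀) + ∫ t' in (0 : ℝ)..t, truncField μ s a w₀ M n t' (X t') := by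
  obtain ⟨L, hL⟩ := exists_lipschitzWith_truncField (μ := μ) (a := a) (w₀ := w₀) (n := n) hs hs1 hM
  obtain ⟨B, hB⟩ := exists_norm_truncField_le (μ := μ) (a := a) (w₀ := w₀) (n := n) hs hs1 hM
  have h0 : (0 : ℝ) ∈ Set.Icc 0 b := ⟨le_rfl, hb⟩
  have hpl : IsPicardLindelof (truncField μ s a w₀ M n) (⟨0, h0⟩ : Set.Icc (0 : ℝ) b) (w₀, r₀)
      (B * b.toNNReal) 0 B L := by
    refine ⟨fun t _ => (hL t).lipschitzOnWith, fun x _ => ?_, fun t _ x _ => hB t x, ?_⟩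
    · exact (Continuous.truncField hM hn continuous_id continuous_const).continuousOn
    · simp [hb]
  obtain ⟨x, hx0, hx⟩ := hpl.exists_eq_forall_mem_Icc_hasDerivWithinAt₀
  have hxc : ContinuousOn x (Set.Icc 0 b) := fun t ht => (hx t ht).continuousWithinAt
  obtain ⟨X, hX⟩ : ∃ X, X = fun t => x (clamp b t) := ⟨_, rfl⟩
  have hXc : Continuous X := hX ▸ hxc.clamp hb
  have hXx : ∀ t ∈ Set.Icc 0 b, X t = x t := fun t ht => by simp only [hX, clamp_of_mem ht]
  have hXd : ∀ t ∈ Set.Ioo 0 b, HasDerivAt X (truncField μ s a w₀ M n t (X t)) t := fun t ht => by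
    have ht' : t ∈ Set.Icc 0 b := ⟨ht.1.le, ht.2.le⟩
    have hn := Icc_mem_nhds ht.1 ht.2
    rw [hXx t ht']
    exact ((hx t ht').hasDerivAt hn).congr_of_eventuallyEq
      (eventually_of_mem hn fun t' h => hXx t' h)
  refine ⟨X, hXc, fun t ht => ?_⟩
  rw [intervalIntegral.integral_eq_sub_of_hasDerivAt_of_le ht.1 hXc.continuousOn
    (fun t' h => hXd t' ⟨h.1, h.2.trans_le ht.2⟩)
    ((Continuous.truncField hM hn continuous_id hXc).intervalIntegrable _ _), hXx 0 h0, hx0]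
  abel

theorem isMildSolution_of_norm_le (hM : 0 < M) (hn : Continuous n)
    (hn0 : n 0 = 0) (hnω : ∀ t ∈ Set.Icc 0 b, ∀ j, n t j = σ j * ω t j)
    {X : ℝ → L2C × EuclideanSpace ℝ (Fin K)} (hX : Continuous X)
    (hXeq : ∀ t ∈ Set.Icc 0 b,
      X t = (w₀, r₀) + ∫ t' in (0 : ℝ)..t, truncField μ s a w₀ M n t' (X t'))
    (hb : 0 ≤ b) (hXM : ∀ t ∈ Set.Icc 0 b, ‖(X t).1‖ ≤ M ∧ ‖reservoir s a w₀ n t (X t)‖ ≤ M) :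
    IsMildSolution μ s a σ ω w₀ r₀ b (fun t => truncForce μ s a w₀ M n t (X t))
        (fun t => reservoir s a w₀ n t (X t)) ∧
      ∀ t ∈ Set.Icc 0 b, ‖mildField s w₀ (fun t => truncForce μ s a w₀ M n t (X t)) t‖ =
        ‖(X t).1‖ := by
  have hg : Continuous fun t => truncField μ s a w₀ M n t (X t) :=
    Continuous.truncField hM hn continuous_id hX
  have hF : Continuous fun t => truncForce μ s a w₀ M n t (X t) :=
    Continuous.truncForce hM hn continuous_id hX
  have hr : Continuous fun t => reservoir s a w₀ n t (X t) := hn.reservoir continuous_id hX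
  have hw : ∀ t ∈ Set.Icc 0 b, mildField s w₀ (fun t => truncForce μ s a w₀ M n t (X t)) t =
      waveGroup t (X t).1 := fun t ht => by
    rw [mildField, duhamel]
    congr 1
    have h1 := congrArg (ContinuousLinearMap.fst ℝ L2C (EuclideanSpace ℝ (Fin K))) (hXeq t ht)
    rw [map_add, ← ContinuousLinearMap.intervalIntegral_comp_comm _ (hg.intervalIntegrable _ _)]
      at h1
    exact h1.symm
  have hX0 : X 0 = (w₀, r₀) := by
    have := hXeq 0 ⟨le_rfl, hb⟩
    rwa [intervalIntegral.integral_same, add_zero] at this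
  refine ⟨⟨hF, fun t ht => ?_, hr.continuousOn, ?_, fun t ht j => ?_⟩, fun t ht => ?_⟩
  · have h1 : ‖waveGroup t (X t).1‖ ≤ M := (norm_waveGroup _ _).trans_le (hXM t ht).1
    simp only [hw t ht]
    rw [truncForce, retract_of_norm_le hM h1, retract_of_norm_le hM (hXM t ht).2]
  · simp only [reservoir, hX0, waveGroup_zero, hn0]
    simp
  · have hg2 : Continuous fun t => ContinuousLinearMap.snd ℝ L2C (EuclideanSpace ℝ (Fin K))
        (truncField μ s a w₀ M n t (X t)) := (ContinuousLinearMap.continuous _).comp hg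
    have h1 := congrArg (fun x : L2C × EuclideanSpace ℝ (Fin K) => EuclideanSpace.proj (𝕜 := ℝ) j
      (ContinuousLinearMap.snd ℝ L2C (EuclideanSpace ℝ (Fin K)) x)) (hXeq t ht)
    rw [map_add, map_add, ← ContinuousLinearMap.intervalIntegral_comp_comm _
      (hg.intervalIntegrable _ _), ← ContinuousLinearMap.intervalIntegral_comp_comm _
      (hg2.intervalIntegrable _ _)] at h1
    have h2 : ∫ t' in (0 : ℝ)..t, EuclideanSpace.proj (𝕜 := ℝ) j (ContinuousLinearMap.snd ℝ L2C
        (EuclideanSpace ℝ (Fin K)) (truncField μ s a w₀ M n t' (X t'))) =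
        -∫ t' in (0 : ℝ)..t, reservoir s a w₀ n t' (X t') j := by
      rw [← intervalIntegral.integral_neg]
      refine intervalIntegral.integral_congr fun t' ht' => ?_
      rw [Set.uIcc_of_le ht.1] at ht'
      have h3 := (hXM t' ⟨ht'.1, ht'.2.trans ht.2⟩).2
      simp only [truncField, retract_of_norm_le hM h3]
      rfl
    rw [h2] at h1
    have h4 : (X t).2 j = r₀ j + -∫ t' in (0 : ℝ)..t, reservoir s a w₀ n t' (X t') j := h1
    rw [hw t ht]
    have h5 : reservoir s a w₀ n t (X t) j =
      (X t).2 j + coupling s a (waveGroup t (X t).1 - w₀) j + n t j := rfl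
    rw [h5, h4, coupling_apply, hnω t ht]
    ring
  · rw [hw t ht, norm_waveGroup]

/-- A mild solution exists as long as mild solutions on shorter intervals stay bounded. -/
theorem exists_isMildSolution (hs : 1 / 3 ≤ s) (hs1 : s ≤ 1) (hb : 0 ≤ b)
    (hω : ∀ j, ContinuousOn (fun t => σ j * ω t j) (Set.Icc 0 b)) (hω0 : ∀ j, σ j * ω 0 j = 0)
    (hw₀ : ‖w₀‖ ≤ M) (hr₀ : ‖r₀‖ ≤ M)
    (hap : ∀ b' ∈ Set.Icc 0 b, ∀ F r, IsMildSolution μ s a σ ω w₀ r₀ b' F r →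
      ‖mildField s w₀ F b'‖ ≤ M ∧ ‖r b'‖ ≤ M) :
    ∃ F r, IsMildSolution μ s a σ ω w₀ r₀ b F r := by
  have hM : 0 < M + 1 := by linarith [norm_nonneg w₀]
  obtain ⟨n, hndef⟩ : ∃ n : ℝ → EuclideanSpace ℝ (Fin K),
    n = fun t => WithLp.toLp 2 fun j => σ j * ω (clamp b t) j := ⟨_, rfl⟩
  have hn : Continuous n := by
    rw [hndef]
    refine (PiLp.continuous_toLp 2 _).comp (continuous_pi fun j => ?_)
    exact (hω j).clamp hb
  have h0 : (0 : ℝ) ∈ Set.Icc 0 b := ⟨le_rfl, hb⟩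
  have hnω : ∀ t ∈ Set.Icc 0 b, ∀ j, n t j = σ j * ω t j := fun t ht j => by
    simp only [hndef, clamp_of_mem ht]
  have hn0 : n 0 = 0 := by
    ext j
    rw [hnω 0 h0, hω0]; rfl
  obtain ⟨X, hX, hXeq⟩ := exists_truncField_solution (μ := μ) (a := a) (w₀ := w₀) (r₀ := r₀) hs hs1
    hM hb hn
  obtain ⟨H, hH⟩ : ∃ H : ℝ → ℝ, H = fun t => max ‖(X t).1‖ ‖reservoir s a w₀ n t (X t)‖ := ⟨_, rfl⟩
  have hHc : Continuous H := by
    have hr : Continuous fun t => reservoir s a w₀ n t (X t) := hn.reservoir continuous_id hX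
    rw [hH]
    exact hX.fst.norm.max hr.norm
  have hX0 : X 0 = (w₀, r₀) := by
    have := hXeq 0 h0
    rwa [intervalIntegral.integral_same, add_zero] at this
  have hH0 : H 0 < M + 1 := by
    have h1 : reservoir s a w₀ n 0 (X 0) = r₀ := by
      simp only [reservoir, hX0, waveGroup_zero, hn0]; simp
    rw [hH]
    dsimp only
    rw [h1, hX0]
    exact max_lt (by linarith) (by linarith)
  have hsol : ∀ b' ∈ Set.Icc 0 b, (∀ t ∈ Set.Icc 0 b', H t ≤ M + 1) →
      IsMildSolution μ s a σ ω w₀ r₀ b' (fun t => truncForce μ s a w₀ (M + 1) n t (X t))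
        (fun t => reservoir s a w₀ n t (X t)) ∧
      ∀ t ∈ Set.Icc 0 b', ‖mildField s w₀ (fun t => truncForce μ s a w₀ (M + 1) n t (X t)) t‖ =
        ‖(X t).1‖ := fun b' hb' hbd => by
    refine isMildSolution_of_norm_le hM hn hn0
      (fun t ht => hnω t ⟨ht.1, ht.2.trans hb'.2⟩) hX
      (fun t ht => hXeq t ⟨ht.1, ht.2.trans hb'.2⟩) hb'.1 fun t ht => ?_
    have := hbd t ht
    rw [hH] at this
    exact max_le_iff.1 this
  have hle : ∀ t ∈ Set.Icc 0 b, H t ≤ M + 1 := by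
    by_contra! hcon
    obtain ⟨t₁, ht₁, hlt⟩ := hcon
    -- `τ` is the first time at which the truncation radius `M + 1` is reached. Up to `τ` the
    -- untruncated system is solved, so the a priori bound gives `H τ ≤ M`, a contradiction.
    obtain ⟨τ, ⟨hτ, hτH⟩, hmin⟩ : ∃ τ, IsLeast (Set.Icc 0 b ∩ {t | H t = M + 1}) τ := by
      refine IsCompact.exists_isLeast (isCompact_Icc.inter_right
        (isClosed_eq hHc continuous_const)) ?_
      obtain ⟨t, ht, htH⟩ := intermediate_value_Icc ht₁.1 hHc.continuousOn
        (⟨hH0.le, hlt.le⟩ : M + 1 ∈ Set.Icc (H 0) (H t₁))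
      exact ⟨t, ⟨ht.1, ht.2.trans ht₁.2⟩, htH⟩
    have hbd : ∀ t ∈ Set.Icc 0 τ, H t ≤ M + 1 := fun t ht => by
      by_contra! hgt
      obtain ⟨t', ht', htH⟩ := intermediate_value_Icc ht.1 hHc.continuousOn
        (⟨hH0.le, hgt.le⟩ : M + 1 ∈ Set.Icc (H 0) (H t))
      have h1 := hmin ⟨⟨ht'.1, (ht'.2.trans ht.2).trans hτ.2⟩, htH⟩
      have h2 : t' = t := le_antisymm ht'.2 (ht.2.trans h1)
      rw [← h2, htH] at hgt
      exact lt_irrefl _ hgt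
    obtain ⟨hmild, hnorm⟩ := hsol τ hτ hbd
    obtain ⟨h1, h2⟩ := hap τ hτ _ _ hmild
    rw [hnorm τ ⟨hτ.1, le_rfl⟩] at h1
    have h3 : H τ ≤ M := by
      rw [hH]; exact max_le h1 h2
    have h4 : H τ = M + 1 := hτH
    linarith
  exact ⟨_, _, (hsol b ⟨hb, le_rfl⟩ hle).1⟩

end Existence

/-! A tail bound for the maximum of Brownian motion, by chaining. -/

theorem ProbabilityTheory.HasLaw.hasSubgaussianMGF {Ω : Type*} {mΩ : MeasurableSpace Ω}
    {P : Measure Ω} {X : Ω → ℝ} {v : ℝ≥0} (h : HasLaw X (gaussianReal 0 v) P) :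
    HasSubgaussianMGF X v P := by
  have h1 : HasSubgaussianMGF id v (gaussianReal 0 v) :=
    ⟨fun t => integrable_exp_mul_gaussianReal t, fun t => by
      rw [mgf_gaussianReal (by rw [Measure.map_id])]; simp⟩
  rw [← h.map_eq] at h1
  exact (HasSubgaussianMGF.id_map_iff h.aemeasurable).1 h1

theorem measure_abs_ge_le {Ω : Type*} [MeasurableSpace Ω] {P : Measure Ω}
    [IsProbabilityMeasure P] {X : Ω → ℝ} {v : ℝ≥0} (h : HasLaw X (gaussianReal 0 v) P) {ε : ℝ}
    (hε : 0 ≤ ε) :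
    P {ω | ε ≤ |X ω|} ≤ ENNReal.ofReal (2 * Real.exp (-ε ^ 2 / (2 * v))) := by
  have h0 := h.hasSubgaussianMGF
  have h1 : ∀ {Y : Ω → ℝ}, HasSubgaussianMGF Y v P →
      P {ω | ε ≤ Y ω} ≤ ENNReal.ofReal (Real.exp (-ε ^ 2 / (2 * v))) := fun hY => by
    rw [← ofReal_measureReal]
    exact ENNReal.ofReal_le_ofReal (hY.measure_ge_le hε)
  have h2 : {ω | ε ≤ |X ω|} ⊆ {ω | ε ≤ X ω} ∪ {ω | ε ≤ (-X) ω} := fun ω hω => by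
    rcases le_abs.1 (Set.mem_ofPred.1 hω) with h | h
    · exact Or.inl h
    · exact Or.inr h
  refine (measure_mono h2).trans ((measure_union_le _ _).trans ?_)
  rw [two_mul, ENNReal.ofReal_add (Real.exp_pos _).le (Real.exp_pos _).le]
  exact add_le_add (h1 h0) (h1 h0.neg)

/-- The dyadic points of `[0, t]`. -/
def dyadic (t : ℝ≥0) (n k : ℕ) : ℝ≥0 := k * t / 2 ^ n

theorem dyadic_succ_two_mul (t : ℝ≥0) (n k : ℕ) : dyadic t (n + 1) (2 * k) = dyadic t n k := by
  unfold dyadic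
  rw [pow_succ, Nat.cast_mul, Nat.cast_ofNat]
  field_simp

theorem nndist_dyadic (t : ℝ≥0) (n k : ℕ) :
    ((nndist (dyadic t n (k + 1) : ℝ) (dyadic t n k : ℝ) : ℝ≥0) : ℝ) = t / 2 ^ n := by
  rw [coe_nndist, Real.dist_eq]
  have h : (dyadic t n (k + 1) : ℝ) - dyadic t n k = t / 2 ^ n := by
    unfold dyadic; push_cast; ring
  rw [h, abs_of_nonneg (by positivity)]

/-- A dyadic point of level `n + 1` is a point of level `n` or one step beyond it, so each level
adds at most one increment. -/
theorem abs_dyadic_le {B : ℝ≥0 → ℝ} {t : ℝ≥0} {a : ℕ → ℝ} (ha : ∀ n, 0 ≤ a n) (h0 : B 0 = 0)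
    (h : ∀ n, ∀ k < 2 ^ n, |B (dyadic t n (k + 1)) - B (dyadic t n k)| ≤ a n) (n : ℕ) :
    ∀ k ≤ 2 ^ n, |B (dyadic t n k)| ≤ ∑ m ∈ Finset.range (n + 1), a m := by
  have hz : ∀ n, dyadic t n 0 = 0 := fun n => by simp [dyadic]
  induction n with
  | zero =>
    intro k hk
    rw [zero_add, Finset.sum_range_one]
    rcases Nat.le_one_iff_eq_zero_or_eq_one.1 (by simpa using hk) with rfl | rfl
    · rw [hz, h0, abs_zero]; exact ha 0
    · have h1 := h 0 0 (by norm_num)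
      rwa [hz, h0, sub_zero] at h1
  | succ n ih =>
    intro k hk
    rw [Finset.sum_range_succ]
    rw [pow_succ] at hk
    rcases Nat.even_or_odd' k with ⟨l, rfl | rfl⟩
    · rw [dyadic_succ_two_mul]
      have h1 := ih l (by omega)
      linarith [ha (n + 1)]
    · have h1 := ih l (by omega)
      have h2 := h (n + 1) (2 * l) (by rw [pow_succ]; omega)
      rw [dyadic_succ_two_mul] at h2
      have h3 := abs_sub_abs_le_abs_sub (B (dyadic t (n + 1) (2 * l + 1))) (B (dyadic t n l))
      linarith

theorem abs_le_of_dyadic {B : ℝ≥0 → ℝ} {t : ℝ≥0} (ht : 0 < t) (hB : Continuous B) {A : ℝ}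
    (h : ∀ n, ∀ k ≤ 2 ^ n, |B (dyadic t n k)| ≤ A) {s : ℝ≥0} (hs : s ≤ t) : |B s| ≤ A := by
  have h1 : Tendsto (fun n : ℕ => dyadic t n ⌊(s / t : ℝ) * 2 ^ n⌋₊) atTop (𝓝 s) := by
    have h2 := (tendsto_nat_floor_mul_div_atTop (R := ℝ) (a := (s / t : ℝ)) (by positivity)).comp
      (tendsto_pow_atTop_atTop_of_one_lt (one_lt_two : (1 : ℝ) < 2))
    have h3 := h2.mul_const (t : ℝ)
    rw [div_mul_cancel₀ _ (by exact_mod_cast ht.ne')] at h3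
    rw [← NNReal.tendsto_coe]
    refine h3.congr fun n => ?_
    simp only [Function.comp_apply, dyadic]
    push_cast
    ring
  refine le_of_tendsto ((hB.tendsto s).comp h1).abs (Eventually.of_forall fun n => ?_)
  refine h n _ ?_
  have h2 : (s / t : ℝ) * 2 ^ n ≤ ((2 ^ n : ℕ) : ℝ) := by
    push_cast
    have ht' : (0 : ℝ) < t := by exact_mod_cast ht
    exact mul_le_of_le_one_left (by positivity) ((div_le_one ht').2 (by exact_mod_cast hs))
  exact Nat.floor_le_of_le h2

theorem sum_geometric_quarter_le (n : ℕ) :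
    ∑ m ∈ Finset.range n, (1 / 4 : ℝ) * (3 / 4) ^ m ≤ 1 := by
  rw [← Finset.mul_sum, geom_sum_eq (by norm_num)]
  have : (0 : ℝ) ≤ (3 / 4) ^ n := by positivity
  norm_num
  linarith

/-- By Bernoulli `(9/8)^n ≥ 1 + n/8`. For `x ≥ 16` this leaves a factor `e^{-2n} ≤ 4^{-n}`, which
beats the `2^n` increments of level `n`. -/
theorem tsum_chaining_le {x : ℝ} (hx : 16 ≤ x) :
    ∑' n : ℕ, (2 : ℝ≥0∞) ^ n * ENNReal.ofReal (2 * Real.exp (-(x * (9 / 8) ^ n))) ≤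
      ENNReal.ofReal (4 * Real.exp (-x)) := by
  have h1 : ∀ n : ℕ, (2 : ℝ≥0∞) ^ n * ENNReal.ofReal (2 * Real.exp (-(x * (9 / 8) ^ n))) ≤
      ENNReal.ofReal (2 * Real.exp (-x) * (1 / 2) ^ n) := fun n => by
    have h2 : (2 : ℝ≥0∞) ^ n = ENNReal.ofReal (2 ^ n) := by
      rw [ENNReal.ofReal_pow (by norm_num)]; norm_num
    rw [h2, ← ENNReal.ofReal_mul (by positivity)]
    refine ENNReal.ofReal_le_ofReal ?_
    have h3 : 1 + (n : ℝ) * (1 / 8) ≤ (9 / 8) ^ n := by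
      have := one_add_mul_le_pow (a := (1 / 8 : ℝ)) (by norm_num) n
      norm_num at this ⊢
      linarith
    have h4 : Real.exp (-(x * (9 / 8) ^ n)) ≤ Real.exp (-x) * Real.exp (-2) ^ n := by
      rw [← Real.exp_nat_mul, ← Real.exp_add]
      refine Real.exp_le_exp.2 ?_
      have h5 : x * (1 + (n : ℝ) * (1 / 8)) ≤ x * (9 / 8) ^ n := by gcongr
      have h6 : (16 : ℝ) * n ≤ x * n := by gcongr
      linarith
    have h7 : Real.exp (-2) ≤ 1 / 4 := by
      have h8 : (4 : ℝ) ≤ Real.exp 2 := by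
        have := Real.add_one_le_exp (1 : ℝ)
        have h9 : Real.exp 2 = Real.exp 1 * Real.exp 1 := by rw [← Real.exp_add]; norm_num
        nlinarith
      rw [Real.exp_neg, ← one_div]
      exact one_div_le_one_div_of_le (by norm_num) h8
    calc (2 : ℝ) ^ n * (2 * Real.exp (-(x * (9 / 8) ^ n)))
        ≤ 2 ^ n * (2 * (Real.exp (-x) * (1 / 4) ^ n)) := by
          gcongr
          exact h4.trans (by gcongr)
      _ = 2 * Real.exp (-x) * (2 ^ n * (1 / 4) ^ n) := by ring
      _ = _ := by rw [← mul_pow]; norm_num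
  refine (ENNReal.tsum_le_tsum h1).trans ?_
  rw [← ENNReal.ofReal_tsum_of_nonneg (fun n => by positivity)
    (summable_geometric_two.mul_left _), tsum_mul_left, tsum_geometric_two]
  refine ENNReal.ofReal_le_ofReal (le_of_eq (by ring))

theorem measure_brownian_le {Ω : Type*} [MeasurableSpace Ω] {P : Measure Ω}
    [IsProbabilityMeasure P] {B : ℝ≥0 → Ω → ℝ} (hB : IsBrownianReal B P) {t : ℝ≥0} (ht : 0 < t)
    {l : ℝ} (hl : 0 ≤ l) :
    P {ω | ¬ (Continuous (B · ω) ∧ B 0 ω = 0 ∧ ∀ s ≤ t, |B s ω| ≤ l)} ≤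
      ENNReal.ofReal (4 * Real.exp 16 * Real.exp (-(l ^ 2 / (32 * t)))) := by
  have htp : (0 : ℝ) < t := by exact_mod_cast ht
  obtain ⟨x, hx⟩ : ∃ x, x = l ^ 2 / (32 * (t : ℝ)) := ⟨_, rfl⟩
  rw [← hx]
  rcases lt_or_ge x 16 with hx16 | hx16
  -- For `x < 16` the factor `e^16` makes the claimed bound exceed 1.
  · refine prob_le_one.trans ?_
    rw [← ENNReal.ofReal_one]
    refine ENNReal.ofReal_le_ofReal ?_
    rw [mul_assoc, ← Real.exp_add]
    have := Real.one_le_exp (by linarith : (0 : ℝ) ≤ 16 + -x)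
    linarith
  -- These thresholds sum to at most `l`. Against the increment variance `t / 2^n` they give the
  -- Gaussian exponent `x (9/8)^n`, because `2 (3/4)² = 9/8`.
  set a : ℕ → ℝ := fun n => l * (1 / 4 * (3 / 4) ^ n) with ha
  have ha0 : ∀ n, 0 ≤ a n := fun n => by simp only [ha]; positivity
  set S : Set Ω := ⋃ n : ℕ, ⋃ k ∈ Finset.range (2 ^ n),
    {ω | a n ≤ |(B (dyadic t n (k + 1)) - B (dyadic t n k)) ω|} with hS
  have hsub : {ω | ¬ (Continuous (B · ω) ∧ B 0 ω = 0 ∧ ∀ s ≤ t, |B s ω| ≤ l)} ⊆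
      ({ω | ¬ Continuous (B · ω)} ∪ {ω | ¬ B 0 ω = 0}) ∪ S := by
    intro ω hω
    by_contra hcon
    simp only [Set.mem_union, Set.mem_ofPred_eq, not_or, not_not] at hcon
    obtain ⟨⟨hc, h0⟩, hSn⟩ := hcon
    refine hω ⟨hc, h0, fun s hs => abs_le_of_dyadic ht hc (fun n k hk => ?_) hs⟩
    refine (abs_dyadic_le (B := (B · ω)) ha0 h0 (fun n k hk => ?_) n k hk).trans ?_
    · by_contra! hlt
      refine hSn (Set.mem_iUnion.2 ⟨n, Set.mem_iUnion₂.2 ⟨k, Finset.mem_range.2 hk, hlt.le⟩⟩)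
    · simp only [ha]
      rw [← Finset.mul_sum]
      exact mul_le_of_le_one_right hl (sum_geometric_quarter_le _)
  have hn1 : P {ω | ¬ Continuous (B · ω)} = 0 := ae_iff.1 hB.cont
  have hn2 : P {ω | ¬ B 0 ω = 0} = 0 := ae_iff.1 hB.eval_zero_ae_eq_zero
  have hSP : P S ≤ ENNReal.ofReal (4 * Real.exp (-x)) := by
    refine le_trans ?_ (tsum_chaining_le hx16)
    refine (measure_iUnion_le _).trans (ENNReal.tsum_le_tsum fun n => ?_)
    refine (measure_biUnion_finset_le _ _).trans ?_
    have h1 : ∀ k ∈ Finset.range (2 ^ n),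
        P {ω | a n ≤ |(B (dyadic t n (k + 1)) - B (dyadic t n k)) ω|} ≤
          ENNReal.ofReal (2 * Real.exp (-(x * (9 / 8) ^ n))) := fun k _ => by
      refine (measure_abs_ge_le (hB.hasLaw_sub _ _) (ha0 n)).trans (le_of_eq ?_)
      have h2 := nndist_dyadic t n k
      have h3 : ((nndist (dyadic t n (k + 1)).1 (dyadic t n k).1 : ℝ≥0) : ℝ) = t / 2 ^ n := h2
      rw [h3, hx]
      congr 3
      simp only [ha]
      have h4 : ((9 : ℝ) / 8) ^ n = 2 ^ n * ((3 / 4) ^ n) ^ 2 := by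
        rw [← pow_mul, mul_comm n 2, pow_mul, ← mul_pow]; norm_num
      rw [h4]
      field_simp
      ring
    refine (Finset.sum_le_card_nsmul _ _ _ h1).trans (le_of_eq ?_)
    rw [Finset.card_range, nsmul_eq_mul]
    push_cast
    rfl
  refine (measure_mono hsub).trans ((measure_union_le _ _).trans ?_)
  have h5 : P ({ω | ¬ Continuous (B · ω)} ∪ {ω | ¬ B 0 ω = 0}) = 0 :=
    measure_union_null hn1 hn2
  rw [h5, zero_add]
  refine hSP.trans (ENNReal.ofReal_le_ofReal ?_)
  have := Real.one_le_exp (by norm_num : (0 : ℝ) ≤ 16)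
  have := Real.exp_pos (-x)
  nlinarith

/-! ### Existence and the energy bound along a good path. -/

theorem IsMildSolution.mono {K : ℕ} {μ s : ℝ} {a : Fin K → L2R} {σ : Fin K → ℝ}
    {ω : ℝ → Fin K → ℝ} {w₀ : L2C} {r₀ : EuclideanSpace ℝ (Fin K)} {b b' : ℝ} {F : ℝ → L2R}
    {r : ℝ → EuclideanSpace ℝ (Fin K)} (h : IsMildSolution μ s a σ ω w₀ r₀ b F r) (hb : b' ≤ b) :
    IsMildSolution μ s a σ ω w₀ r₀ b' F r :=
  have hs : Set.Icc 0 b' ⊆ Set.Icc 0 b := Set.Icc_subset_Icc_right hb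
  ⟨h.continuous_force, fun t ht => h.force_eq t (hs ht), h.continuous_reservoir.mono hs,
    h.init_reservoir, fun t ht => h.reservoir_eq t (hs ht)⟩

theorem energy_eq_diffEnergy {K : ℕ} {μ : ℝ} (hμ : 0 ≤ μ) {f : Torus → ℂ} {V : L2C}
    (hf : f =ᵐ[haarT] smoothing 1 V) (q : EuclideanSpace ℝ (Fin K)) :
    energy μ f q = ENNReal.ofReal (diffEnergy μ V q) := by
  have hpi := Real.pi_pos
  have h4 : ∫⁻ x : Torus, ‖(f x).re‖ₑ ^ 4 = ENNReal.ofReal (2 * Real.pi * quartic V) := by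
    have h1 : (volume : Measure Torus) = ENNReal.ofReal (2 * Real.pi) • haarT :=
      AddCircle.volume_eq_smul_haarAddCircle
    have h2 : ∫⁻ x, ‖(f x).re‖ₑ ^ 4 ∂haarT = ∫⁻ x, ENNReal.ofReal (reL (smoothing 1 V) x ^ 4) ∂haarT := by
      refine lintegral_congr_ae ?_
      filter_upwards [hf, coeFn_reL (smoothing 1 V)] with x h1 h2
      rw [h1, h2, ← ofReal_norm, ← ENNReal.ofReal_pow (norm_nonneg _), Real.norm_eq_abs,
        Even.pow_abs (by decide)]
    rw [h1, lintegral_smul_measure, h2, ← ofReal_integral_eq_lintegral_ofReal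
      (integrable_quartic V) (Eventually.of_forall fun x => by positivity), smul_eq_mul,
      ← ENNReal.ofReal_mul (by positivity)]
    rfl
  have hq := quartic_nonneg V
  have h2 : (2⁻¹ : ℝ≥0∞) = ENNReal.ofReal 2⁻¹ := by
    rw [ENNReal.ofReal_inv_of_pos (by norm_num)]; norm_num
  rw [energy, h4, sobolevNormSq_of_ae zero_le_one hf, ← ofReal_norm,
    ← ENNReal.ofReal_pow (norm_nonneg _), h2, ← ENNReal.ofReal_mul (by norm_num),
    ← ENNReal.ofReal_mul (by norm_num), ← ENNReal.ofReal_mul (by positivity),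
    ← ENNReal.ofReal_add (by positivity) (by positivity),
    ← ENNReal.ofReal_add (by positivity) (by positivity), diffEnergy]
  congr 1
  ring

theorem norm_le_sum_abs {K : ℕ} (r : EuclideanSpace ℝ (Fin K)) : ‖r‖ ≤ ∑ j, |r j| := by
  have h : r = ∑ j, r j • EuclideanSpace.single j (1 : ℝ) := by
    ext i
    simp [Finset.sum_apply, Pi.single_apply]
  conv_lhs => rw [h]
  refine norm_sum_le_of_le _ fun j _ => ?_
  rw [norm_smul, EuclideanSpace.norm_single, norm_one, mul_one, Real.norm_eq_abs]

section GoodPath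

variable {K : ℕ} {μ s γ : ℝ} {α : Fin K → Torus → ℝ} {T : Fin K → ℝ} {a : Fin K → L2R}
  {c : Fin K → L2C} {ω : ℝ → Fin K → ℝ} {u₀ : Torus → ℂ} {w₀ : L2C}
  {r₀ : EuclideanSpace ℝ (Fin K)} {b : ℝ}

theorem modifiedEnergy_eq (hμ : 0 ≤ μ) (hs : 0 ≤ s) (hs1 : s ≤ 1) {F Fo : ℝ → L2R}
    (hF : Continuous F) (hFo : Continuous Fo) {u uo : ℝ → Torus → ℂ} {t : ℝ}
    (hu : u t =ᵐ[haarT] smoothing s (mildField s w₀ F t))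
    (huo : uo t =ᵐ[haarT] smoothing s (mildField s w₀ Fo t)) (N : ℕ)
    (r ro : ℝ → EuclideanSpace ℝ (Fin K)) :
    modifiedEnergy μ N u r uo ro t =
      ENNReal.ofReal (diffEnergy μ (diffField N s w₀ F Fo t) (r t - ro t)) := by
  refine energy_eq_diffEnergy hμ ?_ _
  rw [smoothing_one_diffField hs hs1 w₀ hF hFo]
  exact (hu.sub (highModes_ae huo N)).trans (Lp.coeFn_sub _ _).symm

theorem exists_isMildSolution_linear {σ : Fin K → ℝ} (hs : 1 / 3 ≤ s) (hs1 : s ≤ 1) (hb : 0 ≤ b)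
    (hω : ∀ j, ContinuousOn (fun t => ω t j) (Set.Icc 0 b)) (hω0 : ∀ j, ω 0 j = 0)
    {β G : ℝ} (hβ : 0 < β) (hG : 0 < G) (hr₀ : ‖r₀‖ ≤ β)
    (hg : ∀ t ∈ Set.Icc 0 b, ∀ j, |2 * Real.pi * inner ℝ (a j)
      (reL (smoothing s (waveGroup t w₀ - w₀))) + σ j * ω t j| ≤ G) :
    ∃ F r, IsMildSolution 0 s a σ ω w₀ r₀ b F r := by
  obtain ⟨Y, hY⟩ : ∃ Y, Y = β + G * couplingConst a * b := ⟨_, rfl⟩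
  have hA : 0 < couplingConst a := zero_lt_one.trans_le (one_le_couplingConst a)
  have hY0 : β ≤ Y := by
    have : 0 ≤ G * couplingConst a * b := by positivity
    linarith
  have hK : 0 ≤ (K : ℝ) * (G + 2 * Y) := by
    have : 0 ≤ G + 2 * Y := by linarith
    positivity
  refine exists_isMildSolution (M := ‖w₀‖ + Y + K * (G + 2 * Y)) hs hs1 hb
    (fun j => continuousOn_const.mul (hω j)) (fun j => by rw [hω0, mul_zero]) (by linarith)
    (by linarith [norm_nonneg w₀]) fun b' hb' F r h => ?_
  obtain ⟨h1, h2⟩ := linear_energy_bound h (by linarith) hs1 hβ hG hr₀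
    (fun t ht => hg t ⟨ht.1, ht.2.trans hb'.2⟩) b' ⟨hb'.1, le_rfl⟩
  have h3 : β + G * couplingConst a * b' ≤ Y := by
    have : G * couplingConst a * b' ≤ G * couplingConst a * b := by
      gcongr; exact hb'.2
    linarith
  constructor
  · rw [mildField_eq hs1 w₀ h.continuous_force]
    refine (norm_add_le _ _).trans ?_
    rw [norm_waveGroup]
    have h4 := norm_smoothing_le (by linarith : 0 ≤ 1 - s)
      (duhamel 0 (fun t => ofRealL (F t)) b')
    linarith
  · have h4 : ∑ j, |r b' j| ≤ ∑ _j : Fin K, (G + 2 * Y) :=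
      Finset.sum_le_sum fun j _ => (h2 j).trans (by linarith)
    rw [Finset.sum_const, Finset.card_univ, Fintype.card_fin, nsmul_eq_mul] at h4
    linarith [norm_le_sum_abs (r b'), norm_nonneg w₀]

/-- The bound on the difference energy is itself the a priori estimate: with the linear bounds it
controls the forced part of the field and the reservoirs on every shorter interval. The crude norm
bound may depend on `N`. -/
theorem exists_isMildSolution_nonlinear {σ : Fin K → ℝ} (hμ : 0 ≤ μ) (hs : 1 / 3 ≤ s)
    (hs1 : s ≤ 1) (hγ : 0 ≤ γ) (hγs : γ ≤ 1 - s) (hc : ∀ j, ofRealL (a j) = smoothing γ (c j))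
    (hb : 0 ≤ b) (hω : ∀ j, ContinuousOn (fun t => ω t j) (Set.Icc 0 b)) (hω0 : ∀ j, ω 0 j = 0)
    {Fo : ℝ → L2R} {ro : ℝ → EuclideanSpace ℝ (Fin K)}
    (ho : IsMildSolution 0 s a σ ω w₀ r₀ b Fo ro) {N : ℕ} (hN : 1 ≤ N) {Y R : ℝ}
    (hY : ∀ t ∈ Set.Icc 0 b, ‖duhamel 0 (fun t => ofRealL (Fo t)) t‖ ≤ Y)
    (hR : ∀ t ∈ Set.Icc 0 b, ∀ j, |ro t j| ≤ R) {e η M : ℝ}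
    (he : diffEnergy μ (lowPower N (1 - s) w₀) (0 : EuclideanSpace ℝ (Fin K)) ≤ e)
    (hη : energyRate μ s γ a c N ‖w₀‖ Y R M < η) (hη0 : 0 ≤ η) (hM : e + η * b ≤ M) :
    ∃ F r, IsMildSolution μ s a σ ω w₀ r₀ b F r := by
  have h0 : (0 : ℝ) ∈ Set.Icc 0 b := ⟨le_rfl, hb⟩
  have hY0 : 0 ≤ Y := (norm_nonneg _).trans (hY 0 h0)
  have hr0 : ‖r₀‖ ≤ K * (R + 2 * Real.sqrt M) := by
    have h1 : ∑ j, |ro 0 j| ≤ ∑ _j : Fin K, (R + 2 * Real.sqrt M) :=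
      Finset.sum_le_sum fun j _ => (hR 0 h0 j).trans (by linarith [Real.sqrt_nonneg M])
    rw [Finset.sum_const, Finset.card_univ, Fintype.card_fin, nsmul_eq_mul] at h1
    rw [← ho.init_reservoir]
    exact (norm_le_sum_abs _).trans h1
  have hK : 0 ≤ (K : ℝ) * (R + 2 * Real.sqrt M) := (norm_nonneg _).trans hr0
  refine exists_isMildSolution (M := ‖w₀‖ + (Real.sqrt M + ‖lowPower N (1 - s) w₀‖ + Y) +
    K * (R + 2 * Real.sqrt M)) hs hs1 hb
    (fun j => continuousOn_const.mul (hω j)) (fun j => by rw [hω0, mul_zero])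
    (by linarith [norm_nonneg (lowPower N (1 - s) w₀), Real.sqrt_nonneg M])
    (by linarith [norm_nonneg w₀, norm_nonneg (lowPower N (1 - s) w₀), Real.sqrt_nonneg M])
    fun b' hb' F r h => ?_
  have hb'' : b' ∈ Set.Icc 0 b' := ⟨hb'.1, le_rfl⟩
  have hE := nonlinear_energy_bound h (ho.mono hb'.2) hμ hs hs1 hγ hγs hc hN
    (fun t ht => hY t ⟨ht.1, ht.2.trans hb'.2⟩) (fun t ht => hR t ⟨ht.1, ht.2.trans hb'.2⟩)
    he hη hη0 (M := M) (by
      have : η * b' ≤ η * b := by gcongr; exact hb'.2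
      linarith) b' hb''
  obtain ⟨h1, h2, -⟩ := diffEnergy_bounds hμ hE
  constructor
  · have h3 := diffField_eq (N := N) (s := s) w₀ h.continuous_force ho.continuous_force b'
    have h4 : duhamel 0 (fun t => ofRealL (F t)) b' = diffField N s w₀ F Fo b' -
        waveGroup b' (lowPower N (1 - s) w₀) +
        highProj N (duhamel 0 (fun t => ofRealL (Fo t)) b') := by
      rw [h3]; abel
    have h5 : ‖duhamel 0 (fun t => ofRealL (F t)) b'‖ ≤
        Real.sqrt M + ‖lowPower N (1 - s) w₀‖ + Y := by
      rw [h4]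
      refine (norm_add_le _ _).trans (add_le_add ((norm_sub_le _ _).trans
        (add_le_add h1 (norm_waveGroup _ _).le)) ?_)
      exact (norm_highProj_le N _).trans (hY b' hb')
    rw [mildField_eq hs1 w₀ h.continuous_force]
    refine (norm_add_le _ _).trans ?_
    rw [norm_waveGroup]
    have h6 := norm_smoothing_le (by linarith : 0 ≤ 1 - s)
      (duhamel 0 (fun t => ofRealL (F t)) b')
    linarith
  · have h4 : ∑ j, |r b' j| ≤ ∑ _j : Fin K, (R + 2 * Real.sqrt M) :=
      Finset.sum_le_sum fun j _ => by
        have h5 := h2 j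
        rw [PiLp.sub_apply] at h5
        have h6 := abs_sub_abs_le_abs_sub (r b' j) (ro b' j)
        linarith [hR b' hb' j]
    rw [Finset.sum_const, Finset.card_univ, Fintype.card_fin, nsmul_eq_mul] at h4
    linarith [norm_le_sum_abs (r b'), norm_nonneg w₀, norm_nonneg (lowPower N (1 - s) w₀),
      Real.sqrt_nonneg M]

/-- The deterministic part of the energy estimate. -/
theorem not_energyBoundFails (hμ : 0 ≤ μ) (hs : 1 / 3 ≤ s) (hs1 : s ≤ 1) (hγ : 0 ≤ γ)
    (hγs : γ ≤ 1 - s) (ha : ∀ j, (fun x => (α j x : ℂ)) =ᵐ[haarT] ofRealL (a j))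
    (hc : ∀ j, ofRealL (a j) = smoothing γ (c j)) (hu₀ : u₀ =ᵐ[haarT] smoothing s w₀)
    (hb : 0 ≤ b) (hω : ∀ j, ContinuousOn (fun t => ω t j) (Set.Icc 0 b)) (hω0 : ∀ j, ω 0 j = 0)
    {β G : ℝ} (hβ : 0 < β) (hG : 0 < G) (hr₀ : ‖r₀‖ ≤ β)
    (hg : ∀ t ∈ Set.Icc 0 b, ∀ j, |2 * Real.pi * inner ℝ (a j)
      (reL (smoothing s (waveGroup t w₀ - w₀))) + Real.sqrt (2 * T j) * ω t j| ≤ G)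
    {N : ℕ} (hN : 1 ≤ N) {Y R : ℝ} (hY : β + G * couplingConst a * b ≤ Y)
    (hR : G + 2 * (β + G * couplingConst a * b) ≤ R)
    {e η M : ℝ}
    (he : diffEnergy μ (lowPower N (1 - s) w₀) (0 : EuclideanSpace ℝ (Fin K)) ≤ e)
    (hη : energyRate μ s γ a c N ‖w₀‖ Y R M < η) (hη0 : 0 ≤ η) (hM : e + η * b ≤ M) :
    ¬ EnergyBoundFails μ s α T ω u₀ r₀ N b (ENNReal.ofReal M) := by
  have hs0 : 0 ≤ s := by linarith
  have hA : 0 < couplingConst a := zero_lt_one.trans_le (one_le_couplingConst a)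
  have hlin : ∀ {Fo : ℝ → L2R} {ro : ℝ → EuclideanSpace ℝ (Fin K)},
      IsMildSolution 0 s a (fun j => Real.sqrt (2 * T j)) ω w₀ r₀ b Fo ro →
      (∀ t ∈ Set.Icc 0 b, ‖duhamel 0 (fun t => ofRealL (Fo t)) t‖ ≤ Y) ∧
      ∀ t ∈ Set.Icc 0 b, ∀ j, |ro t j| ≤ R := fun ho => by
    have h1 := linear_energy_bound ho hs0 hs1 hβ hG hr₀ hg
    have h2 : ∀ t ∈ Set.Icc 0 b, G * couplingConst a * t ≤ G * couplingConst a * b :=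
      fun t ht => by gcongr; exact ht.2
    exact ⟨fun t ht => by linarith [(h1 t ht).1, h2 t ht], fun t ht j => by
      linarith [(h1 t ht).2 j, h2 t ht]⟩
  obtain ⟨Fo, ro, ho⟩ := exists_isMildSolution_linear (a := a) (w₀ := w₀) (r₀ := r₀) hs hs1 hb hω
    hω0 hβ hG hr₀ hg
  obtain ⟨F, r, h⟩ := exists_isMildSolution_nonlinear hμ hs hs1 hγ hγs hc hb hω hω0 ho hN
    (hlin ho).1 (hlin ho).2 he hη hη0 hM
  -- The constructed solutions exclude non-existence. The last alternative concerns arbitrary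
  -- solutions, to which the estimate is applied directly, without a uniqueness theorem for the
  -- nonlinear system.
  rintro (hno | hno | ⟨u, r, uo, ro, hu, huo, hlt⟩)
  · exact hno ⟨_, _, h.isSolutionOn hs hs1 ha hu₀⟩
  · exact hno ⟨_, _, ho.isSolutionOn hs hs1 ha hu₀⟩
  · obtain ⟨F, h, hF⟩ := hu.exists_isMildSolution hs hs1 hb ha hu₀
    obtain ⟨Fo, ho, hFo⟩ := huo.exists_isMildSolution hs hs1 hb ha hu₀
    refine absurd hlt (not_lt.2 (iSup₂_le fun t ht => ?_))
    rw [modifiedEnergy_eq hμ hs0 hs1 h.continuous_force ho.continuous_force (hF t ht) (hFo t ht)]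
    exact ENNReal.ofReal_le_ofReal (nonlinear_energy_bound h ho hμ hs hs1 hγ hγs hc hN
      (hlin ho).1 (hlin ho).2 he hη hη0 hM t ht)

end GoodPath

/-! The energy rate for large `N`. -/

/-- `f(N) = O(N^p)`. -/
def PowerBound (p : ℝ) (f : ℕ → ℝ) : Prop := f =O[atTop] fun N : ℕ => (N : ℝ) ^ p

theorem natCast_eventually_pos : ∀ᶠ N : ℕ in atTop, (0 : ℝ) < N :=
  (eventually_ge_atTop 1).mono fun N hN => by exact_mod_cast hN

theorem powerBound_rpow (p : ℝ) : PowerBound p fun N : ℕ => (N : ℝ) ^ p :=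
  Asymptotics.isBigO_refl _ _

namespace PowerBound

variable {p q : ℝ} {f g : ℕ → ℝ}

theorem mono (hf : PowerBound p f) (h : p ≤ q) : PowerBound q f := by
  refine hf.trans (Asymptotics.IsBigO.of_bound 1 ?_)
  filter_upwards [eventually_ge_atTop 1] with N hN
  have hN' : (1 : ℝ) ≤ N := by exact_mod_cast hN
  rw [one_mul, Real.norm_of_nonneg (by positivity), Real.norm_of_nonneg (by positivity)]
  exact Real.rpow_le_rpow_of_exponent_le hN' h

theorem mul (hf : PowerBound p f) (hg : PowerBound q g) :
    PowerBound (p + q) fun N => f N * g N := by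
  refine (Asymptotics.IsBigO.mul hf hg).congr' EventuallyEq.rfl ?_
  filter_upwards [natCast_eventually_pos] with N hN
  rw [Real.rpow_add hN]

theorem const_mul (hf : PowerBound p f) (c : ℝ) : PowerBound p fun N => c * f N :=
  Asymptotics.IsBigO.const_mul_left hf c

theorem mul_const (hf : PowerBound p f) (c : ℝ) : PowerBound p fun N => f N * c := by
  simpa only [mul_comm] using hf.const_mul c

theorem pow (hf : PowerBound p f) (n : ℕ) : PowerBound (n * p) fun N => f N ^ n := by
  refine (Asymptotics.IsBigO.pow hf n).congr' EventuallyEq.rfl ?_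
  filter_upwards [natCast_eventually_pos] with N hN
  rw [mul_comm, Real.rpow_mul hN.le, Real.rpow_natCast]

theorem add (hf : PowerBound p f) (hg : PowerBound p g) : PowerBound p fun N => f N + g N :=
  Asymptotics.IsBigO.add hf hg

theorem const (hp : 0 ≤ p) (c : ℝ) : PowerBound p fun _ => c := by
  have h : PowerBound 0 fun _ => c := by
    unfold PowerBound
    simp only [Real.rpow_zero]
    exact Asymptotics.isBigO_const_const _ one_ne_zero _
  exact h.mono hp

theorem sum {ι : Type*} (s : Finset ι) {f : ι → ℕ → ℝ} (hf : ∀ i ∈ s, PowerBound p (f i)) :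
    PowerBound p fun N => ∑ i ∈ s, f i N :=
  Asymptotics.IsBigO.fun_sum hf

theorem rpow_const_mul {c : ℝ} (hc : 0 ≤ c) (p r : ℝ) :
    PowerBound (p * r) fun N : ℕ => (c * (N : ℝ) ^ p) ^ r := by
  refine ((powerBound_rpow (p * r)).const_mul (c ^ r)).congr_left fun N => ?_
  rw [Real.mul_rpow hc (by positivity), Real.rpow_mul (by positivity)]

theorem eventually_le (hf : PowerBound p f) (h : p < q) {c : ℝ} (hc : 0 < c) :
    ∀ᶠ N : ℕ in atTop, f N ≤ c * (N : ℝ) ^ q := by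
  have h2 : (fun N : ℕ => (N : ℝ) ^ p) =o[atTop] fun N : ℕ => (N : ℝ) ^ q := by
    refine Asymptotics.isLittleO_of_tendsto' ?_ ?_
    · filter_upwards [natCast_eventually_pos] with N hN h0
      exact absurd h0 (Real.rpow_pos_of_pos hN q).ne'
    · refine ((tendsto_rpow_neg_atTop (sub_pos.2 h)).comp tendsto_natCast_atTop_atTop).congr' ?_
      filter_upwards [natCast_eventually_pos] with N hN
      rw [Function.comp_apply, neg_sub, Real.rpow_sub hN]
  have h1 : f =o[atTop] fun N : ℕ => (N : ℝ) ^ q := Asymptotics.IsBigO.trans_isLittleO hf h2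
  filter_upwards [h1.bound hc] with N hN
  refine (le_abs_self _).trans (hN.trans_eq ?_)
  rw [Real.norm_of_nonneg (by positivity)]

end PowerBound

theorem powerBound_bracket {p : ℝ} (hp : 0 ≤ p) :
    PowerBound p fun N : ℕ => bracket N ^ p := by
  refine Asymptotics.IsBigO.of_bound (2 ^ p) ?_
  filter_upwards [eventually_ge_atTop 1] with N hN
  have hN' : (1 : ℝ) ≤ N := by exact_mod_cast hN
  rw [Real.norm_of_nonneg (bracket_rpow_pos _ _).le, Real.norm_of_nonneg (by positivity),
    ← Real.mul_rpow (by norm_num) (by positivity)]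
  refine Real.rpow_le_rpow (bracket_pos _).le ?_ hp
  refine le_of_sq_le_sq ?_ (by positivity)
  rw [bracket_sq]
  push_cast
  nlinarith

theorem energyRate_mono {K : ℕ} {μ s γ : ℝ} (hμ : 0 ≤ μ) {a : Fin K → L2R} {c : Fin K → L2C}
    {N : ℕ} {w w' Y R M : ℝ} (hw : 0 ≤ w) (hww : w ≤ w') (hY : 0 ≤ Y) (hM : 0 ≤ M) :
    energyRate μ s γ a c N w Y R M ≤ energyRate μ s γ a c N w' Y R M := by
  have h1 := cubeConst_nonneg hμ
  have h2 := sobolevConst_nonneg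
  have h3 := Real.pi_pos
  have h4 := (bracket_rpow_pos (1 - s - γ) N).le
  unfold energyRate
  gcongr

/-- Since `√M` is of order `N^{1-s}`, each factor multiplying it has to be `O(N^{1-s-ε})`. For `ψ²z`
the exponent is `4(1-s)/3 - s`, for `ψz²` it is `2(1-s)/3`, and for the smooth coupling `1 - s - γ`;
the three upper bounds on `ε` say exactly that these suffice. -/
theorem powerBound_energyRate {K : ℕ} {μ s γ ε δ : ℝ} (a : Fin K → L2R) (c : Fin K → L2C)
    (hδ : 0 < δ) (hδε : δ < ε) (hε1 : ε < (4 * s - 1) / 3) (hε2 : ε < (1 - s) / 3) (hεγ : ε < γ)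
    (hγs : γ ≤ 1 - s) {ρ : ℝ} (hρ : 0 ≤ ρ) (w D : ℝ) :
    ∃ q < 2 * (1 - s), PowerBound q fun N : ℕ => (N : ℝ) ^ δ *
      (energyRate μ s γ a c N w (D * (N : ℝ) ^ ε) (D * (N : ℝ) ^ ε)
        (ρ * (N : ℝ) ^ (2 * (1 - s))) + 1) := by
  have hs1 : 0 < 1 - s := by linarith
  refine ⟨δ + (2 * (1 - s) - ε), by linarith, ?_⟩
  refine (powerBound_rpow δ).mul (PowerBound.add ?_ (PowerBound.const (by linarith) 1))
  have hM : ∀ r : ℝ, PowerBound (2 * (1 - s) * r)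
      fun N : ℕ => (ρ * (N : ℝ) ^ (2 * (1 - s))) ^ r := fun r =>
    PowerBound.rpow_const_mul hρ (2 * (1 - s)) r
  have hY : PowerBound ε fun N : ℕ => D * (N : ℝ) ^ ε := (powerBound_rpow ε).const_mul D
  have hA : PowerBound 0 fun N : ℕ => w + (N : ℝ) ^ (-(1 - s)) * (D * (N : ℝ) ^ ε) :=
    (PowerBound.const le_rfl w).add
      (((powerBound_rpow (-(1 - s))).mul hY).mono (by linarith))
  have hsq : PowerBound (1 - s) fun N : ℕ => Real.sqrt (ρ * (N : ℝ) ^ (2 * (1 - s))) := by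
    simp only [Real.sqrt_eq_rpow]
    exact (hM (1 / 2)).mono (by linarith)
  have h1 : PowerBound (1 - s - ε) fun N : ℕ => 3 * (cubeConst μ *
      (ρ * (N : ℝ) ^ (2 * (1 - s))) ^ (2 / 3 : ℝ) *
        ((N : ℝ) ^ (-s) * (w + (N : ℝ) ^ (-(1 - s)) * (D * (N : ℝ) ^ ε)))) :=
    ((((hM (2 / 3)).const_mul _).mul ((powerBound_rpow (-s)).mul hA)).const_mul 3).mono
      (by linarith)
  have h2 : PowerBound (1 - s - ε) fun N : ℕ => 3 * (cubeConst μ *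
      (ρ * (N : ℝ) ^ (2 * (1 - s))) ^ (1 / 3 : ℝ) *
        (sobolevConst * (w + (N : ℝ) ^ (-(1 - s)) * (D * (N : ℝ) ^ ε))) ^ 2) :=
    ((((hM (1 / 3)).const_mul _).mul ((hA.const_mul _).pow 2)).const_mul 3).mono
      (by push_cast; linarith)
  have h3 : PowerBound (1 - s - ε) fun N : ℕ => μ *
      (sobolevConst * (w + (N : ℝ) ^ (-(1 - s)) * (D * (N : ℝ) ^ ε))) ^ 3 :=
    (((hA.const_mul _).pow 3).const_mul _).mono (by push_cast; linarith)
  have h4 : PowerBound (1 - s - ε) fun N : ℕ => 2 * (D * (N : ℝ) ^ ε * ∑ j, ‖a j‖) :=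
    ((hY.mul_const _).const_mul 2).mono (by linarith)
  have h5 : PowerBound (1 - s - ε) fun N : ℕ =>
      ∑ j, (bracket N ^ (1 - s - γ) * w * ‖c j‖ + ‖a j‖ * (D * (N : ℝ) ^ ε)) :=
    PowerBound.sum _ fun j _ => PowerBound.add
      ((((powerBound_bracket (by linarith)).mul_const w).mul_const _).mono (by linarith))
      ((hY.const_mul _).mono (by linarith))
  have h6 := ((hsq.const_mul (2 * Real.pi)).mul (((h1.add h2).add h3).add h4)).add
    ((hsq.const_mul (4 * Real.pi)).mul h5)
  exact h6.mono (by linarith)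

theorem energyRate_nonneg {K : ℕ} {μ s γ : ℝ} (hμ : 0 ≤ μ) (a : Fin K → L2R) (c : Fin K → L2C)
    (N : ℕ) {w Y R M : ℝ} (hw : 0 ≤ w) (hY : 0 ≤ Y) (hR : 0 ≤ R) (hM : 0 ≤ M) :
    0 ≤ energyRate μ s γ a c N w Y R M := by
  have h1 := cubeConst_nonneg hμ
  have h2 := sobolevConst_nonneg
  have h3 := Real.pi_pos
  have h4 := (bracket_rpow_pos (1 - s - γ) N).le
  have h5 : 0 ≤ ∑ j, (bracket N ^ (1 - s - γ) * w * ‖c j‖ + ‖a j‖ * Y) :=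
    Finset.sum_nonneg fun j _ => by positivity
  have h6 : 0 ≤ w + (N : ℝ) ^ (-(1 - s)) * Y := by positivity
  unfold energyRate
  positivity

/-! ### Choice of the constants and of the threshold for `N`. -/

/-- A bound for the forcing of the reservoirs in terms of the data and the noise. -/
def noiseConst {K : ℕ} (T : Fin K → ℝ) (a : Fin K → L2R) : ℝ :=
  1 + ∑ j, (4 * Real.pi * ‖a j‖ + Real.sqrt (2 * T j))

theorem one_le_noiseConst {K : ℕ} (T : Fin K → ℝ) (a : Fin K → L2R) : 1 ≤ noiseConst T a := by
  have := Real.pi_pos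
  have h : 0 ≤ ∑ j, (4 * Real.pi * ‖a j‖ + Real.sqrt (2 * T j)) :=
    Finset.sum_nonneg fun j _ => by positivity
  unfold noiseConst
  linarith

theorem abs_noise_le {K : ℕ} {s : ℝ} (hs : 0 ≤ s) (T : Fin K → ℝ) (a : Fin K → L2R) {w₀ : L2C}
    {β l x : ℝ} (hw₀ : ‖w₀‖ ≤ β) (hx : |x| ≤ l) (t : ℝ) (j : Fin K) :
    |2 * Real.pi * inner ℝ (a j) (reL (smoothing s (waveGroup t w₀ - w₀))) +
      Real.sqrt (2 * T j) * x| ≤ noiseConst T a * (β + l) := by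
  have hpi := Real.pi_pos
  have hβ : 0 ≤ β := (norm_nonneg _).trans hw₀
  have hl : 0 ≤ l := (abs_nonneg _).trans hx
  have h1 : |inner ℝ (a j) (reL (smoothing s (waveGroup t w₀ - w₀)))| ≤ ‖a j‖ * (2 * β) := by
    refine (abs_real_inner_le_norm _ _).trans ?_
    gcongr
    refine (norm_reL_le _).trans ((norm_smoothing_le hs _).trans ((norm_sub_le _ _).trans ?_))
    rw [norm_waveGroup]
    linarith
  have h2 : 4 * Real.pi * ‖a j‖ + Real.sqrt (2 * T j) ≤ noiseConst T a := by
    have h3 := Finset.single_le_sum (f := fun j => 4 * Real.pi * ‖a j‖ + Real.sqrt (2 * T j))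
      (fun j _ => by positivity) (Finset.mem_univ j)
    unfold noiseConst
    linarith
  refine (abs_add_le _ _).trans ?_
  rw [abs_mul, abs_of_pos Real.two_pi_pos, abs_mul, abs_of_nonneg (Real.sqrt_nonneg _)]
  calc 2 * Real.pi * |inner ℝ (a j) (reL (smoothing s (waveGroup t w₀ - w₀)))| +
        Real.sqrt (2 * T j) * |x|
      ≤ 2 * Real.pi * (‖a j‖ * (2 * β)) + Real.sqrt (2 * T j) * l := by gcongr
    _ ≤ (4 * Real.pi * ‖a j‖ + Real.sqrt (2 * T j)) * (β + l) := by
        have h3 : 0 ≤ 4 * Real.pi * ‖a j‖ * l := by positivity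
        have h4 : 0 ≤ Real.sqrt (2 * T j) * β := by positivity
        linarith
    _ ≤ _ := by gcongr

section Deterministic

variable {K : ℕ} {μ s γ θ δ : ℝ} {α : Fin K → Torus → ℝ} {T : Fin K → ℝ} {a : Fin K → L2R}
  {c : Fin K → L2C}

/-- For large `N`, the energy bound can only fail if the noise exceeds `N^θ`. -/
theorem exists_forall_not_energyBoundFails (hμ : 0 ≤ μ) (hs : 1 / 3 ≤ s) (hγs : γ ≤ 1 - s)
    (ha : ∀ j, (fun x => (α j x : ℂ)) =ᵐ[haarT] ofRealL (a j))
    (hc : ∀ j, ofRealL (a j) = smoothing γ (c j)) (hθ : 0 < θ) (hδ : 0 < δ)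
    (h1 : θ + δ < (4 * s - 1) / 3) (h2 : θ + δ < (1 - s) / 3) (h3 : θ + δ < γ) {R β : ℝ}
    (hR : 1 < R) (hβ : 0 < β) :
    ∃ N₀ : ℕ, ∀ (u₀ : Torus → ℂ) (w₀ : L2C) (r₀ : EuclideanSpace ℝ (Fin K)),
      u₀ =ᵐ[haarT] smoothing s w₀ → ‖r₀‖ ^ 2 + 2 * Real.pi * ‖w₀‖ ^ 2 = β ^ 2 →
      ∀ N : ℕ, N₀ ≤ N → ∀ b : ℝ, 0 ≤ b → b ≤ (N : ℝ) ^ δ → ∀ ω : ℝ → Fin K → ℝ,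
        (∀ j, ContinuousOn (fun t => ω t j) (Set.Icc 0 b)) → (∀ j, ω 0 j = 0) →
        (∀ t ∈ Set.Icc 0 b, ∀ j, |ω t j| ≤ (N : ℝ) ^ θ) →
        ¬ EnergyBoundFails μ s α T ω u₀ r₀ N b
          (ENNReal.ofReal (R * β ^ 2 * (N : ℝ) ^ (2 * (1 - s)))) := by
  have hpi := Real.pi_gt_three
  have hs1 : 0 < 1 - s := by linarith
  obtain ⟨A, hA⟩ : ∃ A, A = couplingConst a := ⟨_, rfl⟩
  obtain ⟨B, hB⟩ : ∃ B, B = noiseConst T a * (β + 1) := ⟨_, rfl⟩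
  have hn1 := one_le_noiseConst T a
  have hA0 : 0 < A := hA ▸ zero_lt_one.trans_le (one_le_couplingConst a)
  have hB0 : 0 < B := by rw [hB]; positivity
  -- `B N^θ` bounds the reservoir forcing. After a time at most `N^δ`, `D N^{θ+δ}` bounds both the
  -- forced linear field and the linear reservoirs.
  obtain ⟨D, hD⟩ : ∃ D, D = B + 2 * (β + B * A) := ⟨_, rfl⟩
  have hD0 : 0 < D := by rw [hD]; positivity
  obtain ⟨q, hq, hqb⟩ := powerBound_energyRate (μ := μ) (s := s) (γ := γ) (ε := θ + δ) (δ := δ)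
    a c hδ (by linarith) h1 h2 h3 hγs (ρ := R * β ^ 2) (by positivity) β D
  -- The budget in units of `β² N^{2(1-s)}`: one half for the main part of the initial energy, a
  -- quarter for the growth, a quarter for the initial terms bounded in `N`. The total of 1 is less
  -- than `R`.
  have ev1 := hqb.eventually_le hq (c := β ^ 2 / 4) (by positivity)
  have ev2 := (PowerBound.const le_rfl
    (β ^ 2 / 2 + μ * Real.pi / 2 * (sobolevConst ^ 3 * β ^ 4))).eventually_le
    (by linarith : 0 < 2 * (1 - s)) (c := β ^ 2 / 4) (by positivity)
  obtain ⟨N₀, hN₀⟩ := eventually_atTop.1 (ev1.and (ev2.and (eventually_ge_atTop 1)))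
  refine ⟨N₀, fun u₀ w₀ r₀ hu₀ hst N hN b hb hbN ω hω hω0 hωN => ?_⟩
  obtain ⟨e1, e2, hN1⟩ := hN₀ N hN
  have hN1' : (1 : ℝ) ≤ N := by exact_mod_cast hN1
  have hw₀ : ‖w₀‖ ≤ β := by
    refine le_of_sq_le_sq ?_ hβ.le
    nlinarith [sq_nonneg ‖r₀‖, sq_nonneg ‖w₀‖]
  have hr₀ : ‖r₀‖ ≤ β := by
    refine le_of_sq_le_sq ?_ hβ.le
    nlinarith [sq_nonneg ‖w₀‖]
  have hθ1 : 1 ≤ (N : ℝ) ^ θ := Real.one_le_rpow hN1' hθ.le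
  have hδ1 : 1 ≤ (N : ℝ) ^ δ := Real.one_le_rpow hN1' hδ.le
  have hθδ : (N : ℝ) ^ (θ + δ) = (N : ℝ) ^ θ * (N : ℝ) ^ δ := Real.rpow_add (by linarith) _ _
  have hθε : (N : ℝ) ^ θ ≤ (N : ℝ) ^ (θ + δ) :=
    Real.rpow_le_rpow_of_exponent_le hN1' (by linarith)
  have hε1 : 1 ≤ (N : ℝ) ^ (θ + δ) := hθ1.trans hθε
  obtain ⟨G, hG⟩ : ∃ G, G = noiseConst T a * (β + (N : ℝ) ^ θ) := ⟨_, rfl⟩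
  have hG0 : 0 < G := by rw [hG]; positivity
  have hGB : G ≤ B * (N : ℝ) ^ θ := by
    rw [hG, hB, mul_assoc]
    have : β + (N : ℝ) ^ θ ≤ (β + 1) * (N : ℝ) ^ θ := by nlinarith
    gcongr
  have hGA : G * A * b ≤ B * A * (N : ℝ) ^ (θ + δ) := by
    calc G * A * b ≤ B * (N : ℝ) ^ θ * A * (N : ℝ) ^ δ := by gcongr
      _ = _ := by rw [hθδ]; ring
  have hY : β + G * A * b ≤ (β + B * A) * (N : ℝ) ^ (θ + δ) := by nlinarith
  have hRY : G + 2 * (β + G * A * b) ≤ D * (N : ℝ) ^ (θ + δ) := by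
    have h4 : B * (N : ℝ) ^ θ ≤ B * (N : ℝ) ^ (θ + δ) := by gcongr
    rw [hD]
    linarith
  have hYD : β + G * A * b ≤ D * (N : ℝ) ^ (θ + δ) := by
    have h4 : 0 ≤ G * A * b := by positivity
    linarith
  have hM0 : 0 ≤ R * β ^ 2 * (N : ℝ) ^ (2 * (1 - s)) := by positivity
  -- The added 1 gives the strict inequality required by the barrier argument.
  obtain ⟨η, hη⟩ : ∃ η, η = energyRate μ s γ a c N β (D * (N : ℝ) ^ (θ + δ))
    (D * (N : ℝ) ^ (θ + δ)) (R * β ^ 2 * (N : ℝ) ^ (2 * (1 - s))) + 1 := ⟨_, rfl⟩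
  have hη0 : 0 ≤ η := by
    have := energyRate_nonneg (s := s) (γ := γ) hμ a c N hβ.le
      (by positivity : 0 ≤ D * (N : ℝ) ^ (θ + δ)) (by positivity : 0 ≤ D * (N : ℝ) ^ (θ + δ)) hM0
    linarith
  have hηb : η * b ≤ β ^ 2 / 4 * (N : ℝ) ^ (2 * (1 - s)) := by
    refine le_trans ?_ e1
    rw [← hη, mul_comm]
    gcongr
  refine not_energyBoundFails hμ hs (by linarith) (by linarith) hγs ha hc hu₀ hb hω hω0 hβ hG0
    hr₀ (fun t ht j => ?_) hN1 (hA ▸ hYD) (hA ▸ hRY) (diffEnergy_lowPower_le hμ hs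
    (by linarith) N w₀) (η := η) ?_ hη0 ?_
  · rw [hG]
    exact abs_noise_le (by linarith) T a hw₀ (hωN t ht j) t j
  · refine (energyRate_mono hμ (norm_nonneg _) hw₀ (by positivity) hM0).trans_lt ?_
    rw [hη]
    exact lt_add_one _
  · have hκ := sobolevConst_nonneg
    have h4 : Real.pi * ((1 + (N : ℝ) ^ (2 * (1 - s))) * ‖w₀‖ ^ 2) ≤
        (1 + (N : ℝ) ^ (2 * (1 - s))) * (β ^ 2 / 2) := by
      have h5 : Real.pi * ‖w₀‖ ^ 2 ≤ β ^ 2 / 2 := by linarith [sq_nonneg ‖r₀‖]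
      have h6 : 0 ≤ 1 + (N : ℝ) ^ (2 * (1 - s)) := by positivity
      calc _ = (1 + (N : ℝ) ^ (2 * (1 - s))) * (Real.pi * ‖w₀‖ ^ 2) := by ring
        _ ≤ _ := by gcongr
    have h7 : μ * Real.pi / 2 * (sobolevConst ^ 3 * ‖w₀‖ ^ 4) ≤
        μ * Real.pi / 2 * (sobolevConst ^ 3 * β ^ 4) := by gcongr
    have h8 : β ^ 2 * (N : ℝ) ^ (2 * (1 - s)) ≤ R * β ^ 2 * (N : ℝ) ^ (2 * (1 - s)) := by
      gcongr
      exact le_mul_of_one_le_left (by positivity) hR.le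
    linarith

end Deterministic

/-! ### Return to the data of the statement and the probabilistic conclusion. -/

theorem exists_ofRealL_eq_smoothing {γ γ' : ℝ} (hγ' : 0 ≤ γ') (h : γ' ≤ γ) {f : Torus → ℝ}
    (hf : MemSobolev γ (fun x => (f x : ℂ))) :
    ∃ (a : L2R) (c : L2C), (fun x => (f x : ℂ)) =ᵐ[haarT] ofRealL a ∧
      ofRealL a = smoothing γ' c := by
  obtain ⟨c, hc⟩ := hf.exists_ae (hγ'.trans h)
  refine ⟨reL (smoothing γ c), smoothing (γ - γ') c, ?_, ?_⟩
  · filter_upwards [hc, coeFn_ofRealL (reL (smoothing γ c)), coeFn_reL (smoothing γ c)]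
      with x h1 h2 h3
    rw [h2, h3, ← h1, Complex.ofReal_re]
  · rw [smoothing_add hγ' (by linarith), add_sub_cancel]
    apply Lp.ext
    filter_upwards [hc, coeFn_ofRealL (reL (smoothing γ c)), coeFn_reL (smoothing γ c)]
      with x h1 h2 h3
    rw [h2, h3, ← h1, Complex.ofReal_re]

theorem sq_eq_of_stateNorm_eq {K : ℕ} {s β : ℝ} (hs : 0 ≤ s) (hβ : 0 < β) {u₀ : Torus → ℂ}
    {w₀ : L2C} {r₀ : EuclideanSpace ℝ (Fin K)} (hu₀ : u₀ =ᵐ[haarT] smoothing s w₀)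
    (h : stateNorm s u₀ r₀ = ENNReal.ofReal β) :
    ‖r₀‖ ^ 2 + 2 * Real.pi * ‖w₀‖ ^ 2 = β ^ 2 := by
  have hpi := Real.pi_pos
  rw [stateNorm, sobolevNormSq_of_ae hs hu₀, ← ofReal_norm, ← ENNReal.ofReal_pow (norm_nonneg _),
    ← ENNReal.ofReal_add (by positivity) (by positivity),
    ENNReal.ofReal_rpow_of_nonneg (by positivity) (by norm_num), ← Real.sqrt_eq_rpow] at h
  have h1 := (ENNReal.ofReal_eq_ofReal_iff (Real.sqrt_nonneg _) hβ.le).1 h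
  rw [← h1, Real.sq_sqrt (by positivity)]

end

theorem mainTheorem2 {K : ℕ} (α : Fin K → Torus → ℝ) (T : Fin K → ℝ) (μ s γ θ δ : ℝ)
    (hγ : 0 < γ) (hα : ∀ j, MemSobolev γ (fun x => (α j x : ℂ)))
    (hT : ∀ j, 0 ≤ T j) (hμ : 0 ≤ μ) (hs : 1 / 3 ≤ s) (hs1 : s < 1)
    (hθ : 0 < θ) (hδ : 0 < δ) (hθδ : θ + δ < thetaStar s γ) :
    ∃ c : ℝ, 0 < c ∧ ∃ C : ℝ, 0 < C ∧
      ∀ R : ℝ, 1 < R → ∀ β : ℝ, 0 < β →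
        ∃ N₀ : ℕ, ∃ τ : ℝ, 0 < τ ∧
          ∀ (u₀ : Torus → ℂ) (r₀ : EuclideanSpace ℝ (Fin K)),
            MemSobolev s u₀ → stateNorm s u₀ r₀ = ENNReal.ofReal β →
            ∀ N : ℕ, N₀ ≤ N → ∀ t : ℝ, 0 < t → t ≤ τ * (N : ℝ) ^ δ →
              ∀ (Ω : Type*) [MeasurableSpace Ω] (P : Measure Ω) [IsProbabilityMeasure P]
                (W : Fin K → ℝ≥0 → Ω → ℝ), IsBrownianVector W P →
                P {ω | EnergyBoundFails μ s α T (fun t' j => W j t'.toNNReal ω) u₀ r₀ N t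
                    (ENNReal.ofReal (R * β ^ 2 * (N : ℝ) ^ (2 * (1 - s))))} ≤
                  ENNReal.ofReal
                    (C * Real.exp (-(c * (N : ℝ) ^ (2 * θ) / (t * (1 + t) ^ 2)))) := by
  have hpi := Real.pi_pos
  have h1 : θ + δ < (4 * s - 1) / 3 :=
    hθδ.trans_le ((min_le_left _ _).trans (min_le_left _ _))
  have h2 : θ + δ < (1 - s) / 3 := hθδ.trans_le ((min_le_left _ _).trans (min_le_right _ _))
  -- Smoothness of the couplings beyond `1 - s` brings no gain, so `γ` is lowered to `min γ (1 -
  -- s)`. The condition on `θ + δ` survives because `(1-s)/3 < 1 - s`.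
  have h3 : θ + δ < min γ (1 - s) :=
    lt_min (hθδ.trans_le (min_le_right _ _)) (by linarith)
  have hγ' : 0 ≤ min γ (1 - s) := by linarith
  choose a c ha hc using fun j => exists_ofRealL_eq_smoothing hγ' (min_le_left γ (1 - s)) (hα j)
  -- `1/32` and `4e^16` come from the Brownian tail bound, and `K` from the union over components.
  -- `K + 1` keeps the constant positive when there are no reservoirs.
  refine ⟨1 / 32, by norm_num, (K + 1) * (4 * Real.exp 16), by positivity,
    fun R hR β hβ => ?_⟩
  obtain ⟨N₁, hN₁⟩ := exists_forall_not_energyBoundFails (T := T) hμ hs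
    (min_le_right γ (1 - s)) ha hc hθ hδ h1 h2 h3 hR hβ
  -- `τ = 1` suffices, because the dependence on `R` and `β` is absorbed in the threshold `N₁`.
  refine ⟨N₁, 1, one_pos, fun u₀ r₀ hu₀ hst N hN t ht htN Ω _ P _ W hW => ?_⟩
  rw [one_mul] at htN
  obtain ⟨w₀, hw₀⟩ := hu₀.exists_ae (by linarith)
  have hsq := sq_eq_of_stateNorm_eq (by linarith) hβ hw₀ hst
  have htt : ((t.toNNReal : ℝ≥0) : ℝ) = t := Real.coe_toNNReal _ ht.le
  have hsub : {ω | EnergyBoundFails μ s α T (fun t' j => W j t'.toNNReal ω) u₀ r₀ N t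
      (ENNReal.ofReal (R * β ^ 2 * (N : ℝ) ^ (2 * (1 - s))))} ⊆
      ⋃ j ∈ (Finset.univ : Finset (Fin K)), {ω | ¬ (Continuous (W j · ω) ∧ W j 0 ω = 0 ∧
        ∀ t' ≤ t.toNNReal, |W j t' ω| ≤ (N : ℝ) ^ θ)} := by
    intro ω hω
    by_contra hcon
    have hgood : ∀ j, Continuous (W j · ω) ∧ W j 0 ω = 0 ∧
        ∀ t' ≤ t.toNNReal, |W j t' ω| ≤ (N : ℝ) ^ θ := fun j => by
      by_contra hj
      exact hcon (Set.mem_iUnion₂.2 ⟨j, Finset.mem_univ j, hj⟩)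
    refine hN₁ u₀ w₀ r₀ hw₀ hsq N hN t ht.le htN (fun t' j => W j t'.toNNReal ω)
      (fun j => ((hgood j).1.comp continuous_real_toNNReal).continuousOn) (fun j => ?_)
      (fun t' ht' j => (hgood j).2.2 _ (Real.toNNReal_le_toNNReal ht'.2)) hω
    rw [Real.toNNReal_zero]
    exact (hgood j).2.1
  have hNθ : (0 : ℝ) ≤ (N : ℝ) ^ θ := by positivity
  have htail := fun j => measure_brownian_le (hW.brownian j) (Real.toNNReal_pos.2 ht) hNθ
  -- Monotonicity and subadditivity hold for arbitrary sets, so measurability of the failure event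
  -- is not needed.
  refine (measure_mono hsub).trans ((measure_biUnion_finset_le _ _).trans
    ((Finset.sum_le_card_nsmul _ _ _ fun j _ => htail j).trans ?_))
  rw [Finset.card_univ, Fintype.card_fin, ← ENNReal.ofReal_nsmul, nsmul_eq_mul, htt]
  refine ENNReal.ofReal_le_ofReal ?_
  have hexp : Real.exp (-(((N : ℝ) ^ θ) ^ 2 / (32 * t))) ≤
      Real.exp (-(1 / 32 * (N : ℝ) ^ (2 * θ) / (t * (1 + t) ^ 2))) := by
    have h4 : ((N : ℝ) ^ θ) ^ 2 = (N : ℝ) ^ (2 * θ) := by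
      rw [← Real.rpow_natCast, ← Real.rpow_mul (Nat.cast_nonneg N), mul_comm]
      norm_num
    rw [h4]
    refine Real.exp_le_exp.2 (neg_le_neg ?_)
    have h5 : (N : ℝ) ^ (2 * θ) / (32 * t) = 1 / 32 * (N : ℝ) ^ (2 * θ) / t := by
      field_simp
    rw [h5]
    -- The tail bound has only `t` in the denominator; enlarging it by `(1+t)² ≥ 1` weakens the
    -- estimate to the stated form.
    refine div_le_div_of_nonneg_left (by positivity) ht ?_
    exact le_mul_of_one_le_right ht.le (one_le_pow₀ (by linarith))
  rw [mul_assoc, mul_assoc]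
  refine mul_le_mul (by linarith) ?_ (by positivity) (by positivity)
  rw [← mul_assoc]
  gcongr
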